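/- **Theorem (Metastability of the Curie–Weiss–Potts model).** Let $q\ge 2$ be an integer. For $N\in\mathbb N$ let $\mathcal S_N=\{1,\dots,q\}^N$, let $\widetilde H_N(\sigma)=-\frac1N\sum_{1\le i<j\le N}\mathbf 1_{\{\sigma_i=\sigma_j\}}$, and for $\beta\geq 0$ let $\widetilde\mu_N(\sigma)=e^{-\beta \widetilde H_N(\sigma)}/\widetilde Z_N$ be the Gibbs measure on $\mathcal S_N$. Let $(\widetilde\Sigma^N_t)_{t\in\mathbb N_0}$ be the discrete-time Markov chain on $\mathcal S_N$ with transition probabilities $\widetilde\pi_N(\sigma,\eta)=\frac1{Nq}e^{-\beta[\widetilde H_N(\eta)-\widetilde H_N(\sigma)]_+}$ if $\sigma$ and $\eta$ differ in exactly one coordinate, $\widetilde\pi_N(\sigma,\sigma)=1-\sum_{\eta\ne\sigma}\widetilde\pi_N(\sigma,\eta)$, and $\widetilde\pi_N(\sigma,\eta)=0$ otherwise. Let $\mathbb P_\nu$ denote its law with initial distribution $\nu$, and $\tau_{\mathcal A}=\inf\{t>0:\widetilde\Sigma^N_t\in\mathcal A\}$ (with $\inf\emptyset=\infty$). Let $\mathcal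 P=\{x\in[0,1]^q:\sum_k x_k=1\}$, $\mathcal P_N=\frac1N\mathbb N_0^q\cap\mathcal P$, let $L_N:\mathcal S_N\to\mathcal P_N$, $L_N(\sigma)_k=\frac1N\sum_{i=1}^N\mathbf 1_{\{\sigma_i=k\}}$, be the empirical measure, and for $\beta>0$ let $$\widetilde F_{\beta,q}(x)=-\tfrac12\sum_{k=1}^q x_k^2+\tfrac1\beta\sum_{k=1}^q x_k\log x_k,\qquad x\in\mathcal P ,$$ with $0\log 0=0$. Put $m_0=(1/q,\dots,1/q)$ and let $\beta_1(q)$ be the infimum of all $\beta>0$ for which $\widetilde F_{\beta,q}$ has a local minimum on $\mathcal P$ at a point other than $m_0$. For $i\in\{1,\dots,q\}$ let $m_i\in\mathcal P$ be the point with $i$-th coordinate $(1+(q-1)s)/q$ and all other coordinates $(1-s)/q$, where $s$ is the largest solution of $\log(1+(q-1)s)-\log(1-s)=\beta s$ in $(-\frac{1}{q-1},1)$. Let $\mathcal I_\beta=\{0,1,\dots,q\}$ if $\beta<q$ and $\mathcal I_\beta=\{1,\dots,q\}$ if $\beta\ge q$. Then for every $\beta>\beta_1(q)$ there exist $k_1=k_1(\beta,q)>0$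 and $N_0\in\mathbb N$ such that, for every $N>N_0$ and every choice of points $m_{i,N}\in\mathcal P_N$ at minimal Euclidean distance from $m_i$, $i\in\mathcal I_\beta$, the chain $(\widetilde\Sigma^N_t)$ is $e^{-k_1N}$-metastable with respect to the sets $\mathcal M_{i,N}=L_N^{-1}(m_{i,N})$, $i\in\mathcal I_\beta$. That is, these sets are non-empty and pairwise disjoint and, with $\mathcal M_N=\bigcup_{i\in\mathcal I_\beta}\mathcal M_{i,N}$, $$|\mathcal I_\beta|\,\frac{\max_{j\in\mathcal I_\beta}\mathbb P_{\widetilde\mu_N|\mathcal M_{j,N}}\big[\tau_{\mathcal M_N\setminus\mathcal M_{j,N}}<\tau_{\mathcal M_{j,N}}\big]}{\min_{\emptyset\ne\mathcal X\subset\mathcal S_N\setminus\mathcal M_N}\mathbb P_{\widetilde\mu_N|\mathcal X}\big[\tau_{\mathcal M_N}<\tau_{\mathcal X}\big]}\;\le\;e^{-k_1N},$$ where the minimum is over a non-empty family and is positive, and $\widetilde\mu_N|\mathcal X$ is $\widetilde\mu_N$ conditioned on $\mathcal X$. -/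

import Mathlib

open MeasureTheory ProbabilityTheory
open scoped NNReal ENNReal

noncomputable section

namespace MarkovChain

variable {S : Type} [Fintype S] [DecidableEq S] [MeasurableSpace S] [MeasurableSingletonClass S]

/-- The one-step kernel `σ ↦ ∑ η, P σ η • δ_η` of a stochastic matrix. -/
def stepKernel (P : Matrix.rowStochastic ℝ S) : Kernel S S :=
  Kernel.ofFunOfCountable fun σ => ∑ η, ENNReal.ofReal (P.1 σ η) • Measure.dirac η

instance (P : Matrix.rowStochastic ℝ S) : IsMarkovKernel (stepKernel P) := by
  refine ⟨fun σ => ⟨?_⟩⟩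
  have h1 : ∑ η, P.1 σ η = 1 := Matrix.sum_row_of_mem_rowStochastic P.2 σ
  have h2 : stepKernel P σ = ∑ η, ENNReal.ofReal (P.1 σ η) • Measure.dirac η := rfl
  rw [h2, Measure.finsetSum_apply]
  simp only [Measure.smul_apply, measure_univ, smul_eq_mul, mul_one]
  rw [← ENNReal.ofReal_sum_of_nonneg fun η _ => P.2.1 σ η, h1, ENNReal.ofReal_one]

/-- The law, on the space of trajectories `ℕ → S`, of the time-homogeneous Markov chain with
transition matrix `P` and initial distribution `ν`. -/
def law (P : Matrix.rowStochastic ℝ S) (ν : Measure S) : Measure (ℕ → S) :=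
  Kernel.trajMeasure (X := fun _ => S) ν fun n =>
    (stepKernel P).comap (fun x : (i : Finset.Iic n) → S => x ⟨n, Finset.mem_Iic.2 le_rfl⟩)
      (measurable_pi_apply _)

/-- The first return time `τ_A = inf {t > 0 : ω t ∈ A}`, equal to `⊤` if there is no such `t`. -/
def returnTime (A : Set S) (ω : ℕ → S) : ℕ∞ :=
  ⨅ (t : ℕ) (_ : 0 < t ∧ ω t ∈ A), (t : ℕ∞)

/-- The probability that the chain, started from `μ` conditioned on `A`, reaches `B` before it
returns to `A`, i.e. `ℙ_{μ|A}[τ_B < τ_A]`. -/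
def escapeProb (P : Matrix.rowStochastic ℝ S) (μ : Measure S) (A B : Set S) : ℝ :=
  (law P μ[|A]).real {ω | returnTime B ω < returnTime A ω}

/-- `ρ`-metastability of the chain with transition matrix `P` and invariant measure `μ` with
respect to the finite family of pairwise disjoint non-empty sets `M i`, `i : ι`. The infimum in
the denominator is over the non-empty subsets `X` of the complement of the union of the `M i`;
the supremum and the infimum are over finite types. The denominator is required to be positive, so
that the quotient is a genuine one (and the infimum is not over an empty family). -/
structure IsMetastable {ι : Type} [Fintype ι] (P : Matrix.rowStochastic ℝ S) (μ : Measure S)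
    (ρ : ℝ) (M : ι → Set S) : Prop where
  nonempty : ∀ i, (M i).Nonempty
  disjoint : Pairwise fun i j => Disjoint (M i) (M j)
  denom_pos : 0 < ⨅ X : {X : Set S // X.Nonempty ∧ X ⊆ (⋃ i, M i)ᶜ},
    escapeProb P μ X (⋃ i, M i)
  ratio_le : (Fintype.card ι : ℝ) *
      ((⨆ j, escapeProb P μ (M j) ((⋃ i, M i) \ M j)) /
        ⨅ X : {X : Set S // X.Nonempty ∧ X ⊆ (⋃ i, M i)ᶜ}, escapeProb P μ X (⋃ i, M i)) ≤ ρ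

end MarkovChain

namespace CWP

/-- Spin configurations of `N` spins with `q` colours. -/
abbrev Config (N q : ℕ) : Type := Fin N → Fin q

/-- The mean-field Hamiltonian `-(1/N) ∑_{i<j} 1{σ i = σ j}`. -/
def hamiltonian (N q : ℕ) (σ : Config N q) : ℝ :=
  -(1 / (N : ℝ)) * ∑ i, ∑ j, if i < j ∧ σ i = σ j then (1 : ℝ) else 0

/-- The Gibbs measure at inverse temperature `β`. -/
def gibbs (N q : ℕ) (β : ℝ≥0) : Measure (Config N q) :=
  ∑ σ, ENNReal.ofReal (Real.exp (-β * hamiltonian N q σ) /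
    ∑ η, Real.exp (-β * hamiltonian N q η)) • Measure.dirac σ

/-- The off-diagonal Glauber–Metropolis transition probabilities (and `0` on the diagonal). -/
def flipProb (N q : ℕ) (β : ℝ≥0) (σ η : Config N q) : ℝ :=
  if hammingDist σ η = 1 then
    ((N : ℝ) * q)⁻¹ * Real.exp (-β * max 0 (hamiltonian N q η - hamiltonian N q σ))
  else 0

/-- The Glauber–Metropolis transition probabilities. -/
def glauberMatrix (N q : ℕ) (β : ℝ≥0) : Matrix (Config N q) (Config N q) ℝ := fun σ η =>
  if σ = η then 1 - ∑ ξ ∈ Finset.univ.erase σ, flipProb N q β σ ξ else flipProb N q β σ η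

lemma flipProb_nonneg (N q : ℕ) (β : ℝ≥0) (σ η : Config N q) : 0 ≤ flipProb N q β σ η := by
  unfold flipProb; split_ifs <;> positivity

lemma card_neighbours_le (N q : ℕ) (σ : Config N q) :
    (Finset.univ.filter fun η : Config N q => hammingDist σ η = 1).card ≤ N * q := by
  have h : (Finset.univ.filter fun η : Config N q => hammingDist σ η = 1) ⊆
      (Finset.univ : Finset (Fin N × Fin q)).image fun p => Function.update σ p.1 p.2 := by
    intro η hη
    have hη' : hammingDist σ η = 1 := by simpa using hη
    obtain ⟨i, hi⟩ := Finset.card_eq_one.1 hη'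
    refine Finset.mem_image.2 ⟨(i, η i), Finset.mem_univ _, ?_⟩
    funext k
    by_cases hk : k = i
    · subst hk; simp
    · have : k ∉ Finset.univ.filter fun i => σ i ≠ η i := by rw [hi]; simpa using hk
      simpa [Function.update_of_ne hk] using this
  calc _ ≤ _ := Finset.card_le_card h
    _ ≤ _ := Finset.card_image_le
    _ = N * q := by simp

lemma sum_flipProb_le (N q : ℕ) (β : ℝ≥0) (σ : Config N q) :
    ∑ ξ ∈ Finset.univ.erase σ, flipProb N q β σ ξ ≤ 1 := by
  calc _ ≤ ∑ ξ, flipProb N q β σ ξ :=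
        Finset.sum_le_sum_of_subset_of_nonneg (Finset.erase_subset _ _)
          fun ξ _ _ => flipProb_nonneg N q β σ ξ
    _ ≤ ∑ ξ, if hammingDist σ ξ = 1 then ((N : ℝ) * q)⁻¹ else 0 := by
        refine Finset.sum_le_sum fun ξ _ => ?_
        unfold flipProb
        split_ifs
        · refine mul_le_of_le_one_right (by positivity) (Real.exp_le_one_iff.2 ?_)
          have : 0 ≤ (β : ℝ) * max 0 (hamiltonian N q ξ - hamiltonian N q σ) := by positivity
          linarith
        · exact le_rfl
    _ = ((Finset.univ.filter fun η : Config N q => hammingDist σ η = 1).card : ℝ) *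
          ((N : ℝ) * q)⁻¹ := by rw [← Finset.sum_filter, Finset.sum_const, nsmul_eq_mul]
    _ ≤ ((N : ℝ) * q) * ((N : ℝ) * q)⁻¹ := by
        refine mul_le_mul_of_nonneg_right ?_ (by positivity)
        exact_mod_cast card_neighbours_le N q σ
    _ ≤ 1 := mul_inv_le_one

/-- The Glauber–Metropolis chain, as a stochastic matrix. -/
def glauber (N q : ℕ) (β : ℝ≥0) : Matrix.rowStochastic ℝ (Config N q) :=
  ⟨glauberMatrix N q β, by
    refine Matrix.mem_rowStochastic_iff_sum.2 ⟨fun σ η => ?_, fun σ => ?_⟩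
    · unfold glauberMatrix
      split_ifs
      · linarith [sum_flipProb_le N q β σ]
      · exact flipProb_nonneg N q β σ η
    · rw [← Finset.add_sum_erase _ _ (Finset.mem_univ σ)]
      have : ∑ η ∈ Finset.univ.erase σ, glauberMatrix N q β σ η =
          ∑ η ∈ Finset.univ.erase σ, flipProb N q β σ η :=
        Finset.sum_congr rfl fun η hη => if_neg (Finset.ne_of_mem_erase hη).symm
      rw [this, glauberMatrix, if_pos rfl]
      ring⟩

/-- The empirical measure `L_N`: the vector of relative frequencies of the colours. -/
def empiricalMeasure (N q : ℕ) (σ : Config N q) : Fin q → ℝ := fun k =>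
  1 / (N : ℝ) * ∑ i, if σ i = k then (1 : ℝ) else 0

/-- The lattice `𝒫_N = (1/N) ℕ₀^q ∩ 𝒫`, where `𝒫` is the standard simplex. -/
def latticeSimplex (N q : ℕ) : Set (Fin q → ℝ) :=
  {x ∈ stdSimplex ℝ (Fin q) | ∃ n : Fin q → ℕ, ∀ k, x k = n k / N}

/-- The limiting free energy, to be read on the standard simplex (`0 * log 0 = 0`). -/
def freeEnergy (q : ℕ) (β : ℝ) (x : Fin q → ℝ) : ℝ :=
  -(1 / 2) * ∑ k, x k ^ 2 + 1 / β * ∑ k, x k * Real.log (x k)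

/-- The barycentre `m₀ = (1/q, …, 1/q)`. -/
def barycentre (q : ℕ) : Fin q → ℝ := fun _ => 1 / q

/-- The critical inverse temperature `β₁(q)` above which the free energy has local minima on the
simplex other than the barycentre. -/
def betaOne (q : ℕ) : ℝ :=
  sInf {β : ℝ | 0 < β ∧ ∃ x ∈ stdSimplex ℝ (Fin q), x ≠ barycentre q ∧
    IsLocalMinOn (freeEnergy q β) (stdSimplex ℝ (Fin q)) x}

/-- The largest solution `s` of `log (1 + (q - 1) s) - log (1 - s) = β s`. The solution set lies
below `1`, contains `0`, and has a greatest element for `q ≥ 2`. -/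
def orderParameter (q : ℕ) (β : ℝ) : ℝ :=
  sSup {s : ℝ | 0 < 1 + ((q : ℝ) - 1) * s ∧ 0 < 1 - s ∧
    Real.log (1 + ((q : ℝ) - 1) * s) - Real.log (1 - s) = β * s}

/-- The points `m₀` (index `none`) and `m_i` (index `some i`), `i` a colour. -/
def minimum (q : ℕ) (β : ℝ) : Option (Fin q) → Fin q → ℝ
  | none => barycentre q
  | some i => fun k =>
      if k = i then (1 + ((q : ℝ) - 1) * orderParameter q β) / q
      else (1 - orderParameter q β) / q

/-- The index set `I_β`: all of `{0, …, q}` if `β < q`, and `{1, …, q}` if `β ≥ q`. -/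
def indexSet (q : ℕ) (β : ℝ) : Finset (Option (Fin q)) :=
  if β < q then Finset.univ else Finset.univ.erase none

/-- `y` is a closest point of the lattice `𝒫_N` to `x`, in Euclidean distance. -/
def IsClosestLatticePoint (N q : ℕ) (x y : Fin q → ℝ) : Prop :=
  y ∈ latticeSimplex N q ∧
    ∀ z ∈ latticeSimplex N q, ∑ k, (y k - x k) ^ 2 ≤ ∑ k, (z k - x k) ^ 2

end CWP

end

/-! The chain is reversible, so escape probabilities are ratios of capacities and masses: by
`escapeProb_mul_real`, P_{μ|A}[τ_B < τ_A] μ(A) is half of `dirichlet` at the equilibrium potential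
of (A, B). Numerator and denominator then become an upper and a lower bound on Dirichlet forms.
Stirling's formula turns masses of colour classes into exp(-βN F), up to a common normalisation and
factors polynomial in N (`gibbsWeight_mul_symmetryCount_le`). Everything is thus governed by the
landscape of the free energy F on the simplex.

Landscape (`isLocalMinOn_iff`): above β₁ the local minima of F are exactly the points m_i, i ∈ I_β.
At a local minimum all coordinates are positive and share the value of log t - βt, a function
increasing before 1/β and decreasing after it. Two coordinates equal beyond 1/β would contradict
concavity there, so at most one coordinate is large and the others agree: the point lies on a ray
from the barycentre to a vertex. Along a ray, the derivative of F is a positive multiple of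
`meanField`, which is concave and then convex on [0, 1). Its sign pattern singles out the largest
zero. Jensen's inequality off the distinguished coordinate gives minimality in the full simplex. As
the minima are finitely many, each is strict and surrounded by a shell where F is larger by a fixed
amount.

Numerator (`exists_escapeProb_le`): by the Dirichlet principle, the indicator of the complement of a
ball around m_j bounds the capacity by the mass of the shell, which is exponentially small relative
to the mass of M_j.

Denominator (`one_le_mul_escapeProb`): from any configuration, the lowest configuration reachable
below level F + ε is an approximate local minimum on the lattice. By compactness it is near some m_i
(`exists_reachable_minimum`). Averaging such a path over all permutations of the sites and applying
Cauchy–Schwarz to the potential bounds the mass of X by the Dirichlet form, at a cost polynomial in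
N times exp(βNε). Since ε may be chosen below the barrier height, the quotient decays exponentially.
-/

set_option linter.unusedSectionVars false

/-! ### Path measures, return times and the equilibrium potential -/

namespace MarkovChain

variable {S : Type} [Fintype S] [DecidableEq S] [MeasurableSpace S] [MeasurableSingletonClass S]

lemma stepKernel_singleton (P : Matrix.rowStochastic ℝ S) (ξ η : S) :
    stepKernel P ξ {η} = ENNReal.ofReal (P.1 ξ η) := by
  have h : stepKernel P ξ = ∑ η, ENNReal.ofReal (P.1 ξ η) • Measure.dirac η := rfl
  rw [h, Measure.finsetSum_apply]
  simp [Set.indicator_apply]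

instance (P : Matrix.rowStochastic ℝ S) (ν : Measure S) [IsProbabilityMeasure ν] :
    IsProbabilityMeasure (law P ν) := by
  unfold law; infer_instance

lemma law_zero (P : Matrix.rowStochastic ℝ S) (ν : Measure S) [IsProbabilityMeasure ν] (ξ : S) :
    law P ν {ω | ω 0 = ξ} = ν {ξ} := by
  have h : (law P ν).map (Preorder.frestrictLe 0) =
      ν.map (MeasurableEquiv.piUnique (fun _ : Finset.Iic 0 => S)).symm := by
    rw [law, Kernel.trajMeasure, Measure.map_comp _ _ (by fun_prop),
      Kernel.traj_map_frestrictLe, Kernel.partialTraj_self, Measure.id_comp]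
  have e : {ω : ℕ → S | ω 0 = ξ} =
      (Preorder.frestrictLe (π := fun _ => S) 0) ⁻¹' {x | x ⟨0, by simp⟩ = ξ} := rfl
  have hm : MeasurableSet {x : (i : Finset.Iic 0) → S | x ⟨0, by simp⟩ = ξ} :=
    Set.Finite.measurableSet (Set.toFinite _)
  rw [e, ← Measure.map_apply (by fun_prop) hm, h, Measure.map_apply (by fun_prop) hm]
  rfl

/-- The Markov property at time `n`. -/
lemma law_succ (P : Matrix.rowStochastic ℝ S) (ν : Measure S) [IsProbabilityMeasure ν] (n : ℕ)
    (D : Set ((i : Finset.Iic n) → S)) (ξ η : S) :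
    law P ν {ω | (Preorder.frestrictLe n ω ∈ D ∧ ω n = ξ) ∧ ω (n + 1) = η} =
      law P ν {ω | Preorder.frestrictLe n ω ∈ D ∧ ω n = ξ} * ENNReal.ofReal (P.1 ξ η) := by
  set E : Set ((i : Finset.Iic n) → S) := {x | x ∈ D ∧ x ⟨n, by simp⟩ = ξ} with hE
  have hEm : MeasurableSet E := Set.Finite.measurableSet (Set.toFinite _)
  have key := Kernel.map_frestrictLe_trajMeasure_compProd_eq_map_trajMeasure (X := fun _ => S)
    (μ₀ := ν) (κ := fun n => (stepKernel P).comap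
      (fun x : (i : Finset.Iic n) → S => x ⟨n, Finset.mem_Iic.2 le_rfl⟩) (measurable_pi_apply _))
    (a := n)
  have e1 : {ω : ℕ → S | (Preorder.frestrictLe n ω ∈ D ∧ ω n = ξ) ∧ ω (n + 1) = η} =
      (fun x : ℕ → S => (Preorder.frestrictLe (π := fun _ => S) n x, x (n + 1))) ⁻¹'
        (E ×ˢ {η}) := rfl
  have e2 : {ω : ℕ → S | Preorder.frestrictLe n ω ∈ D ∧ ω n = ξ} =
      (Preorder.frestrictLe (π := fun _ => S) n) ⁻¹' E := rfl
  rw [e1, e2, ← Measure.map_apply (by fun_prop) (hEm.prod (measurableSet_singleton η)),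
    ← Measure.map_apply (by fun_prop) hEm]
  unfold law
  rw [← key, Measure.compProd_apply_prod hEm (measurableSet_singleton η)]
  rw [setLIntegral_congr_fun (g := fun _ => ENNReal.ofReal (P.1 ξ η)) hEm]
  · rw [setLIntegral_const, mul_comm]
  · intro x hx
    have : x ⟨n, by simp⟩ = ξ := hx.2
    simp only [Kernel.comap_apply]
    rw [this, stepKernel_singleton]

lemma real_eq_sum_fibers {Ω : Type*} [MeasurableSpace Ω] (μ : Measure Ω) [IsFiniteMeasure μ]
    {f : Ω → S} (hf : Measurable f) {E : Set Ω} (hE : MeasurableSet E) :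
    μ.real E = ∑ ξ, μ.real {ω | ω ∈ E ∧ f ω = ξ} := by
  rw [← measureReal_biUnion_finset]
  · congr 1; ext ω; simp
  · intro ξ _ η _ h
    refine Set.disjoint_left.2 fun ω h1 h2 => h (h1.2.symm.trans h2.2)
  · intro ξ _
    exact hE.inter (hf (measurableSet_singleton ξ))

open Classical in
/-- The substochastic matrix of the chain killed on entering `C`. -/
noncomputable def killedMatrix (P : Matrix.rowStochastic ℝ S) (C : Set S) : Matrix S S ℝ :=
  fun ξ η => if η ∈ C then 0 else P.1 ξ η

open Classical in
/-- The probability of entering `B` in one step. -/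
noncomputable def entryProb (P : Matrix.rowStochastic ℝ S) (B : Set S) (ξ : S) : ℝ :=
  ∑ η, if η ∈ B then P.1 ξ η else 0

/-- The trajectories avoiding `C` at times `1, …, n`. -/
def avoids (C : Set S) (n : ℕ) : Set (ℕ → S) := {ω | ∀ k, 1 ≤ k → k ≤ n → ω k ∉ C}

/-- The finite-dimensional version of `avoids`. -/
def avoidsUpTo (C : Set S) (n : ℕ) : Set ((i : Finset.Iic n) → S) :=
  {x | ∀ (k : ℕ) (_ : 1 ≤ k) (h : k ≤ n), x ⟨k, Finset.mem_Iic.2 h⟩ ∉ C}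

lemma mem_avoids_iff (C : Set S) (n : ℕ) (ω : ℕ → S) :
    ω ∈ avoids C n ↔ Preorder.frestrictLe n ω ∈ avoidsUpTo C n := Iff.rfl

lemma measurableSet_avoids (C : Set S) (n : ℕ) : MeasurableSet (avoids C n) := by
  have h : MeasurableSet (avoidsUpTo C n) := Set.Finite.measurableSet (Set.toFinite _)
  exact (Preorder.measurable_frestrictLe (X := fun _ => S) n) h

lemma measurableSet_avoids_and (C B : Set S) (n : ℕ) :
    MeasurableSet {ω : ℕ → S | ω ∈ avoids C n ∧ ω (n + 1) ∈ B} :=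
  (measurableSet_avoids C n).inter
    (measurable_pi_apply (n + 1) (Set.Finite.measurableSet (Set.toFinite B)))

lemma avoids_succ_iff (C : Set S) (n : ℕ) (ω : ℕ → S) :
    ω ∈ avoids C (n + 1) ↔ ω ∈ avoids C n ∧ ω (n + 1) ∉ C := by
  refine ⟨fun h => ⟨fun k h1 h2 => h k h1 (by omega), h _ (by omega) le_rfl⟩, fun h k h1 h2 => ?_⟩
  rcases Nat.lt_or_ge n k with hk | hk
  · obtain rfl : k = n + 1 := by omega
    exact h.2
  · exact h.1 k h1 hk

lemma law_real_avoids_step (P : Matrix.rowStochastic ℝ S) (ν : Measure S) [IsProbabilityMeasure ν]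
    (C : Set S) (n : ℕ) (η : S) :
    (law P ν).real {ω | ω ∈ avoids C n ∧ ω (n + 1) = η} =
      ∑ ξ, (law P ν).real {ω | ω ∈ avoids C n ∧ ω n = ξ} * P.1 ξ η := by
  have hm : MeasurableSet {ω : ℕ → S | ω ∈ avoids C n ∧ ω (n + 1) = η} :=
    measurableSet_avoids_and C {η} n
  rw [real_eq_sum_fibers (law P ν) (measurable_pi_apply n) hm]
  refine Finset.sum_congr rfl fun ξ _ => ?_
  have h := law_succ P ν n (avoidsUpTo C n) ξ η
  have e : {ω : ℕ → S | ω ∈ {ω : ℕ → S | ω ∈ avoids C n ∧ ω (n + 1) = η} ∧ ω n = ξ} =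
      {ω | (Preorder.frestrictLe (π := fun _ => S) n ω ∈ avoidsUpTo C n ∧ ω n = ξ) ∧
        ω (n + 1) = η} := by
    ext ω; simp only [Set.mem_ofPred_eq, mem_avoids_iff]; tauto
  rw [e, Measure.real, h, ENNReal.toReal_mul, ENNReal.toReal_ofReal (P.2.1 ξ η)]
  rfl

/-- Only the columns in `C` are killed, not the rows, and time 0 is unconstrained. The formula
therefore allows starting points inside `C`, as return times at strictly positive times require. -/
lemma law_real_avoids (P : Matrix.rowStochastic ℝ S) (ν : Measure S) [IsProbabilityMeasure ν]
    (C : Set S) (n : ℕ) (ξ : S) :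
    (law P ν).real {ω | ω ∈ avoids C n ∧ ω n = ξ} =
      ∑ σ, ν.real {σ} * (killedMatrix P C ^ n) σ ξ := by
  induction n generalizing ξ with
  | zero =>
    have e : {ω : ℕ → S | ω ∈ avoids C 0 ∧ ω 0 = ξ} = {ω | ω 0 = ξ} := by
      ext ω
      simp only [Set.mem_ofPred_eq, and_iff_right_iff_imp]
      intro _ k h1 h2; omega
    rw [e, Measure.real, law_zero]
    simp [Matrix.one_apply, Measure.real]
  | succ n ih =>
    by_cases hξ : ξ ∈ C
    · have e : {ω : ℕ → S | ω ∈ avoids C (n + 1) ∧ ω (n + 1) = ξ} = ∅ := by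
        ext ω
        simp only [Set.mem_ofPred_eq, avoids_succ_iff, Set.mem_empty_iff_false, iff_false]
        rintro ⟨⟨_, h⟩, rfl⟩; exact h hξ
      rw [e, measureReal_empty]
      symm
      refine Finset.sum_eq_zero fun σ _ => ?_
      rw [pow_succ, Matrix.mul_apply]
      simp [killedMatrix, hξ]
    · have e : {ω : ℕ → S | ω ∈ avoids C (n + 1) ∧ ω (n + 1) = ξ} =
          {ω | ω ∈ avoids C n ∧ ω (n + 1) = ξ} := by
        ext ω
        simp only [Set.mem_ofPred_eq, avoids_succ_iff]
        constructor
        · rintro ⟨⟨h, _⟩, h'⟩; exact ⟨h, h'⟩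
        · rintro ⟨h, rfl⟩; exact ⟨⟨h, hξ⟩, rfl⟩
      rw [e, law_real_avoids_step]
      simp only [ih, pow_succ, Matrix.mul_apply, killedMatrix, hξ, if_false, Finset.sum_mul,
        Finset.mul_sum]
      rw [Finset.sum_comm]
      simp only [mul_assoc]

lemma law_real_entry (P : Matrix.rowStochastic ℝ S) (ν : Measure S) [IsProbabilityMeasure ν]
    (C B : Set S) (n : ℕ) :
    (law P ν).real {ω | ω ∈ avoids C n ∧ ω (n + 1) ∈ B} =
      ∑ σ, ν.real {σ} * ((killedMatrix P C ^ n).mulVec (entryProb P B)) σ := by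
  classical
  have hm : MeasurableSet {ω : ℕ → S | ω ∈ avoids C n ∧ ω (n + 1) ∈ B} :=
    measurableSet_avoids_and C B n
  rw [real_eq_sum_fibers (law P ν) (measurable_pi_apply (n + 1)) hm]
  have h : ∀ η, (law P ν).real {ω | ω ∈ {ω : ℕ → S | ω ∈ avoids C n ∧ ω (n + 1) ∈ B} ∧
      ω (n + 1) = η} = ∑ σ, ∑ ξ, ν.real {σ} * ((killedMatrix P C ^ n) σ ξ *
        (if η ∈ B then P.1 ξ η else 0)) := by
    intro η
    by_cases hη : η ∈ B
    · have e : {ω | ω ∈ {ω : ℕ → S | ω ∈ avoids C n ∧ ω (n + 1) ∈ B} ∧ ω (n + 1) = η} =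
          {ω | ω ∈ avoids C n ∧ ω (n + 1) = η} := by
        ext ω
        simp only [Set.mem_ofPred_eq]
        constructor
        · rintro ⟨⟨h, _⟩, h'⟩; exact ⟨h, h'⟩
        · rintro ⟨h, rfl⟩; exact ⟨⟨h, hη⟩, rfl⟩
      rw [e, law_real_avoids_step]
      simp only [law_real_avoids, hη, if_true, Finset.sum_mul]
      rw [Finset.sum_comm]
      simp only [mul_assoc]
    · have e : {ω | ω ∈ {ω : ℕ → S | ω ∈ avoids C n ∧ ω (n + 1) ∈ B} ∧ ω (n + 1) = η} = ∅ := by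
        ext ω
        simp only [Set.mem_ofPred_eq, Set.mem_empty_iff_false, iff_false]
        rintro ⟨⟨_, h⟩, rfl⟩; exact hη h
      rw [e]; simp [hη]
  simp only [h]
  rw [Finset.sum_comm]
  refine Finset.sum_congr rfl fun σ _ => ?_
  rw [Finset.sum_comm]
  simp only [Matrix.mulVec, dotProduct, entryProb, Finset.mul_sum]

/-- The first positive time at which `A ∪ B` is visited decides the comparison. Disjointness rules
out that the entry into `B` at time `n + 1` is simultaneously a visit to `A`. -/
lemma returnTime_lt_iff {A B : Set S} (hAB : Disjoint A B) (ω : ℕ → S) :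
    returnTime B ω < returnTime A ω ↔ ∃ n, ω ∈ avoids (A ∪ B) n ∧ ω (n + 1) ∈ B := by
  classical
  constructor
  · intro h
    have h1 : ∃ t : ℕ, 0 < t ∧ ω t ∈ B := by
      by_contra hne
      push Not at hne
      have : returnTime B ω = ⊤ := by
        simp only [returnTime, iInf_eq_top]
        rintro t ⟨ht, hB⟩; exact absurd hB (hne t ht)
      rw [this] at h; exact absurd h not_top_lt
    set t := Nat.find h1 with ht
    have hts := Nat.find_spec h1
    have hB : returnTime B ω = t := by
      refine le_antisymm (iInf₂_le t hts) (le_iInf₂ fun s hs => ?_)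
      exact_mod_cast Nat.find_min' h1 hs
    refine ⟨t - 1, fun k hk1 hk2 => ?_, ?_⟩
    · rintro (hA | hB')
      · have : returnTime A ω ≤ k := iInf₂_le k ⟨by omega, hA⟩
        have h3 := lt_of_lt_of_le h this
        rw [hB] at h3
        have : t < k := by exact_mod_cast h3
        omega
      · have := Nat.find_min' h1 ⟨by omega, hB'⟩
        have := hts.1
        omega
    · have : t - 1 + 1 = t := Nat.sub_add_cancel hts.1
      rw [this]; exact hts.2
  · rintro ⟨n, hav, hB⟩
    have h1 : returnTime B ω ≤ ((n + 1 : ℕ) : ℕ∞) := iInf₂_le (n + 1) ⟨by omega, hB⟩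
    have h2 : ((n + 1 + 1 : ℕ) : ℕ∞) ≤ returnTime A ω := by
      refine le_iInf₂ fun s hs => ?_
      have : n + 1 + 1 ≤ s := by
        by_contra hlt
        rcases Nat.lt_or_ge n s with hs' | hs'
        · obtain rfl : s = n + 1 := by omega
          exact Set.disjoint_left.1 hAB hs.2 hB
        · exact hav s hs.1 hs' (Or.inl hs.2)
      exact_mod_cast this
    refine lt_of_le_of_lt h1 (lt_of_lt_of_le ?_ h2)
    exact_mod_cast Nat.lt_succ_self (n + 1)

/-- The event is split according to the time `n + 1` of the first entry into `A ∪ B`; the pieces are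
disjoint, and countable additivity turns this into a convergent series. -/
lemma hasSum_law_returnTime_lt (P : Matrix.rowStochastic ℝ S) (ν : Measure S)
    [IsProbabilityMeasure ν] {A B : Set S} (hAB : Disjoint A B) :
    HasSum (fun n => ∑ σ, ν.real {σ} *
        ((killedMatrix P (A ∪ B) ^ n).mulVec (entryProb P B)) σ)
      ((law P ν).real {ω | returnTime B ω < returnTime A ω}) := by
  have e : {ω : ℕ → S | returnTime B ω < returnTime A ω} =
      ⋃ n, {ω : ℕ → S | ω ∈ avoids (A ∪ B) n ∧ ω (n + 1) ∈ B} := by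
    ext ω; simp [returnTime_lt_iff hAB]
  have hm : ∀ n, MeasurableSet {ω : ℕ → S | ω ∈ avoids (A ∪ B) n ∧ ω (n + 1) ∈ B} := fun n =>
    measurableSet_avoids_and _ B n
  have hd : Pairwise fun m n => Disjoint {ω : ℕ → S | ω ∈ avoids (A ∪ B) m ∧ ω (m + 1) ∈ B}
      {ω : ℕ → S | ω ∈ avoids (A ∪ B) n ∧ ω (n + 1) ∈ B} := by
    have aux : ∀ m n, m < n → Disjoint {ω : ℕ → S | ω ∈ avoids (A ∪ B) m ∧ ω (m + 1) ∈ B}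
      {ω : ℕ → S | ω ∈ avoids (A ∪ B) n ∧ ω (n + 1) ∈ B} := fun m n hmn =>
      Set.disjoint_left.2 fun ω h1 h2 => h2.1 (m + 1) (by omega) (by omega) (Or.inr h1.2)
    intro m n hmn
    rcases lt_or_gt_of_ne hmn with h | h
    · exact aux m n h
    · exact (aux n m h).symm
  simp only [← law_real_entry]
  rw [e]
  have hsum := measure_iUnion (μ := law P ν) hd hm
  have hfin : (∑' n, law P ν {ω : ℕ → S | ω ∈ avoids (A ∪ B) n ∧ ω (n + 1) ∈ B}) ≠ ⊤ := by
    rw [← hsum]; exact measure_ne_top _ _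
  have h := ENNReal.hasSum_toReal hfin
  rw [← ENNReal.tsum_toReal_eq fun n => measure_ne_top _ _, ← hsum] at h
  exact h

open Classical in
/-- The equilibrium potential of `B` against `A`: `0` on `A`, `1` on `B` and the probability of
reaching `B` before `A` elsewhere. -/
noncomputable def potential (P : Matrix.rowStochastic ℝ S) (A B : Set S) (σ : S) : ℝ :=
  if σ ∈ A then 0 else if σ ∈ B then 1 else
    (law P (Measure.dirac σ)).real {ω | returnTime B ω < returnTime A ω}

lemma hasSum_reach (P : Matrix.rowStochastic ℝ S) {A B : Set S} (hAB : Disjoint A B) (σ : S) :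
    HasSum (fun n => ((killedMatrix P (A ∪ B) ^ n).mulVec (entryProb P B)) σ)
      ((law P (Measure.dirac σ)).real {ω | returnTime B ω < returnTime A ω}) := by
  have h := hasSum_law_returnTime_lt P (Measure.dirac σ) hAB
  refine Eq.mp (congrArg (fun f => HasSum f _) (funext fun n => ?_)) h
  symm
  rw [Finset.sum_eq_single σ]
  · simp [Measure.real]
  · intro τ _ hτ
    simp [Measure.real, Ne.symm hτ]
  · simp

/-- The one-step equation of the equilibrium potential. -/
lemma reach_eq_sum_potential (P : Matrix.rowStochastic ℝ S) {A B : Set S} (hAB : Disjoint A B)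
    (σ : S) : (law P (Measure.dirac σ)).real {ω | returnTime B ω < returnTime A ω} =
      ∑ η, P.1 σ η * potential P A B η := by
  classical
  set g : S → ℝ := fun σ => (law P (Measure.dirac σ)).real {ω | returnTime B ω < returnTime A ω}
    with hg
  have h0 := (hasSum_reach P hAB σ)
  -- First-step analysis: dropping the term `n = 0` from the series is the same as applying the
  -- killed matrix once to the whole series.
  have h1 : HasSum (fun n => ((killedMatrix P (A ∪ B) ^ (n + 1)).mulVec (entryProb P B)) σ)
      (∑ η, killedMatrix P (A ∪ B) σ η * g η) := by
    have : ∀ n, ((killedMatrix P (A ∪ B) ^ (n + 1)).mulVec (entryProb P B)) σ =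
        ∑ η, killedMatrix P (A ∪ B) σ η *
          ((killedMatrix P (A ∪ B) ^ n).mulVec (entryProb P B)) η := by
      intro n
      rw [pow_succ', ← Matrix.mulVec_mulVec]; rfl
    rw [funext this]
    exact hasSum_sum fun η _ => (hasSum_reach P hAB η).mul_left _
  have h2 := (hasSum_nat_add_iff' 1).2 h0
  have h3 := h2.unique h1
  simp only [Finset.range_one, Finset.sum_singleton, pow_zero, Matrix.one_mulVec] at h3
  have h4 : g σ = entryProb P B σ + ∑ η, killedMatrix P (A ∪ B) σ η * g η := by
    linarith
  change g σ = _
  rw [h4, entryProb, ← Finset.sum_add_distrib]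
  refine Finset.sum_congr rfl fun η _ => ?_
  by_cases hA : η ∈ A
  · have hB : η ∉ B := Set.disjoint_left.1 hAB hA
    simp [killedMatrix, potential, hA, hB]
  · by_cases hB : η ∈ B
    · simp [killedMatrix, potential, hA, hB]
    · simp [killedMatrix, potential, hA, hB, hg]

lemma law_real_eq_sum_reach (P : Matrix.rowStochastic ℝ S) (ν : Measure S)
    [IsProbabilityMeasure ν] {A B : Set S} (hAB : Disjoint A B) :
    (law P ν).real {ω | returnTime B ω < returnTime A ω} =
      ∑ σ, ν.real {σ} * ∑ η, P.1 σ η * potential P A B η := by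
  simp only [← reach_eq_sum_potential P hAB]
  exact (hasSum_law_returnTime_lt P ν hAB).unique
    (hasSum_sum fun σ _ => (hasSum_reach P hAB σ).mul_left _)

lemma potential_of_mem_left (P : Matrix.rowStochastic ℝ S) {A : Set S} (B : Set S) {σ : S}
    (h : σ ∈ A) : potential P A B σ = 0 := by
  simp [potential, h]

lemma potential_of_mem_right (P : Matrix.rowStochastic ℝ S) {A B : Set S} (hAB : Disjoint A B)
    {σ : S} (h : σ ∈ B) : potential P A B σ = 1 := by
  simp [potential, h, Set.disjoint_right.1 hAB h]

lemma potential_harmonic (P : Matrix.rowStochastic ℝ S) {A B : Set S} (hAB : Disjoint A B)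
    {σ : S} (hA : σ ∉ A) (hB : σ ∉ B) :
    potential P A B σ = ∑ η, P.1 σ η * potential P A B η := by
  rw [← reach_eq_sum_potential P hAB]
  simp [potential, hA, hB]

end MarkovChain

/-! ### Reversibility, the Dirichlet principle and capacities -/

namespace MarkovChain

variable {S : Type} [Fintype S] [DecidableEq S] [MeasurableSpace S] [MeasurableSingletonClass S]

/-- Twice the Dirichlet form of the chain `P` with respect to the weights `w`. -/
def dirichlet (P : Matrix.rowStochastic ℝ S) (w : S → ℝ) (u : S → ℝ) : ℝ :=
  ∑ σ, ∑ η, w σ * P.1 σ η * (u σ - u η) ^ 2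

/-- Detailed balance. -/
def IsReversible (P : Matrix.rowStochastic ℝ S) (w : S → ℝ) : Prop :=
  ∀ σ η, w σ * P.1 σ η = w η * P.1 η σ

/-- Summation by parts: exchanging the two summation variables and using detailed balance shows that
the `v η` half contributes as much as the `v σ` half. -/
lemma sum_mul_sub_mul_sub (P : Matrix.rowStochastic ℝ S) {w : S → ℝ} (hw : IsReversible P w)
    (u v : S → ℝ) :
    ∑ σ, ∑ η, w σ * P.1 σ η * ((u σ - u η) * (v σ - v η)) =
      2 * ∑ σ, w σ * v σ * (u σ - ∑ η, P.1 σ η * u η) := by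
  have h1 : ∑ σ, ∑ η, w σ * P.1 σ η * ((u σ - u η) * v σ) =
      ∑ σ, w σ * v σ * (u σ - ∑ η, P.1 σ η * u η) := by
    refine Finset.sum_congr rfl fun σ _ => ?_
    have hrow : ∑ η, P.1 σ η = 1 := Matrix.sum_row_of_mem_rowStochastic P.2 σ
    calc ∑ η, w σ * P.1 σ η * ((u σ - u η) * v σ)
        = ∑ η, (w σ * v σ * u σ * P.1 σ η - w σ * v σ * (P.1 σ η * u η)) :=
          Finset.sum_congr rfl fun η _ => by ring
      _ = w σ * v σ * u σ * ∑ η, P.1 σ η - w σ * v σ * ∑ η, P.1 σ η * u η := by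
          rw [Finset.sum_sub_distrib, Finset.mul_sum, Finset.mul_sum]
      _ = _ := by rw [hrow]; ring
  have h2 : ∑ σ, ∑ η, w σ * P.1 σ η * ((u σ - u η) * v η) =
      - ∑ σ, ∑ η, w σ * P.1 σ η * ((u σ - u η) * v σ) := by
    rw [Finset.sum_comm, ← Finset.sum_neg_distrib]
    refine Finset.sum_congr rfl fun σ _ => ?_
    rw [← Finset.sum_neg_distrib]
    refine Finset.sum_congr rfl fun η _ => ?_
    rw [hw η σ]; ring
  have h3 : ∑ σ, ∑ η, w σ * P.1 σ η * ((u σ - u η) * (v σ - v η)) =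
      ∑ σ, ∑ η, w σ * P.1 σ η * ((u σ - u η) * v σ) -
        ∑ σ, ∑ η, w σ * P.1 σ η * ((u σ - u η) * v η) := by
    rw [← Finset.sum_sub_distrib]
    refine Finset.sum_congr rfl fun σ _ => ?_
    rw [← Finset.sum_sub_distrib]
    refine Finset.sum_congr rfl fun η _ => by ring
  rw [h3, h2, h1]; ring

lemma dirichlet_eq (P : Matrix.rowStochastic ℝ S) {w : S → ℝ} (hw : IsReversible P w)
    (u : S → ℝ) :
    dirichlet P w u = 2 * ∑ σ, w σ * u σ * (u σ - ∑ η, P.1 σ η * u η) := by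
  rw [← sum_mul_sub_mul_sub P hw u u]
  refine Finset.sum_congr rfl fun σ _ => Finset.sum_congr rfl fun η _ => by ring

lemma dirichlet_nonneg (P : Matrix.rowStochastic ℝ S) {w : S → ℝ} (hw : ∀ σ, 0 ≤ w σ)
    (u : S → ℝ) : 0 ≤ dirichlet P w u :=
  Finset.sum_nonneg fun σ _ => Finset.sum_nonneg fun η _ =>
    mul_nonneg (mul_nonneg (hw σ) (P.2.1 σ η)) (sq_nonneg _)

/-- The potential is harmonic off `A ∪ B`, so a test function enters only through its boundary
values, which agree with those of the potential. -/
lemma sum_mul_potential_sub (P : Matrix.rowStochastic ℝ S) {w : S → ℝ} {A B : Set S}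
    (hAB : Disjoint A B) {v : S → ℝ} (hvA : ∀ σ ∈ A, v σ = 0)
    (hvB : ∀ σ ∈ B, v σ = 1) :
    ∑ σ, w σ * v σ * (potential P A B σ - ∑ η, P.1 σ η * potential P A B η) =
      ∑ σ, w σ * potential P A B σ *
        (potential P A B σ - ∑ η, P.1 σ η * potential P A B η) := by
  refine Finset.sum_congr rfl fun σ _ => ?_
  by_cases hA : σ ∈ A
  · rw [hvA σ hA, potential_of_mem_left P B hA]
  · by_cases hB : σ ∈ B
    · rw [hvB σ hB, potential_of_mem_right P hAB hB]
    · rw [← potential_harmonic P hAB hA hB]; ring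

/-- The Dirichlet principle: the equilibrium potential minimises the Dirichlet form. -/
lemma dirichlet_potential_le (P : Matrix.rowStochastic ℝ S) {w : S → ℝ} (hw : IsReversible P w)
    (hw0 : ∀ σ, 0 ≤ w σ) {A B : Set S} (hAB : Disjoint A B) {v : S → ℝ}
    (hvA : ∀ σ ∈ A, v σ = 0) (hvB : ∀ σ ∈ B, v σ = 1) :
    dirichlet P w (potential P A B) ≤ dirichlet P w v := by
  set u := potential P A B
  have h1 : ∑ σ, ∑ η, w σ * P.1 σ η * ((u σ - u η) * (v σ - v η)) = dirichlet P w u := by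
    rw [sum_mul_sub_mul_sub P hw, dirichlet_eq P hw, sum_mul_potential_sub P hAB hvA hvB]
  have h2 : dirichlet P w v - dirichlet P w u =
      ∑ σ, ∑ η, w σ * P.1 σ η * ((v σ - v η) - (u σ - u η)) ^ 2 := by
    have h3 : ∑ σ, ∑ η, w σ * P.1 σ η * ((v σ - v η) - (u σ - u η)) ^ 2 =
        dirichlet P w v + dirichlet P w u -
          2 * ∑ σ, ∑ η, w σ * P.1 σ η * ((u σ - u η) * (v σ - v η)) := by
      simp only [dirichlet, Finset.mul_sum, ← Finset.sum_add_distrib, ← Finset.sum_sub_distrib]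
      refine Finset.sum_congr rfl fun σ _ => Finset.sum_congr rfl fun η _ => by ring
    rw [h3, h1]; ring
  have h4 : 0 ≤ ∑ σ, ∑ η, w σ * P.1 σ η * ((v σ - v η) - (u σ - u η)) ^ 2 :=
    Finset.sum_nonneg fun σ _ => Finset.sum_nonneg fun η _ =>
      mul_nonneg (mul_nonneg (hw0 σ) (P.2.1 σ η)) (sq_nonneg _)
  linarith

open Classical in
/-- The capacity of `(A, B)` as the flux out of `A`. -/
lemma dirichlet_potential_eq (P : Matrix.rowStochastic ℝ S) {w : S → ℝ} (hw : IsReversible P w)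
    {A B : Set S} (hAB : Disjoint A B) :
    dirichlet P w (potential P A B) =
      2 * ∑ σ, if σ ∈ A then w σ * ∑ η, P.1 σ η * potential P A B η else 0 := by
  set u := potential P A B with hu
  -- Testing against the constant 1 shows that the total flux vanishes. The form is the flux at `B`,
  -- where `u = 1`, so it can be read off at `A`.
  have h1 : ∑ σ, w σ * (1 : ℝ) * (u σ - ∑ η, P.1 σ η * u η) = 0 := by
    have := sum_mul_sub_mul_sub P hw u fun _ => (1 : ℝ)
    simp only [sub_self, mul_zero, Finset.sum_const_zero] at this
    linarith
  have h2 : ∑ σ, w σ * u σ * (u σ - ∑ η, P.1 σ η * u η) -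
      (∑ σ, if σ ∈ A then w σ * ∑ η, P.1 σ η * u η else 0) =
      ∑ σ, w σ * (1 : ℝ) * (u σ - ∑ η, P.1 σ η * u η) := by
    rw [← Finset.sum_sub_distrib]
    refine Finset.sum_congr rfl fun σ _ => ?_
    by_cases hA : σ ∈ A
    · have : u σ = 0 := potential_of_mem_left P B hA
      simp [hA, this]
    · by_cases hB : σ ∈ B
      · have : u σ = 1 := potential_of_mem_right P hAB hB
        simp [hA, this]
      · have : u σ - ∑ η, P.1 σ η * u η = 0 := by
          rw [sub_eq_zero]; exact potential_harmonic P hAB hA hB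
        simp [hA, this]
  rw [dirichlet_eq P hw]
  linarith

/-- The escape probability is the capacity divided by the mass of the starting set. -/
lemma escapeProb_mul_real (P : Matrix.rowStochastic ℝ S) (μ : Measure S) [IsFiniteMeasure μ]
    (hw : IsReversible P fun σ => μ.real {σ}) {A B : Set S} (hAB : Disjoint A B)
    (hA : μ A ≠ 0) :
    escapeProb P μ A B * μ.real A =
      dirichlet P (fun σ => μ.real {σ}) (potential P A B) / 2 := by
  classical
  have := cond_isProbabilityMeasure (μ := μ) hA
  have hAm : MeasurableSet A := Set.Finite.measurableSet (Set.toFinite A)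
  have hpos : μ.real A ≠ 0 := by
    simp [Measure.real, ENNReal.toReal_eq_zero_iff, hA]
  rw [escapeProb, law_real_eq_sum_reach P _ hAB, dirichlet_potential_eq P hw hAB,
    mul_div_cancel_left₀ _ two_ne_zero, Finset.sum_mul]
  refine Finset.sum_congr rfl fun σ _ => ?_
  by_cases h : σ ∈ A
  · have e : A ∩ {σ} = {σ} := by simpa using h
    simp only [Measure.real, cond_apply hAm, e, h, if_true, ENNReal.toReal_mul, ENNReal.toReal_inv]
    simp only [Measure.real] at hpos
    field_simp
  · have e : A ∩ {σ} = ∅ := by simpa using h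
    simp [Measure.real, cond_apply hAm, e, h]

end MarkovChain

/-! ### One-variable analysis of the site energy and the mean-field function -/

namespace CWP

open Set Filter Topology

/-- The contribution of one coordinate to `β` times the free energy. -/
noncomputable def siteEnergy (β t : ℝ) : ℝ := t * Real.log t - β / 2 * t ^ 2

lemma continuous_siteEnergy (β : ℝ) : Continuous (siteEnergy β) := by
  unfold siteEnergy
  exact Real.continuous_mul_log.sub (by fun_prop)

lemma freeEnergy_eq (q : ℕ) {β : ℝ} (hβ : 0 < β) (x : Fin q → ℝ) :
    freeEnergy q β x = 1 / β * ∑ k, siteEnergy β (x k) := by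
  unfold freeEnergy siteEnergy
  rw [Finset.sum_sub_distrib, ← Finset.mul_sum]
  field_simp
  ring

lemma continuous_freeEnergy (q : ℕ) (β : ℝ) : Continuous (freeEnergy q β) := by
  unfold freeEnergy
  refine (by fun_prop : Continuous _).add (continuous_const.mul ?_)
  exact continuous_finsetSum _ fun k _ => Real.continuous_mul_log.comp (continuous_apply k)

lemma hasDerivAt_siteEnergy (β : ℝ) {t : ℝ} (ht : 0 < t) :
    HasDerivAt (siteEnergy β) (Real.log t - β * t + 1) t := by
  unfold siteEnergy
  have h1 := Real.hasDerivAt_mul_log ht.ne'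
  have h2 : HasDerivAt (fun t : ℝ => β / 2 * t ^ 2) (β / 2 * (2 * t)) t := by
    simpa using (hasDerivAt_pow 2 t).const_mul (β / 2)
  exact (h1.sub h2).congr_deriv (by ring)

lemma hasDerivAt_log_sub_mul (β : ℝ) {t : ℝ} (ht : 0 < t) :
    HasDerivAt (fun t => Real.log t - β * t) (t⁻¹ - β) t := by
  exact ((Real.hasDerivAt_log ht.ne').sub ((hasDerivAt_id t).const_mul β)).congr_deriv (by simp)

lemma strictMonoOn_log_sub_mul {β : ℝ} (hβ : 0 < β) :
    StrictMonoOn (fun t => Real.log t - β * t) (Ioc 0 (1 / β)) := by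
  refine strictMonoOn_of_deriv_pos (convex_Ioc _ _)
    (fun t ht => (hasDerivAt_log_sub_mul β ht.1).continuousAt.continuousWithinAt) fun t ht => ?_
  rw [interior_Ioc] at ht
  rw [(hasDerivAt_log_sub_mul β ht.1).deriv, sub_pos]
  rw [lt_inv_comm₀ hβ ht.1, inv_eq_one_div]; exact ht.2

lemma strictAntiOn_log_sub_mul {β : ℝ} (hβ : 0 < β) :
    StrictAntiOn (fun t => Real.log t - β * t) (Ici (1 / β)) := by
  have hp : ∀ t ∈ Ici (1 / β), 0 < t := fun t ht => lt_of_lt_of_le (by positivity) ht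
  refine strictAntiOn_of_deriv_neg (convex_Ici _)
    (fun t ht => (hasDerivAt_log_sub_mul β (hp t ht)).continuousAt.continuousWithinAt)
      fun t ht => ?_
  rw [interior_Ici] at ht
  have h0 := hp t (Ioi_subset_Ici_self ht)
  rw [(hasDerivAt_log_sub_mul β h0).deriv, sub_neg, inv_lt_comm₀ h0 hβ, inv_eq_one_div]
  exact ht

/-- Two distinct points with the same value of `log t - β t` straddle the maximiser `1 / β`. -/
lemma lt_and_lt_of_log_sub_mul_eq {β : ℝ} (hβ : 0 < β) {u v : ℝ} (hu : 0 < u) (huv : u < v)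
    (h : Real.log u - β * u = Real.log v - β * v) : u < 1 / β ∧ 1 / β < v := by
  constructor
  · by_contra! hc
    exact absurd h (ne_of_gt (strictAntiOn_log_sub_mul hβ hc (hc.trans huv.le) huv))
  · by_contra! hc
    exact absurd h (ne_of_lt (strictMonoOn_log_sub_mul hβ ⟨hu, huv.le.trans hc⟩
      ⟨hu.trans huv, hc⟩ huv))

lemma strictConvexOn_siteEnergy {β : ℝ} (hβ : 0 < β) :
    StrictConvexOn ℝ (Icc 0 (1 / β)) (siteEnergy β) := by
  refine StrictMonoOn.strictConvexOn_of_deriv (convex_Icc _ _)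
    (continuous_siteEnergy β).continuousOn ?_
  rw [interior_Icc]
  intro s hs t ht hst
  rw [(hasDerivAt_siteEnergy β hs.1).deriv, (hasDerivAt_siteEnergy β ht.1).deriv]
  have := strictMonoOn_log_sub_mul hβ ⟨hs.1, hs.2.le⟩ ⟨ht.1, ht.2.le⟩ hst
  simp only at this
  linarith

lemma strictConcaveOn_siteEnergy {β : ℝ} (hβ : 0 < β) :
    StrictConcaveOn ℝ (Ici (1 / β)) (siteEnergy β) := by
  refine StrictAntiOn.strictConcaveOn_of_deriv (convex_Ici _)
    (continuous_siteEnergy β).continuousOn ?_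
  rw [interior_Ici]
  have h0 : 0 < 1 / β := by positivity
  intro s hs t ht hst
  rw [(hasDerivAt_siteEnergy β (h0.trans hs)).deriv, (hasDerivAt_siteEnergy β (h0.trans ht)).deriv]
  have := strictAntiOn_log_sub_mul hβ (Ioi_subset_Ici_self hs) (Ioi_subset_Ici_self ht) hst
  simp only at this
  linarith

/-- The mean-field function whose zeros are the critical points on the symmetric rays. -/
noncomputable def meanField (c β s : ℝ) : ℝ := Real.log (1 + c * s) - Real.log (1 - s) - β * s

lemma hasDerivAt_meanField {c : ℝ} (β : ℝ) {s : ℝ} (h1 : 0 < 1 + c * s) (h2 : 0 < 1 - s) :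
    HasDerivAt (meanField c β) ((c + 1) / ((1 + c * s) * (1 - s)) - β) s := by
  have e1 : HasDerivAt (fun s : ℝ => 1 + c * s) c s := by
    simpa using ((hasDerivAt_id s).const_mul c).const_add 1
  have e2 : HasDerivAt (fun s : ℝ => 1 - s) (-1) s := by
    simpa using (hasDerivAt_id s).const_sub 1
  have e3 : HasDerivAt (fun s : ℝ => β * s) β s := by
    simpa using (hasDerivAt_id s).const_mul β
  have h := ((e1.log h1.ne').sub (e2.log h2.ne')).sub e3
  refine h.congr_deriv ?_
  have := h1.ne'
  have := h2.ne'
  field_simp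
  ring

lemma deriv_meanField {c : ℝ} (hc : 0 ≤ c) (β : ℝ) {s : ℝ} (h1 : 0 ≤ s) (h2 : s < 1) :
    deriv (meanField c β) s = (c + 1) / ((1 + c * s) * (1 - s)) - β :=
  (hasDerivAt_meanField β (by positivity) (by linarith)).deriv

lemma meanField_zero (c β : ℝ) : meanField c β 0 = 0 := by simp [meanField]

lemma continuousOn_meanField {c : ℝ} (hc : 0 ≤ c) (β : ℝ) :
    ContinuousOn (meanField c β) (Ico 0 1) := fun s hs =>
  (hasDerivAt_meanField β (by nlinarith [hs.1]) (by linarith [hs.2])).continuousAt.continuousWithinAt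

/-- The denominator `(1 + c s) (1 - s)` is a concave parabola with vertex at `(c - 1) / (2 c)`, so
the quotient decreases up to there. This vertex is the inflection point of `meanField`. -/
lemma meanField_deriv_strictAnti_of {c : ℝ} (hc : 1 ≤ c) (β : ℝ) {s t : ℝ} (hs : 0 ≤ s)
    (hst : s < t) (ht : t ≤ (c - 1) / (2 * c)) :
    (c + 1) / ((1 + c * t) * (1 - t)) - β < (c + 1) / ((1 + c * s) * (1 - s)) - β := by
  have hc0 : 0 < c := by linarith
  have ht' : t * (2 * c) ≤ c - 1 := (le_div_iff₀ (by positivity)).1 ht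
  have h1 : t < 1 := by nlinarith
  have hD : (1 + c * s) * (1 - s) < (1 + c * t) * (1 - t) := by
    nlinarith [mul_pos (sub_pos.2 hst) (by nlinarith : 0 < c - 1 - c * (s + t))]
  have hDs : 0 < (1 + c * s) * (1 - s) := by
    apply mul_pos <;> nlinarith
  have := div_lt_div_of_pos_left (by linarith : 0 < c + 1) hDs hD
  linarith

lemma strictConcaveOn_meanField {c : ℝ} (hc : 1 ≤ c) (β : ℝ) :
    StrictConcaveOn ℝ (Icc 0 ((c - 1) / (2 * c))) (meanField c β) := by
  have hc0 : 0 < c := by linarith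
  have hlt : (c - 1) / (2 * c) < 1 := by rw [div_lt_one (by positivity)]; linarith
  refine StrictAntiOn.strictConcaveOn_of_deriv (convex_Icc _ _)
    ((continuousOn_meanField hc0.le β).mono fun s hs => ⟨hs.1, hs.2.trans_lt hlt⟩) ?_
  rw [interior_Icc]
  intro s hs t ht hst
  rw [deriv_meanField hc0.le β hs.1.le (hs.2.trans hlt),
    deriv_meanField hc0.le β ht.1.le (ht.2.trans hlt)]
  exact meanField_deriv_strictAnti_of hc β hs.1.le hst ht.2.le

lemma strictConvexOn_meanField {c : ℝ} (hc : 1 ≤ c) (β : ℝ) :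
    StrictConvexOn ℝ (Ico ((c - 1) / (2 * c)) 1) (meanField c β) := by
  have hc0 : 0 < c := by linarith
  have hge : 0 ≤ (c - 1) / (2 * c) := div_nonneg (by linarith) (by linarith)
  refine StrictMonoOn.strictConvexOn_of_deriv (convex_Ico _ _)
    ((continuousOn_meanField hc0.le β).mono fun s hs => ⟨hge.trans hs.1, hs.2⟩) ?_
  rw [interior_Ico]
  intro s hs t ht hst
  rw [deriv_meanField hc0.le β (hge.trans hs.1.le) hs.2,
    deriv_meanField hc0.le β (hge.trans ht.1.le) ht.2]
  have hs' : c - 1 < s * (2 * c) := (div_lt_iff₀ (by positivity)).1 hs.1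
  have hD : (1 + c * t) * (1 - t) < (1 + c * s) * (1 - s) := by
    nlinarith [mul_pos (sub_pos.2 hst) (by nlinarith : 0 < c * (s + t) - (c - 1))]
  have hDt : 0 < (1 + c * t) * (1 - t) := by
    apply mul_pos
    · nlinarith [ht.1]
    · linarith [ht.2]
  have := div_lt_div_of_pos_left (by linarith : 0 < c + 1) hDt hD
  linarith

/-- For such `s` the term `-log (1 - s)` is at least `β`, which exceeds `β s`, and the other
logarithm is positive. -/
lemma meanField_pos_of_near_one {c β s : ℝ} (hc : 0 < c) (hβ : 0 < β) (hs : 0 < s) (hs1 : s < 1)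
    (h : 1 - Real.exp (-β) ≤ s) : 0 < meanField c β s := by
  have h1 : 0 < Real.log (1 + c * s) := Real.log_pos (by nlinarith)
  have h2 : Real.log (1 - s) ≤ -β := by
    rw [Real.log_le_iff_le_exp (by linarith)]; linarith
  unfold meanField
  nlinarith

/-- Before a second positive zero the mean-field function is negative just after the first. -/
lemma meanField_neg_right_of_two_zeros {c β s t : ℝ} (hc : 1 ≤ c) (hs : 0 < s) (hst : s < t)
    (ht : t < 1) (h1 : meanField c β s = 0) (h2 : meanField c β t = 0) :
    ∃ r, s < r ∧ r < 1 ∧ ∀ x ∈ Ioo s r, meanField c β x < 0 := by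
  have hge : 0 ≤ (c - 1) / (2 * c) := div_nonneg (by linarith) (by linarith)
  -- Before the inflection point, strict concavity and the zeros at 0 and `s` force negativity after
  -- `s`. Beyond it, strict convexity forces negativity between the zeros `s` and `t`.
  rcases lt_or_ge s ((c - 1) / (2 * c)) with h | h
  · refine ⟨(c - 1) / (2 * c), h, ?_, fun x hx => ?_⟩
    · rw [div_lt_one (by linarith)]; linarith
    · by_contra! hneg
      have h3 := (strictConcaveOn_meanField hc β).slope_anti_adjacent (x := 0) (y := s) (z := x)
        ⟨le_rfl, hge⟩ ⟨hs.le.trans hx.1.le, hx.2.le⟩ hs hx.1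
      rw [h1, meanField_zero] at h3
      have : 0 ≤ (meanField c β x - 0) / (x - s) :=
        div_nonneg (by linarith) (by linarith [hx.1])
      simp at h3
      simp at this
      linarith
  · refine ⟨t, hst, ht, fun x hx => ?_⟩
    have h3 := (strictConvexOn_meanField hc β).lt_on_openSegment (x := s) (y := t) (z := x)
      ⟨h, hst.trans ht⟩ ⟨h.trans hst.le, ht⟩ hst.ne (by rw [openSegment_eq_Ioo hst]; exact hx)
    rw [h1, h2, max_self] at h3
    exact h3

/-- Once negative at `s`, the mean-field function stays nonpositive up to any later zero. -/
lemma meanField_nonpos_of_neg_of_zero {c β s t : ℝ} (hc : 1 ≤ c) (hs : 0 < s) (ht : t < 1)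
    (h1 : meanField c β s < 0) (h2 : meanField c β t = 0) :
    ∀ x ∈ Icc s t, meanField c β x ≤ 0 := by
  intro x hx
  by_contra! hpos
  set p := (c - 1) / (2 * c) with hp
  have hge : 0 ≤ p := div_nonneg (by linarith) (by linarith)
  have hsx : s < x := lt_of_le_of_ne hx.1 (by rintro rfl; linarith)
  have hxt : x < t := lt_of_le_of_ne hx.2 (by rintro rfl; linarith)
  -- On the concave part, the zero at 0 and a positive value at `y` would make the value at `s`
  -- nonnegative.
  have hconc : ∀ y, s < y → y ≤ p → 0 < meanField c β y → False := by
    intro y hsy hyp hy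
    have h3 := (strictConcaveOn_meanField hc β).concaveOn.min_le_of_mem_Icc (x := 0) (y := y)
      (z := s) ⟨le_rfl, hge⟩ ⟨by linarith, hyp⟩ ⟨hs.le, hsy.le⟩
    rw [meanField_zero, min_eq_left hy.le] at h3
    linarith
  -- On the convex part, nonpositive values at `y` and at `t` would make the value at `x`
  -- nonpositive.
  have hconv : ∀ y, p ≤ y → y < x → meanField c β y ≤ 0 → False := by
    intro y hpy hyx hy
    have h3 := (strictConvexOn_meanField hc β).convexOn.le_max_of_mem_Icc (x := y) (y := t)
      (z := x) ⟨hpy, by linarith⟩ ⟨by linarith, ht⟩ ⟨hyx.le, hxt.le⟩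
    rw [h2, max_eq_right hy] at h3
    linarith
  rcases le_or_gt x p with h | h
  · exact hconc x hsx h hpos
  rcases le_or_gt p s with h' | h'
  · exact hconv s h' hsx h1.le
  · rcases le_or_gt (meanField c β p) 0 with h'' | h''
    · exact hconv p le_rfl h h''
    · exact hconc p h' le_rfl h''

/-- At or beyond the spinodal of the barycentre the mean-field function is negative near `0`. -/
lemma meanField_neg_near_zero {c β s : ℝ} (hc : 1 ≤ c) (hβ : c + 1 ≤ β) (hs : 0 < s) (hs1 : s < 1)
    (h : meanField c β s < 0) : ∃ r, 0 < r ∧ r < 1 ∧ ∀ x ∈ Ioo 0 r, meanField c β x < 0 := by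
  have hge : 0 ≤ (c - 1) / (2 * c) := div_nonneg (by linarith) (by linarith)
  have hlt : (c - 1) / (2 * c) < 1 := by rw [div_lt_one (by linarith)]; linarith
  -- If the inflection point is 0 (that is, `c = 1`), the function is convex on all of `[0, 1)` and
  -- lies below its chord from 0 to `s`. Otherwise its slope at 0 is `c + 1 - β ≤ 0` and decreases
  -- up to the inflection point.
  rcases hge.eq_or_lt with h0 | h0
  · refine ⟨s, hs, hs1, fun x hx => ?_⟩
    have h3 := @(strictConvexOn_meanField hc β).convexOn.2 0 (by simp [← h0]) s
      ⟨by linarith, hs1⟩ (1 - x / s) (x / s)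
      (by rw [sub_nonneg, div_le_one hs]; exact hx.2.le) (div_nonneg hx.1.le hs.le) (by ring)
    simp only [meanField_zero, smul_eq_mul, mul_zero, zero_add, div_mul_cancel₀ _ hs.ne'] at h3
    exact h3.trans_lt (mul_neg_of_pos_of_neg (div_pos hx.1 hs) h)
  · refine ⟨_, h0, hlt, fun x hx => ?_⟩
    have hanti : StrictAntiOn (meanField c β) (Icc 0 ((c - 1) / (2 * c))) := by
      refine strictAntiOn_of_deriv_neg (convex_Icc _ _)
        ((continuousOn_meanField (by linarith) β).mono fun s hs => ⟨hs.1, hs.2.trans_lt hlt⟩)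
        fun t ht => ?_
      rw [interior_Icc] at ht
      rw [deriv_meanField (by linarith) β ht.1.le (ht.2.trans hlt)]
      have := meanField_deriv_strictAnti_of hc β le_rfl ht.1 ht.2.le
      simp at this
      simp
      linarith
    have := hanti ⟨le_rfl, hge⟩ ⟨hx.1.le, hx.2.le⟩ hx.1
    rwa [meanField_zero] at this

/-- The largest zero of the mean-field function, beyond a point where it is negative. -/
lemma exists_isGreatest_zero_meanField {c β s : ℝ} (hc : 1 ≤ c) (hβ : 0 < β) (hs : 0 < s)
    (hs1 : s < 1) (h : meanField c β s < 0) :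
    ∃ t, s < t ∧ t < 1 ∧ meanField c β t = 0 ∧ ∀ x ∈ Ioo t 1, 0 < meanField c β x := by
  -- Beyond `r` the function is positive, so all zeros after `s` lie in the compact interval `[s,
  -- r]` and a largest one exists.
  set r := max ((s + 1) / 2) (1 - Real.exp (-β)) with hr
  have hsr : s < r := lt_of_lt_of_le (by linarith) (le_max_left _ _)
  have hr1 : r < 1 := max_lt (by linarith) (by linarith [Real.exp_pos (-β)])
  have hpos : ∀ x, r ≤ x → x < 1 → 0 < meanField c β x := fun x hx hx1 =>
    meanField_pos_of_near_one (by linarith) hβ (by linarith) hx1 ((le_max_right _ _).trans hx)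
  have hcont : ContinuousOn (meanField c β) (Icc s r) :=
    (continuousOn_meanField (by linarith) β).mono fun x hx => ⟨by linarith [hx.1], by linarith [hx.2]⟩
  set Z := Icc s r ∩ meanField c β ⁻¹' {0} with hZ
  have hcomp : IsCompact Z := isCompact_Icc.of_isClosed_subset
    (hcont.preimage_isClosed_of_isClosed isClosed_Icc isClosed_singleton) inter_subset_left
  have hne : Z.Nonempty := by
    obtain ⟨x, hx, hx0⟩ := intermediate_value_Icc hsr.le hcont ⟨h.le, (hpos r le_rfl hr1).le⟩
    exact ⟨x, hx, hx0⟩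
  obtain ⟨t, ht, htmax⟩ := hcomp.exists_isGreatest hne
  have ht0 : meanField c β t = 0 := ht.2
  refine ⟨t, lt_of_le_of_ne ht.1.1 (by rintro rfl; linarith), by linarith [ht.1.2], ht0, ?_⟩
  intro x hx
  rcases le_or_gt r x with hxr | hxr
  · exact hpos x hxr hx.2
  by_contra! hneg
  obtain ⟨y, hy, hy0⟩ := intermediate_value_Icc hxr.le
    (hcont.mono (Icc_subset_Icc_left (by linarith [ht.1.1, hx.1])))
    ⟨hneg, (hpos r le_rfl hr1).le⟩
  have : y ≤ t := htmax ⟨⟨by linarith [ht.1.1, hx.1, hy.1], hy.2⟩, hy0⟩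
  linarith [hx.1, hy.1]

end CWP

/-! ### Critical points of the free energy and the symmetric rays -/

namespace CWP

open Set Filter Topology

/-- Moving mass `t` from coordinate `b` to coordinate `a`. -/
def transfer {q : ℕ} (x : Fin q → ℝ) (a b : Fin q) (t : ℝ) : Fin q → ℝ := fun k =>
  if k = a then x a + t else if k = b then x b - t else x k

lemma sum_transfer {q : ℕ} (x : Fin q → ℝ) {a b : Fin q} (hab : a ≠ b) (t : ℝ) (f : ℝ → ℝ) :
    ∑ k, f (transfer x a b t k) =
      ∑ k, f (x k) + (f (x a + t) - f (x a)) + (f (x b - t) - f (x b)) := by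
  have h : ∑ k, (f (transfer x a b t k) - f (x k)) =
      (f (x a + t) - f (x a)) + (f (x b - t) - f (x b)) := by
    rw [← Finset.sum_subset (Finset.subset_univ {a, b}), Finset.sum_pair hab]
    · simp [transfer, hab.symm]
    · intro k _ hk
      simp only [Finset.mem_insert, Finset.mem_singleton, not_or] at hk
      simp [transfer, hk.1, hk.2]
  rw [Finset.sum_sub_distrib] at h
  linarith

lemma transfer_mem_stdSimplex {q : ℕ} {x : Fin q → ℝ} (hx : x ∈ stdSimplex ℝ (Fin q))
    {a b : Fin q} (hab : a ≠ b) {t : ℝ} (ha : 0 ≤ x a + t) (hb : 0 ≤ x b - t) :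
    transfer x a b t ∈ stdSimplex ℝ (Fin q) := by
  refine ⟨fun k => ?_, ?_⟩
  · unfold transfer
    split_ifs
    exacts [ha, hb, hx.1 k]
  · have := sum_transfer x hab t fun y => y
    rw [this, hx.2]; ring

lemma dist_transfer_le {q : ℕ} (x : Fin q → ℝ) (a b : Fin q) (t : ℝ) :
    dist (transfer x a b t) x ≤ |t| := by
  refine (dist_pi_le_iff (abs_nonneg t)).2 fun k => ?_
  unfold transfer
  split_ifs with h1 h2
  · subst h1; simp
  · subst h2; simp
  · simp

lemma exists_forall_le_of_isLocalMinOn {q : ℕ} {β : ℝ} {x : Fin q → ℝ}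
    (h : IsLocalMinOn (freeEnergy q β) (stdSimplex ℝ (Fin q)) x) :
    ∃ ε > 0, ∀ y ∈ stdSimplex ℝ (Fin q), dist y x < ε → freeEnergy q β x ≤ freeEnergy q β y := by
  obtain ⟨ε, hε, h'⟩ := Metric.mem_nhdsWithin_iff.1 h
  exact ⟨ε, hε, fun y hy hd => h' ⟨hd, hy⟩⟩

/-- Exchanging mass between two coordinates leaves all other site energies unchanged, so local
minimality in the simplex yields a one-parameter inequality. -/
lemma pair_le_of_isLocalMinOn {q : ℕ} {β : ℝ} (hβ : 0 < β) {x : Fin q → ℝ}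
    (hx : x ∈ stdSimplex ℝ (Fin q))
    (h : IsLocalMinOn (freeEnergy q β) (stdSimplex ℝ (Fin q)) x) {a b : Fin q} (hab : a ≠ b) :
    ∃ ε > 0, ∀ t, |t| < ε → 0 ≤ x a + t → 0 ≤ x b - t →
      siteEnergy β (x a) + siteEnergy β (x b) ≤
        siteEnergy β (x a + t) + siteEnergy β (x b - t) := by
  obtain ⟨ε, hε, h'⟩ := exists_forall_le_of_isLocalMinOn h
  refine ⟨ε, hε, fun t ht ha hb => ?_⟩
  have h1 := h' _ (transfer_mem_stdSimplex hx hab ha hb) ((dist_transfer_le x a b t).trans_lt ht)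
  rw [freeEnergy_eq q hβ, freeEnergy_eq q hβ, sum_transfer x hab] at h1
  have h2 := le_of_mul_le_mul_left h1 (by positivity : 0 < 1 / β)
  linarith

/-- The entropy has slope `-∞` at 0: moving a little mass to an empty coordinate strictly lowers the
free energy. -/
lemma pos_of_isLocalMinOn {q : ℕ} {β : ℝ} (hβ : 0 < β) {x : Fin q → ℝ}
    (hx : x ∈ stdSimplex ℝ (Fin q))
    (h : IsLocalMinOn (freeEnergy q β) (stdSimplex ℝ (Fin q)) x) (a : Fin q) : 0 < x a := by
  by_contra hneg
  have ha : x a = 0 := le_antisymm (not_lt.1 hneg) (hx.1 a)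
  obtain ⟨b, hb⟩ : ∃ b, 0 < x b := by
    by_contra! hall
    have : ∑ k, x k ≤ 0 := Finset.sum_nonpos fun k _ => hall k
    rw [hx.2] at this; linarith
  have hab : a ≠ b := by rintro rfl; linarith
  obtain ⟨ε, hε, hmin⟩ := pair_le_of_isLocalMinOn hβ hx h hab
  set y := x b
  -- The last bound gives `log t < log y - β y`; the entropy gained at `a` then beats the change at
  -- `b` by at least `β t ^ 2`.
  set t := min (ε / 2) (min (y / 2) (y * Real.exp (-(β * y)) / 2)) with ht
  have ht0 : 0 < t := lt_min (by linarith) (lt_min (by linarith) (by positivity))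
  have ht1 : t ≤ ε / 2 := min_le_left _ _
  have ht2 : t ≤ y / 2 := (min_le_right _ _).trans (min_le_left _ _)
  have ht3 : t ≤ y * Real.exp (-(β * y)) / 2 := (min_le_right _ _).trans (min_le_right _ _)
  have h1 := hmin t (by rw [abs_of_pos ht0]; linarith) (by linarith) (by linarith)
  rw [ha, zero_add] at h1
  have hlog : Real.log t < Real.log y - β * y := by
    have h2 : t < y * Real.exp (-(β * y)) := by
      have : 0 < y * Real.exp (-(β * y)) := by positivity
      linarith
    have := Real.log_lt_log ht0 h2
    rw [Real.log_mul hb.ne' (Real.exp_pos _).ne', Real.log_exp] at this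
    linarith
  have hlog2 : Real.log (y - t) ≤ Real.log y := Real.log_le_log (by linarith) (by linarith)
  have h3 : (y - t) * Real.log (y - t) ≤ (y - t) * Real.log y :=
    mul_le_mul_of_nonneg_left hlog2 (by linarith)
  have h4 : t * Real.log t < t * (Real.log y - β * y) := mul_lt_mul_of_pos_left hlog ht0
  simp only [siteEnergy] at h1
  nlinarith [mul_pos hβ (mul_pos ht0 ht0)]

/-- This is the Lagrange condition. Positivity of both coordinates makes the exchange possible in
both directions, so the derivative vanishes. -/
lemma log_sub_mul_eq_of_isLocalMinOn {q : ℕ} {β : ℝ} (hβ : 0 < β) {x : Fin q → ℝ}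
    (hx : x ∈ stdSimplex ℝ (Fin q))
    (h : IsLocalMinOn (freeEnergy q β) (stdSimplex ℝ (Fin q)) x) (a b : Fin q) :
    Real.log (x a) - β * x a = Real.log (x b) - β * x b := by
  rcases eq_or_ne a b with rfl | hab
  · rfl
  have ha := pos_of_isLocalMinOn hβ hx h a
  have hb := pos_of_isLocalMinOn hβ hx h b
  obtain ⟨ε, hε, hmin⟩ := pair_le_of_isLocalMinOn hβ hx h hab
  set f : ℝ → ℝ := fun t => siteEnergy β (x a + t) + siteEnergy β (x b - t) with hf
  have hloc : IsLocalMin f 0 := by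
    have : ∀ᶠ t : ℝ in 𝓝 0, |t| < min ε (min (x a) (x b)) := by
      have := Metric.ball_mem_nhds (0 : ℝ) (lt_min hε (lt_min ha hb))
      filter_upwards [this] with t ht
      simpa [Real.dist_eq] using ht
    filter_upwards [this] with t ht
    have h1 : |t| < ε := ht.trans_le (min_le_left _ _)
    have h2 : |t| < x a := ht.trans_le ((min_le_right _ _).trans (min_le_left _ _))
    have h3 : |t| < x b := ht.trans_le ((min_le_right _ _).trans (min_le_right _ _))
    have := hmin t h1 (by linarith [neg_abs_le t]) (by linarith [le_abs_self t])
    simpa [hf] using this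
  have hd : HasDerivAt f ((Real.log (x a) - β * x a + 1) * 1 +
      (Real.log (x b) - β * x b + 1) * (-1)) 0 := by
    have e1 : HasDerivAt (fun t : ℝ => x a + t) 1 0 := by
      simpa using (hasDerivAt_id (0 : ℝ)).const_add (x a)
    have e2 : HasDerivAt (fun t : ℝ => x b - t) (-1) 0 := by
      simpa using (hasDerivAt_id (0 : ℝ)).const_sub (x b)
    have g1 : HasDerivAt (siteEnergy β) (Real.log (x a) - β * x a + 1) (x a + 0) := by
      rw [add_zero]; exact hasDerivAt_siteEnergy β ha
    have g2 : HasDerivAt (siteEnergy β) (Real.log (x b) - β * x b + 1) (x b - 0) := by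
      rw [sub_zero]; exact hasDerivAt_siteEnergy β hb
    exact (g1.comp (0 : ℝ) e1).add (g2.comp (0 : ℝ) e2)
  have := hloc.hasDerivAt_eq_zero hd
  linarith

/-- At a local minimum no two coordinates coincide beyond the inflection point `1 / β`. -/
lemma le_of_isLocalMinOn_of_eq {q : ℕ} {β : ℝ} (hβ : 0 < β) {x : Fin q → ℝ}
    (hx : x ∈ stdSimplex ℝ (Fin q))
    (h : IsLocalMinOn (freeEnergy q β) (stdSimplex ℝ (Fin q)) x) {a b : Fin q} (hab : a ≠ b)
    (heq : x a = x b) : x a ≤ 1 / β := by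
  by_contra! hlt
  obtain ⟨ε, hε, hmin⟩ := pair_le_of_isLocalMinOn hβ hx h hab
  have h0 : 0 < 1 / β := by positivity
  rw [← heq] at hmin
  set v := x a
  set t := min (ε / 2) (v - 1 / β)
  have ht0 : 0 < t := lt_min (by linarith) (by linarith)
  have ht1 : t ≤ ε / 2 := min_le_left _ _
  have ht2 : t ≤ v - 1 / β := min_le_right _ _
  have h1 := hmin t (by rw [abs_of_pos ht0]; linarith) (by linarith) (by linarith)
  -- Both perturbed coordinates stay in the concave region, where spreading two equal masses apart
  -- strictly lowers the energy.
  have h2 := @(strictConcaveOn_siteEnergy hβ).2 (v + t) (mem_Ici.2 (by linarith)) (v - t)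
    (mem_Ici.2 (by linarith)) (by linarith) (1 / 2) (1 / 2) (by norm_num) (by norm_num)
    (by norm_num)
  simp only [smul_eq_mul] at h2
  rw [show 1 / 2 * (v + t) + 1 / 2 * (v - t) = v by ring] at h2
  linarith

/-- The ray from the barycentre through the vertex `i`. -/
noncomputable def ray (q : ℕ) (i : Fin q) (s : ℝ) : Fin q → ℝ := fun k =>
  if k = i then (1 + ((q : ℝ) - 1) * s) / q else (1 - s) / q

lemma sum_ray (q : ℕ) (i : Fin q) (s : ℝ) (f : ℝ → ℝ) :
    ∑ k, f (ray q i s k) =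
      f ((1 + ((q : ℝ) - 1) * s) / q) + ((q : ℝ) - 1) * f ((1 - s) / q) := by
  rw [← Finset.add_sum_erase _ _ (Finset.mem_univ i)]
  congr 1
  · simp [ray]
  · rw [Finset.sum_congr rfl (g := fun _ => f ((1 - s) / q))]
    · have : 1 ≤ q := Nat.one_le_of_lt i.2
      simp [Finset.card_erase_of_mem, Nat.cast_sub this]
    · intro k hk
      simp [ray, Finset.ne_of_mem_erase hk]

lemma ray_mem_stdSimplex {q : ℕ} (i : Fin q) {s : ℝ} (h0 : 0 ≤ s) (h1 : s ≤ 1) :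
    ray q i s ∈ stdSimplex ℝ (Fin q) := by
  have hq : 1 ≤ q := Nat.one_le_of_lt i.2
  have hq' : (1 : ℝ) ≤ q := by exact_mod_cast hq
  refine ⟨fun k => ?_, ?_⟩
  · unfold ray
    split_ifs
    · exact div_nonneg (by nlinarith) (by linarith)
    · exact div_nonneg (by linarith) (by linarith)
  · rw [sum_ray q i s fun y => y]
    field_simp
    ring

lemma ray_zero {q : ℕ} (i : Fin q) : ray q i 0 = barycentre q := by
  funext k; simp [ray, barycentre]

lemma dist_ray_le {q : ℕ} (i : Fin q) (s t : ℝ) : dist (ray q i s) (ray q i t) ≤ |s - t| := by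
  have hq : 1 ≤ q := Nat.one_le_of_lt i.2
  have hq' : (1 : ℝ) ≤ q := by exact_mod_cast hq
  refine (dist_pi_le_iff (abs_nonneg _)).2 fun k => ?_
  unfold ray
  split_ifs
  · rw [Real.dist_eq, show (1 + ((q : ℝ) - 1) * s) / q - (1 + ((q : ℝ) - 1) * t) / q =
      ((q : ℝ) - 1) / q * (s - t) by ring, abs_mul]
    refine mul_le_of_le_one_left (abs_nonneg _) ?_
    rw [abs_of_nonneg (div_nonneg (by linarith) (by linarith)), div_le_one (by linarith)]
    linarith
  · rw [Real.dist_eq, show (1 - s) / q - (1 - t) / q = 1 / q * -(s - t) by ring, abs_mul, abs_neg]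
    refine mul_le_of_le_one_left (abs_nonneg _) ?_
    rw [abs_of_nonneg (by positivity), div_le_one (by linarith)]
    linarith

/-- Local minima of the free energy lie on the rays, at zeros of the mean-field function. -/
lemma eq_ray_of_isLocalMinOn {q : ℕ} (hq : 2 ≤ q) {β : ℝ} (hβ : 0 < β) {x : Fin q → ℝ}
    (hx : x ∈ stdSimplex ℝ (Fin q))
    (h : IsLocalMinOn (freeEnergy q β) (stdSimplex ℝ (Fin q)) x) (hne : x ≠ barycentre q) :
    ∃ i s, 0 < s ∧ s < 1 ∧ x = ray q i s ∧ meanField ((q : ℝ) - 1) β s = 0 := by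
  have hq0 : (0 : ℝ) < q := by exact_mod_cast (by omega : 0 < q)
  have hpos := pos_of_isLocalMinOn hβ hx h
  have hcrit := log_sub_mul_eq_of_isLocalMinOn hβ hx h
  obtain ⟨i, j, hij⟩ : ∃ i j, x j < x i := by
    by_contra! hall
    apply hne
    funext k
    have h1 : ∑ l, x l = ∑ l : Fin q, x k :=
      Finset.sum_congr rfl fun l _ => le_antisymm (hall l k) (hall k l)
    rw [hx.2] at h1
    simp only [Finset.sum_const, Finset.card_univ, Fintype.card_fin, nsmul_eq_mul] at h1
    unfold barycentre
    field_simp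
    linarith
  have hst := lt_and_lt_of_log_sub_mul_eq hβ (hpos j) hij (hcrit j i)
  -- Since `x i > 1 / β`, another coordinate cannot equal `x i`; straddling then puts it below `1 /
  -- β`, where `log t - β t` is injective, so it equals `x j`.
  have hother : ∀ k, k ≠ i → x k = x j := by
    intro k hk
    have hki : x k ≠ x i := by
      intro he
      have := le_of_isLocalMinOn_of_eq hβ hx h hk he
      rw [he] at this
      linarith [hst.2]
    have hlt : x k < 1 / β := by
      rcases lt_or_gt_of_ne hki with hlt | hgt
      · exact (lt_and_lt_of_log_sub_mul_eq hβ (hpos k) hlt (hcrit k i)).1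
      · have := (lt_and_lt_of_log_sub_mul_eq hβ (hpos i) hgt (hcrit i k)).1
        linarith [hst.2]
    exact (strictMonoOn_log_sub_mul hβ).injOn ⟨hpos k, hlt.le⟩ ⟨hpos j, hst.1.le⟩ (hcrit k j)
  have hsum : x i + ((q : ℝ) - 1) * x j = 1 := by
    have h1 := hx.2
    rw [← Finset.add_sum_erase _ _ (Finset.mem_univ i),
      Finset.sum_congr rfl (g := fun _ => x j) fun k hk => hother k (Finset.ne_of_mem_erase hk)] at h1
    simpa [Finset.card_erase_of_mem, Nat.cast_sub (by omega : 1 ≤ q)] using h1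
  have hxj : x j = (1 - (1 - q * x j)) / q := by field_simp; ring
  have hxi : x i = (1 + ((q : ℝ) - 1) * (1 - q * x j)) / q := by
    rw [eq_div_iff hq0.ne']; nlinarith
  refine ⟨i, 1 - q * x j, ?_, ?_, ?_, ?_⟩
  · nlinarith
  · nlinarith [mul_pos hq0 (hpos j)]
  · funext k
    unfold ray
    split_ifs with hk
    · rw [hk]; exact hxi
    · rw [hother k hk]; exact hxj
  · have e1 : 1 + ((q : ℝ) - 1) * (1 - q * x j) = q * x i := by rw [hxi]; field_simp
    have e2 : 1 - (1 - q * x j) = q * x j := by ring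
    unfold meanField
    rw [e1, e2, Real.log_mul hq0.ne' (hpos i).ne', Real.log_mul hq0.ne' (hpos j).ne']
    have e3 : 1 - q * x j = x i - x j := by linarith
    rw [e3]
    linarith [hcrit i j]

/-- This links the simplex to the scalar analysis: along a ray the free energy decreases or
increases according to the sign of `meanField`. -/
lemma hasDerivAt_freeEnergy_ray {q : ℕ} {β : ℝ} (hβ : 0 < β) (i : Fin q) {s : ℝ}
    (h0 : 0 ≤ s) (h1 : s < 1) :
    HasDerivAt (fun s => freeEnergy q β (ray q i s))
      (((q : ℝ) - 1) / (β * q) * meanField ((q : ℝ) - 1) β s) s := by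
  have hq : (1 : ℝ) ≤ q := by exact_mod_cast Nat.one_le_of_lt i.2
  have hq0 : (0 : ℝ) < q := by linarith
  have hp1 : 0 < 1 + ((q : ℝ) - 1) * s := by nlinarith
  have hp2 : 0 < 1 - s := by linarith
  simp only [freeEnergy_eq q hβ, sum_ray]
  have e1 : HasDerivAt (fun s : ℝ => (1 + ((q : ℝ) - 1) * s) / q) (((q : ℝ) - 1) / q) s := by
    simpa using (((hasDerivAt_id s).const_mul ((q : ℝ) - 1)).const_add 1).div_const (q : ℝ)
  have e2 : HasDerivAt (fun s : ℝ => (1 - s) / q) (-1 / q) s := by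
    simpa using ((hasDerivAt_id s).const_sub 1).div_const (q : ℝ)
  have g1 := (hasDerivAt_siteEnergy β (div_pos hp1 hq0)).comp s e1
  have g2 := (hasDerivAt_siteEnergy β (div_pos hp2 hq0)).comp s e2
  refine ((g1.add (g2.const_mul ((q : ℝ) - 1))).const_mul (1 / β)).congr_deriv ?_
  rw [Real.log_div hp1.ne' hq0.ne', Real.log_div hp2.ne' hq0.ne']
  unfold meanField
  field_simp
  ring

lemma not_isLocalMinOn_ray {q : ℕ} (hq : 2 ≤ q) {β : ℝ} (hβ : 0 < β) (i : Fin q) {s r : ℝ}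
    (h0 : 0 ≤ s) (hsr : s < r) (hr : r < 1)
    (hneg : ∀ x ∈ Ioo s r, meanField ((q : ℝ) - 1) β x < 0) :
    ¬ IsLocalMinOn (freeEnergy q β) (stdSimplex ℝ (Fin q)) (ray q i s) := by
  intro h
  have hq' : (2 : ℝ) ≤ q := by exact_mod_cast hq
  obtain ⟨ε, hε, hmin⟩ := exists_forall_le_of_isLocalMinOn h
  have hanti : StrictAntiOn (fun s => freeEnergy q β (ray q i s)) (Icc s r) := by
    refine strictAntiOn_of_deriv_neg (convex_Icc _ _) (fun t ht =>
      (hasDerivAt_freeEnergy_ray hβ i (h0.trans ht.1)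
        (ht.2.trans_lt hr)).continuousAt.continuousWithinAt) fun t ht => ?_
    rw [interior_Icc] at ht
    rw [(hasDerivAt_freeEnergy_ray hβ i (h0.trans ht.1.le) (ht.2.trans hr)).deriv]
    exact mul_neg_of_pos_of_neg (div_pos (by linarith) (by positivity)) (hneg t ht)
  set t := min r (s + ε / 2) with ht
  have hst : s < t := lt_min hsr (by linarith)
  have htr : t ≤ r := min_le_left _ _
  have h1 := hanti ⟨le_rfl, hsr.le⟩ ⟨hst.le, htr⟩ hst
  have h2 := hmin (ray q i t) (ray_mem_stdSimplex i (by linarith) (by linarith))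
    ((dist_ray_le i t s).trans_lt (by
      rw [abs_of_pos (by linarith)]; linarith [min_le_right r (s + ε / 2)]))
  simp only at h1
  linarith

end CWP

/-! ### Classification of the local minima above the critical temperature -/

namespace CWP

open Set Filter Topology

lemma orderParameter_eq {q : ℕ} {β t : ℝ} (hq : 2 ≤ q) (h0 : 0 < t) (h1 : t < 1)
    (ht : meanField ((q : ℝ) - 1) β t = 0)
    (hmax : ∀ x ∈ Ioo t 1, meanField ((q : ℝ) - 1) β x ≠ 0) : orderParameter q β = t := by
  have hq' : (2 : ℝ) ≤ q := by exact_mod_cast hq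
  refine IsGreatest.csSup_eq ⟨⟨by nlinarith, by linarith, ?_⟩, fun s hs => ?_⟩
  · unfold meanField at ht; linarith
  · by_contra! hlt
    refine hmax s ⟨hlt, by linarith [hs.2.1]⟩ ?_
    unfold meanField; linarith [hs.2.2]

/-- For large `β` the barycentre is not a global minimiser. -/
lemma exists_isLocalMinOn_ne_barycentre {q : ℕ} (hq : 2 ≤ q) :
    ∃ β : ℝ, 0 < β ∧ ∃ x ∈ stdSimplex ℝ (Fin q), x ≠ barycentre q ∧
      IsLocalMinOn (freeEnergy q β) (stdSimplex ℝ (Fin q)) x := by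
  have hq' : (2 : ℝ) ≤ q := by exact_mod_cast hq
  have hlog : 0 < Real.log q := Real.log_pos (by linarith)
  -- If the barycentre beat a vertex, comparing energies would give `β / 2 ≤ log q + β / (2 q)`. As
  -- `q ≥ 2`, this forces `β ≤ 4 log q`.
  set β := 4 * Real.log q + 1 with hβdef
  have hβ : 0 < β := by positivity
  let i : Fin q := ⟨0, by omega⟩
  have hv : ray q i 1 ∈ stdSimplex ℝ (Fin q) := ray_mem_stdSimplex i zero_le_one le_rfl
  obtain ⟨x, hx, hmin⟩ := (isCompact_stdSimplex ℝ (Fin q)).exists_isMinOn ⟨_, hv⟩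
    (continuous_freeEnergy q β).continuousOn
  refine ⟨β, hβ, x, hx, ?_, hmin.localize⟩
  rintro rfl
  have h1 : freeEnergy q β (barycentre q) ≤ freeEnergy q β (ray q i 1) := hmin hv
  rw [← ray_zero i, freeEnergy_eq q hβ, freeEnergy_eq q hβ, sum_ray, sum_ray] at h1
  have h2 := le_of_mul_le_mul_left h1 (by positivity : 0 < 1 / β)
  have hq0 : (q : ℝ) ≠ 0 := by positivity
  simp only [siteEnergy, mul_zero, add_zero, sub_zero, mul_one, sub_self, zero_div,
    add_sub_cancel, div_self hq0, Real.log_one, Real.log_div one_ne_zero hq0] at h2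
  have h3 : -Real.log q - β / 2 / q ≤ -(β / 2) := by
    have e : 1 / (q : ℝ) * (0 - Real.log q) - β / 2 * (1 / q) ^ 2 + ((q : ℝ) - 1) *
        (1 / (q : ℝ) * (0 - Real.log q) - β / 2 * (1 / q) ^ 2) = -Real.log q - β / 2 / q := by
      field_simp; ring
    rw [e] at h2
    norm_num at h2
    linarith
  have h4 : β / 2 / q ≤ β / 4 := by
    rw [div_div, div_le_div_iff₀ (by positivity) (by norm_num)]
    nlinarith
  linarith

/-- Some smaller `β'` has a nontrivial local minimum, hence a positive zero `s` of its mean-field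
function. Passing to `β` lowers the value at `s` by `(β - β') s > 0`. -/
lemma exists_meanField_neg {q : ℕ} (hq : 2 ≤ q) {β : ℝ} (hβ : betaOne q < β) :
    0 < β ∧ ∃ s, 0 < s ∧ s < 1 ∧ meanField ((q : ℝ) - 1) β s < 0 := by
  obtain ⟨β', ⟨hβ'0, x, hx, hne, hmin⟩, hlt⟩ :=
    exists_lt_of_csInf_lt (exists_isLocalMinOn_ne_barycentre hq) hβ
  obtain ⟨i, s, hs0, hs1, -, hs⟩ := eq_ray_of_isLocalMinOn hq hβ'0 hx hmin hne
  refine ⟨hβ'0.trans hlt, s, hs0, hs1, ?_⟩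
  unfold meanField at *
  nlinarith

/-- Above `β₁` the order parameter is the place of the last sign change of the mean-field
function. -/
lemma orderParameter_spec {q : ℕ} (hq : 2 ≤ q) {β : ℝ} (hβ : betaOne q < β) :
    ∃ s, 0 < s ∧ s < orderParameter q β ∧ orderParameter q β < 1 ∧
      meanField ((q : ℝ) - 1) β s < 0 ∧
      meanField ((q : ℝ) - 1) β (orderParameter q β) = 0 ∧
      (∀ x ∈ Icc s (orderParameter q β), meanField ((q : ℝ) - 1) β x ≤ 0) ∧
      ∀ x ∈ Ioo (orderParameter q β) 1, 0 < meanField ((q : ℝ) - 1) β x := by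
  have hc : (1 : ℝ) ≤ (q : ℝ) - 1 := by
    have : (2 : ℝ) ≤ q := by exact_mod_cast hq
    linarith
  obtain ⟨hβ0, s, hs0, hs1, hneg⟩ := exists_meanField_neg hq hβ
  obtain ⟨t, hst, ht1, ht, hpos⟩ := exists_isGreatest_zero_meanField hc hβ0 hs0 hs1 hneg
  have e := orderParameter_eq hq (hs0.trans hst) ht1 ht fun x hx => (hpos x hx).ne'
  rw [e]
  exact ⟨s, hs0, hst, ht1, hneg, ht, meanField_nonpos_of_neg_of_zero hc hs0 ht1 hneg ht, hpos⟩

/-- Jensen's inequality on `[0, 1 / β]`, where the site energy is convex: equalising small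
coordinates does not raise the energy. -/
lemma card_mul_siteEnergy_le {ι : Type*} (t : Finset ι) (ht : t.Nonempty) {β : ℝ} (hβ : 0 < β)
    {x : ι → ℝ} (hx : ∀ k ∈ t, x k ∈ Icc 0 (1 / β)) :
    t.card * siteEnergy β ((∑ k ∈ t, x k) / t.card) ≤ ∑ k ∈ t, siteEnergy β (x k) := by
  have hc : (0 : ℝ) < t.card := by exact_mod_cast ht.card_pos
  have h := (strictConvexOn_siteEnergy hβ).convexOn.map_sum_le (t := t)
    (w := fun _ => 1 / (t.card : ℝ)) (p := x) (fun _ _ => by positivity)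
    (by rw [Finset.sum_const, nsmul_eq_mul]; field_simp) hx
  simp only [smul_eq_mul, ← Finset.mul_sum] at h
  rw [div_eq_inv_mul, ← one_div]
  calc t.card * siteEnergy β (1 / (t.card : ℝ) * ∑ k ∈ t, x k)
      ≤ t.card * (1 / (t.card : ℝ) * ∑ k ∈ t, siteEnergy β (x k)) :=
        mul_le_mul_of_nonneg_left h hc.le
    _ = _ := by field_simp

lemma isLocalMinOn_of_forall_dist {q : ℕ} {β : ℝ} {x : Fin q → ℝ} {ε : ℝ} (hε : 0 < ε)
    (h : ∀ y ∈ stdSimplex ℝ (Fin q), dist y x < ε → freeEnergy q β x ≤ freeEnergy q β y) :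
    IsLocalMinOn (freeEnergy q β) (stdSimplex ℝ (Fin q)) x :=
  Metric.mem_nhdsWithin_iff.2 ⟨ε, hε, fun y hy => h y hy.2 hy.1⟩

/-- For `β < q` the value `1 / q` lies below `1 / β`, so near the barycentre all coordinates stay in
the convex region and Jensen's inequality applies to all of them at once. -/
lemma isLocalMinOn_barycentre {q : ℕ} (hq : 2 ≤ q) {β : ℝ} (hβ : 0 < β) (hβq : β < q) :
    IsLocalMinOn (freeEnergy q β) (stdSimplex ℝ (Fin q)) (barycentre q) := by
  have hq0 : (0 : ℝ) < q := by exact_mod_cast (by omega : 0 < q)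
  have hgap : 1 / (q : ℝ) < 1 / β := one_div_lt_one_div_of_lt hβ hβq
  refine isLocalMinOn_of_forall_dist (sub_pos.2 hgap) fun y hy hd => ?_
  have hne : (Finset.univ : Finset (Fin q)).Nonempty := ⟨⟨0, by omega⟩, Finset.mem_univ _⟩
  have h := card_mul_siteEnergy_le Finset.univ hne hβ (x := y) fun k _ => ⟨hy.1 k, ?_⟩
  · rw [hy.2, Finset.card_univ, Fintype.card_fin] at h
    rw [freeEnergy_eq q hβ, freeEnergy_eq q hβ]
    refine mul_le_mul_of_nonneg_left ?_ (by positivity)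
    simpa [barycentre] using h
  · have h1 : dist (y k) (barycentre q k) < 1 / β - 1 / q := (dist_le_pi_dist y _ k).trans_lt hd
    rw [Real.dist_eq] at h1
    have := le_abs_self (y k - barycentre q k)
    simp only [barycentre] at *
    linarith

/-- Averaging all coordinates other than `i` projects `y` onto the ray. The parameter solves `y i =
(1 + (q - 1) s) / q`. -/
lemma freeEnergy_ray_le {q : ℕ} (hq : 2 ≤ q) {β : ℝ} (hβ : 0 < β) (i : Fin q)
    {y : Fin q → ℝ} (hy : y ∈ stdSimplex ℝ (Fin q)) (hle : ∀ k, k ≠ i → y k ≤ 1 / β) :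
    freeEnergy q β (ray q i ((q * y i - 1) / ((q : ℝ) - 1))) ≤ freeEnergy q β y := by
  have hq' : (2 : ℝ) ≤ q := by exact_mod_cast hq
  have hq1 : (q : ℝ) - 1 ≠ 0 := by linarith
  have hcard : ((Finset.univ.erase i).card : ℝ) = (q : ℝ) - 1 := by
    simp [Finset.card_erase_of_mem, Nat.cast_sub (by omega : 1 ≤ q)]
  have hne : (Finset.univ.erase i).Nonempty := by
    rw [← Finset.card_pos]; simp [Finset.card_erase_of_mem]; omega
  have h := card_mul_siteEnergy_le _ hne hβ (x := y)
    fun k hk => ⟨hy.1 k, hle k (Finset.ne_of_mem_erase hk)⟩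
  rw [hcard] at h
  have hsum : ∑ k ∈ Finset.univ.erase i, y k = 1 - y i := by
    have := Finset.add_sum_erase Finset.univ y (Finset.mem_univ i)
    rw [hy.2] at this; linarith
  rw [hsum] at h
  rw [freeEnergy_eq q hβ, freeEnergy_eq q hβ, sum_ray,
    ← Finset.add_sum_erase _ _ (Finset.mem_univ i)]
  refine mul_le_mul_of_nonneg_left ?_ (by positivity)
  have e1 : (1 + ((q : ℝ) - 1) * ((q * y i - 1) / ((q : ℝ) - 1))) / q = y i := by
    field_simp; ring
  have e2 : (1 - (q * y i - 1) / ((q : ℝ) - 1)) / q = (1 - y i) / ((q : ℝ) - 1) := by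
    field_simp; ring
  rw [e1, e2]
  linarith

/-- Projection to the ray lowers the energy because the small coordinates lie in the convex region.
On the ray, `meanField` is nonpositive just before the order parameter and positive after it. -/
lemma isLocalMinOn_ray_orderParameter {q : ℕ} (hq : 2 ≤ q) {β : ℝ} (hβ : betaOne q < β)
    (i : Fin q) :
    IsLocalMinOn (freeEnergy q β) (stdSimplex ℝ (Fin q)) (ray q i (orderParameter q β)) := by
  have hq' : (2 : ℝ) ≤ q := by exact_mod_cast hq
  have hq0 : (0 : ℝ) < q := by linarith
  have hβ0 := (exists_meanField_neg hq hβ).1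
  obtain ⟨s, hs0, hst, ht1, -, hzero, hnonpos, hpos⟩ := orderParameter_spec hq hβ
  set t := orderParameter q β
  have ht0 : 0 < t := hs0.trans hst
  -- A zero of `meanField` is exactly the Lagrange condition for the two coordinate values, which
  -- therefore straddle `1 / β`.
  have hu : (1 - t) / q < 1 / β := by
    refine (lt_and_lt_of_log_sub_mul_eq hβ0 (v := (1 + ((q : ℝ) - 1) * t) / q)
      (div_pos (by linarith) hq0) ?_ ?_).1
    · exact div_lt_div_of_pos_right (by nlinarith) hq0
    · have hp1 : 0 < 1 + ((q : ℝ) - 1) * t := by nlinarith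
      have hp2 : 0 < 1 - t := by linarith
      rw [Real.log_div hp1.ne' hq0.ne', Real.log_div hp2.ne' hq0.ne']
      unfold meanField at hzero
      have : β * ((1 + ((q : ℝ) - 1) * t) / q) - β * ((1 - t) / q) = β * t := by
        field_simp; ring
      linarith
  have hcoef : 0 ≤ ((q : ℝ) - 1) / (β * q) := div_nonneg (by linarith) (by positivity)
  have hf : ∀ r, s ≤ r → r < 1 → freeEnergy q β (ray q i t) ≤ freeEnergy q β (ray q i r) := by
    intro r hsr hr1
    rcases le_total r t with hrt | hrt
    · have hanti : AntitoneOn (fun s => freeEnergy q β (ray q i s)) (Icc s t) := by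
        refine antitoneOn_of_deriv_nonpos (convex_Icc _ _) (fun x hx =>
          (hasDerivAt_freeEnergy_ray hβ0 i (hs0.le.trans hx.1)
            (hx.2.trans_lt ht1)).continuousAt.continuousWithinAt) (fun x hx => ?_) fun x hx => ?_
        · rw [interior_Icc] at hx
          exact (hasDerivAt_freeEnergy_ray hβ0 i (hs0.le.trans hx.1.le)
            (hx.2.trans ht1)).differentiableAt.differentiableWithinAt
        · rw [interior_Icc] at hx
          rw [(hasDerivAt_freeEnergy_ray hβ0 i (hs0.le.trans hx.1.le) (hx.2.trans ht1)).deriv]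
          exact mul_nonpos_of_nonneg_of_nonpos hcoef (hnonpos x ⟨hx.1.le, hx.2.le⟩)
      exact hanti ⟨hsr, hrt⟩ ⟨hst.le, le_rfl⟩ hrt
    · have hmono : MonotoneOn (fun s => freeEnergy q β (ray q i s)) (Ico t 1) := by
        refine monotoneOn_of_deriv_nonneg (convex_Ico _ _) (fun x hx =>
          (hasDerivAt_freeEnergy_ray hβ0 i (ht0.le.trans hx.1)
            hx.2).continuousAt.continuousWithinAt) (fun x hx => ?_) fun x hx => ?_
        · rw [interior_Ico] at hx
          exact (hasDerivAt_freeEnergy_ray hβ0 i (ht0.le.trans hx.1.le)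
            hx.2).differentiableAt.differentiableWithinAt
        · rw [interior_Ico] at hx
          rw [(hasDerivAt_freeEnergy_ray hβ0 i (ht0.le.trans hx.1.le) hx.2).deriv]
          exact mul_nonneg hcoef (hpos x hx).le
      exact hmono ⟨le_rfl, ht1⟩ ⟨hrt, hr1⟩ hrt
  set ε := min (1 / β - (1 - t) / q) (min ((t - s) / 2) ((1 - t) / 2)) with hε
  have hε0 : 0 < ε := lt_min (by linarith) (lt_min (by linarith) (by linarith))
  have hε1 : ε ≤ 1 / β - (1 - t) / q := min_le_left _ _
  have hε2 : ε ≤ (t - s) / 2 := (min_le_right _ _).trans (min_le_left _ _)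
  have hε3 : ε ≤ (1 - t) / 2 := (min_le_right _ _).trans (min_le_right _ _)
  refine isLocalMinOn_of_forall_dist hε0 fun y hy hd => ?_
  have hdk : ∀ k, |y k - ray q i t k| < ε := fun k => by
    rw [← Real.dist_eq]; exact (dist_le_pi_dist y _ k).trans_lt hd
  refine (hf ((q * y i - 1) / ((q : ℝ) - 1)) ?_ ?_).trans (freeEnergy_ray_le hq hβ0 i hy ?_)
  · have h1 := (abs_lt.1 (hdk i)).1
    simp only [ray, if_true] at h1
    have h2 : (1 + ((q : ℝ) - 1) * t) / q - (t - s) / 2 < y i := by linarith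
    have h3 : (1 + ((q : ℝ) - 1) * t) - q * ((t - s) / 2) < q * y i := by
      have := mul_lt_mul_of_pos_left h2 hq0
      rwa [mul_sub, mul_div_cancel₀ _ hq0.ne'] at this
    rw [le_div_iff₀ (by linarith)]
    nlinarith
  · have h1 := (abs_lt.1 (hdk i)).2
    simp only [ray, if_true] at h1
    have h2 : y i < (1 + ((q : ℝ) - 1) * t) / q + (1 - t) / 2 := by linarith
    have h3 : q * y i < (1 + ((q : ℝ) - 1) * t) + q * ((1 - t) / 2) := by
      have := mul_lt_mul_of_pos_left h2 hq0
      rwa [mul_add, mul_div_cancel₀ _ hq0.ne'] at this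
    rw [div_lt_one (by linarith)]
    nlinarith
  · intro k hk
    have h1 := (abs_lt.1 (hdk k)).2
    simp only [ray, hk, if_false] at h1
    linarith

lemma minimum_some (q : ℕ) (β : ℝ) (i : Fin q) :
    minimum q β (some i) = ray q i (orderParameter q β) := rfl

lemma minimum_mem_stdSimplex {q : ℕ} (hq : 2 ≤ q) {β : ℝ} (hβ : betaOne q < β)
    (i : Option (Fin q)) : minimum q β i ∈ stdSimplex ℝ (Fin q) := by
  obtain ⟨s, hs0, hst, ht1, -⟩ := orderParameter_spec hq hβ
  cases i with
  | none =>
    have := ray_mem_stdSimplex (⟨0, by omega⟩ : Fin q) le_rfl zero_le_one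
    rwa [ray_zero] at this
  | some i => exact ray_mem_stdSimplex i (hs0.trans hst).le ht1.le

/-- Above `β₁` the local minima of the free energy are exactly the points `m_i`, `i ∈ I_β`. -/
theorem isLocalMinOn_iff {q : ℕ} (hq : 2 ≤ q) {β : ℝ} (hβ : betaOne q < β) {x : Fin q → ℝ}
    (hx : x ∈ stdSimplex ℝ (Fin q)) :
    IsLocalMinOn (freeEnergy q β) (stdSimplex ℝ (Fin q)) x ↔
      ∃ i ∈ indexSet q β, x = minimum q β i := by
  have hc : (1 : ℝ) ≤ (q : ℝ) - 1 := by
    have : (2 : ℝ) ≤ q := by exact_mod_cast hq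
    linarith
  obtain ⟨hβ0, s, hs0, hs1, hneg⟩ := exists_meanField_neg hq hβ
  constructor
  · intro h
    by_cases hb : x = barycentre q
    · subst hb
      refine ⟨none, ?_, rfl⟩
      unfold indexSet
      split_ifs with hlt
      · exact Finset.mem_univ _
      · exfalso
        obtain ⟨r, hr0, hr1, hr⟩ := meanField_neg_near_zero hc
          (by linarith : (q : ℝ) - 1 + 1 ≤ β) hs0 hs1 hneg
        have := not_isLocalMinOn_ray hq hβ0 ⟨0, by omega⟩ le_rfl hr0 hr1 hr
        rw [ray_zero] at this
        exact this h
    · obtain ⟨i, t, ht0, ht1, rfl, ht⟩ := eq_ray_of_isLocalMinOn hq hβ0 hx h hb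
      refine ⟨some i, ?_, ?_⟩
      · unfold indexSet
        split_ifs <;> simp
      · rw [minimum_some, orderParameter_eq hq ht0 ht1 ht]
        -- A later zero would make the energy decrease along the ray just after `t`, so a local
        -- minimum can only sit at the largest zero.
        intro y hy hy0
        obtain ⟨r, hr0, hr1, hr⟩ := meanField_neg_right_of_two_zeros hc ht0 hy.1 hy.2 ht hy0
        exact not_isLocalMinOn_ray hq hβ0 i ht0.le hr0 hr1 hr h
  · rintro ⟨i, hi, rfl⟩
    cases i with
    | none =>
      refine isLocalMinOn_barycentre hq hβ0 ?_
      by_contra hge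
      simp [indexSet, hge] at hi
    | some i => exact isLocalMinOn_ray_orderParameter hq hβ i

/-- The points `m_i`, `i ∈ I_β`, are strict local minima. -/
lemma exists_strict_min_minimum {q : ℕ} (hq : 2 ≤ q) {β : ℝ} (hβ : betaOne q < β)
    {i : Option (Fin q)} (hi : i ∈ indexSet q β) :
    ∃ r > 0, ∀ y ∈ stdSimplex ℝ (Fin q), y ≠ minimum q β i → dist y (minimum q β i) ≤ r →
      freeEnergy q β (minimum q β i) < freeEnergy q β y := by
  have hmem := minimum_mem_stdSimplex hq hβ i
  obtain ⟨ε, hε, hmin⟩ :=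
    exists_forall_le_of_isLocalMinOn ((isLocalMinOn_iff hq hβ hmem).2 ⟨i, hi, rfl⟩)
  have hfin : ((minimum q β '' (indexSet q β : Set (Option (Fin q)))) \ {minimum q β i}).Finite :=
    ((Finset.finite_toSet _).image _).subset sdiff_subset
  obtain ⟨δ, hδ, hδ'⟩ := Metric.isOpen_iff.1 hfin.isClosed.isOpen_compl (minimum q β i) (by simp)
  refine ⟨min (ε / 2) (δ / 2), by positivity, fun y hy hne hd => ?_⟩
  have hd1 : dist y (minimum q β i) ≤ ε / 2 := hd.trans (min_le_left _ _)
  have hd2 : dist y (minimum q β i) ≤ δ / 2 := hd.trans (min_le_right _ _)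
  refine lt_of_le_of_ne (hmin y hy (by linarith)) fun heq => ?_
  -- A nearby point with the same energy would itself be a local minimum, but the finitely many
  -- local minima are isolated.
  have hloc : IsLocalMinOn (freeEnergy q β) (stdSimplex ℝ (Fin q)) y := by
    refine isLocalMinOn_of_forall_dist (half_pos hε) fun z hz hzd => ?_
    rw [← heq]
    exact hmin z hz (by linarith [dist_triangle z y (minimum q β i)])
  obtain ⟨j, hj, hyj⟩ := (isLocalMinOn_iff hq hβ hy).1 hloc
  have : y ∈ Metric.ball (minimum q β i) δ := by rw [Metric.mem_ball]; linarith
  exact hδ' this ⟨⟨j, hj, hyj.symm⟩, hne⟩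

lemma minimum_injective {q : ℕ} (hq : 2 ≤ q) {β : ℝ} (hβ : betaOne q < β) :
    Function.Injective (minimum q β) := by
  obtain ⟨s, hs0, hst, ht1, -⟩ := orderParameter_spec hq hβ
  have hq' : (2 : ℝ) ≤ q := by exact_mod_cast hq
  have hq0 : (0 : ℝ) < q := by linarith
  have ht0 := hs0.trans hst
  have hlt : (1 - orderParameter q β) / q < (1 + ((q : ℝ) - 1) * orderParameter q β) / q :=
    div_lt_div_of_pos_right (by nlinarith) hq0
  have hlt' : 1 / (q : ℝ) < (1 + ((q : ℝ) - 1) * orderParameter q β) / q :=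
    div_lt_div_of_pos_right (by nlinarith) hq0
  rintro (_ | i) (_ | j) h
  · rfl
  · have := congrFun h j
    simp [minimum, barycentre] at this
    simp at hlt'
    linarith
  · have := congrFun h i
    simp [minimum, barycentre] at this
    simp at hlt'
    linarith
  · have := congrFun h i
    by_contra hne
    have hij : i ≠ j := fun e => hne (by rw [e])
    simp [minimum, hij] at this
    linarith

lemma minimum_lt_one {q : ℕ} (hq : 2 ≤ q) {β : ℝ} (hβ : betaOne q < β)
    (i : Option (Fin q)) (k : Fin q) : minimum q β i k < 1 := by
  obtain ⟨s, hs0, hst, ht1, -⟩ := orderParameter_spec hq hβ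
  have hq' : (2 : ℝ) ≤ q := by exact_mod_cast hq
  have ht0 := hs0.trans hst
  cases i with
  | none =>
    simp only [minimum, barycentre]
    rw [div_lt_one (by linarith)]; linarith
  | some i =>
    simp only [minimum]
    split_ifs <;> rw [div_lt_one (by linarith)] <;> nlinarith

end CWP

/-! ### Gibbs weights and rates in terms of colour counts -/

namespace CWP

open Set Filter Topology

variable {N q : ℕ}

/-- The number of spins of colour `k`. -/
def colourCount (σ : Config N q) (k : Fin q) : ℕ := (Finset.univ.filter fun i => σ i = k).card

lemma empiricalMeasure_apply (σ : Config N q) (k : Fin q) :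
    empiricalMeasure N q σ k = colourCount σ k / N := by
  simp [empiricalMeasure, colourCount, div_eq_inv_mul]

lemma colourCount_le (σ : Config N q) (k : Fin q) : colourCount σ k ≤ N := by
  simpa [colourCount] using Finset.card_filter_le (Finset.univ : Finset (Fin N)) fun i => σ i = k

lemma sum_colourCount (σ : Config N q) : ∑ k, colourCount σ k = N := by
  have := Finset.card_eq_sum_card_fiberwise (s := (Finset.univ : Finset (Fin N)))
    (t := (Finset.univ : Finset (Fin q))) (f := σ) (fun _ _ => by simp)
  simpa [colourCount] using this.symm

lemma empiricalMeasure_mem_latticeSimplex (hN : 0 < N) (σ : Config N q) :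
    empiricalMeasure N q σ ∈ latticeSimplex N q := by
  have hN' : (N : ℝ) ≠ 0 := by positivity
  refine ⟨⟨fun k => ?_, ?_⟩, colourCount σ, fun k => empiricalMeasure_apply σ k⟩
  · rw [empiricalMeasure_apply]; positivity
  · simp only [empiricalMeasure_apply, ← Finset.sum_div, ← Nat.cast_sum, sum_colourCount]
    exact div_self hN'

lemma empiricalMeasure_eq_iff (hN : 0 < N) (σ η : Config N q) :
    empiricalMeasure N q σ = empiricalMeasure N q η ↔ colourCount σ = colourCount η := by
  have hN' : (N : ℝ) ≠ 0 := by positivity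
  simp only [funext_iff, empiricalMeasure_apply]
  refine forall_congr' fun k => ?_
  rw [div_left_inj' hN', Nat.cast_inj]

lemma colourCount_le_add_hammingDist (σ η : Config N q) (k : Fin q) :
    colourCount σ k ≤ colourCount η k + hammingDist σ η := by
  unfold colourCount hammingDist
  rw [← Finset.card_union_add_card_inter]
  refine le_trans (Finset.card_le_card fun i hi => ?_) (Nat.le_add_right _ _)
  simp only [Finset.mem_filter, Finset.mem_univ, true_and, Finset.mem_union] at *
  by_cases h : σ i = η i
  · exact Or.inl (h ▸ hi)
  · exact Or.inr h

lemma abs_empiricalMeasure_sub_le (σ η : Config N q) (k : Fin q) :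
    |empiricalMeasure N q σ k - empiricalMeasure N q η k| ≤ hammingDist σ η / N := by
  rw [empiricalMeasure_apply, empiricalMeasure_apply, ← sub_div, abs_div, Nat.abs_cast]
  refine div_le_div_of_nonneg_right ?_ (Nat.cast_nonneg _)
  have h1 : (colourCount σ k : ℝ) ≤ colourCount η k + hammingDist σ η := by
    exact_mod_cast colourCount_le_add_hammingDist σ η k
  have h2 : (colourCount η k : ℝ) ≤ colourCount σ k + hammingDist σ η := by
    rw [hammingDist_comm]; exact_mod_cast colourCount_le_add_hammingDist η σ k
  rw [abs_le]; constructor <;> linarith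

lemma sum_sum_eq_sum_sq (σ : Config N q) :
    ∑ i, ∑ j, (if σ i = σ j then (1 : ℝ) else 0) = ∑ k, (colourCount σ k : ℝ) ^ 2 := by
  have h : ∀ i j : Fin N, (if σ i = σ j then (1 : ℝ) else 0) =
      ∑ k, (if σ i = k then (1 : ℝ) else 0) * (if σ j = k then (1 : ℝ) else 0) := by
    intro i j
    simp [eq_comm]
  simp only [h]
  have h2 : ∀ k, (colourCount σ k : ℝ) = ∑ i, if σ i = k then (1 : ℝ) else 0 := by
    intro k; simp [colourCount]
  calc ∑ i, ∑ j, ∑ k, (if σ i = k then (1 : ℝ) else 0) * (if σ j = k then (1 : ℝ) else 0)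
      = ∑ i, ∑ k, ∑ j, (if σ i = k then (1 : ℝ) else 0) * (if σ j = k then (1 : ℝ) else 0) :=
        Finset.sum_congr rfl fun i _ => Finset.sum_comm
    _ = ∑ k, ∑ i, ∑ j, (if σ i = k then (1 : ℝ) else 0) * (if σ j = k then (1 : ℝ) else 0) :=
        Finset.sum_comm
    _ = _ := Finset.sum_congr rfl fun k _ => by rw [sq, h2, Finset.sum_mul_sum]

/-- The Hamiltonian is a function of the empirical measure. -/
lemma hamiltonian_eq (hN : 0 < N) (σ : Config N q) :
    hamiltonian N q σ = 1 / 2 - N / 2 * ∑ k, empiricalMeasure N q σ k ^ 2 := by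
  have hN' : (N : ℝ) ≠ 0 := by positivity
  have hsym : ∑ i : Fin N, ∑ j : Fin N, (if j < i ∧ σ i = σ j then (1 : ℝ) else 0) =
      ∑ i : Fin N, ∑ j : Fin N, (if i < j ∧ σ i = σ j then (1 : ℝ) else 0) := by
    rw [Finset.sum_comm]
    simp only [eq_comm]
  have hsplit : ∑ i : Fin N, ∑ j : Fin N, (if σ i = σ j then (1 : ℝ) else 0) =
      ∑ i : Fin N, ∑ j : Fin N, (if i < j ∧ σ i = σ j then (1 : ℝ) else 0) +
      ∑ i : Fin N, ∑ j : Fin N, (if j < i ∧ σ i = σ j then (1 : ℝ) else 0) + N := by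
    have hd : (N : ℝ) = ∑ i : Fin N, ∑ j : Fin N, if i = j then (1 : ℝ) else 0 := by simp
    rw [hd, ← Finset.sum_add_distrib, ← Finset.sum_add_distrib]
    refine Finset.sum_congr rfl fun i _ => ?_
    rw [← Finset.sum_add_distrib, ← Finset.sum_add_distrib]
    refine Finset.sum_congr rfl fun j _ => ?_
    rcases lt_trichotomy i j with h | h | h
    · simp [h, h.ne, h.not_gt]
    · simp [h]
    · simp [h, h.ne', h.not_gt]
  rw [hsym, sum_sum_eq_sum_sq] at hsplit
  simp only [empiricalMeasure_apply, div_pow, ← Finset.sum_div]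
  unfold hamiltonian
  have : ∑ i : Fin N, ∑ j : Fin N, (if i < j ∧ σ i = σ j then (1 : ℝ) else 0) =
      (∑ k, (colourCount σ k : ℝ) ^ 2 - N) / 2 := by linarith
  rw [this]
  field_simp
  ring

/-- A single-site change costs a bounded energy, so the Metropolis rates are bounded below by a
constant over `N`. -/
lemma hamiltonian_sub_le (hN : 0 < N) {σ η : Config N q} (h : hammingDist σ η = 1) :
    hamiltonian N q η - hamiltonian N q σ ≤ q := by
  have hN' : (0 : ℝ) < N := by exact_mod_cast hN
  rw [hamiltonian_eq hN, hamiltonian_eq hN]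
  have hk : ∀ k : Fin q, empiricalMeasure N q σ k ^ 2 - empiricalMeasure N q η k ^ 2 ≤ 2 / N := by
    intro k
    have h1 := (abs_le.1 (abs_empiricalMeasure_sub_le σ η k)).2
    rw [h, Nat.cast_one] at h1
    have hle : ∀ τ : Config N q, 0 ≤ empiricalMeasure N q τ k ∧ empiricalMeasure N q τ k ≤ 1 := by
      intro τ
      rw [empiricalMeasure_apply]
      refine ⟨by positivity, ?_⟩
      rw [div_le_one hN']; exact_mod_cast colourCount_le τ k
    have a1 := hle σ
    have a2 := hle η
    have e : empiricalMeasure N q σ k ^ 2 - empiricalMeasure N q η k ^ 2 =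
      (empiricalMeasure N q σ k - empiricalMeasure N q η k) *
        (empiricalMeasure N q σ k + empiricalMeasure N q η k) := by ring
    rw [e]
    calc _ ≤ 1 / (N : ℝ) * (empiricalMeasure N q σ k + empiricalMeasure N q η k) :=
          mul_le_mul_of_nonneg_right h1 (by linarith)
      _ ≤ 1 / (N : ℝ) * 2 := mul_le_mul_of_nonneg_left (by linarith) (by positivity)
      _ = _ := by ring
  have hs : ∑ k, empiricalMeasure N q σ k ^ 2 - ∑ k, empiricalMeasure N q η k ^ 2 ≤
      q * (2 / N) := by
    rw [← Finset.sum_sub_distrib]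
    refine (Finset.sum_le_sum fun k _ => hk k).trans ?_
    simp
  have := mul_le_mul_of_nonneg_left hs (by positivity : (0 : ℝ) ≤ N / 2)
  have e : (N : ℝ) / 2 * (q * (2 / N)) = q := by field_simp
  rw [e] at this
  linarith

/-- The Gibbs weight of a configuration. -/
noncomputable def gibbsWeight (N q : ℕ) (β : ℝ≥0) (σ : Config N q) : ℝ :=
  Real.exp (-β * hamiltonian N q σ) / ∑ η, Real.exp (-β * hamiltonian N q η)

lemma gibbsWeight_pos (β : ℝ≥0) (σ : Config N q) : 0 < gibbsWeight N q β σ :=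
  div_pos (Real.exp_pos _)
    (Finset.sum_pos (fun _ _ => Real.exp_pos _) ⟨σ, Finset.mem_univ σ⟩)

lemma gibbs_singleton (β : ℝ≥0) (σ : Config N q) :
    gibbs N q β {σ} = ENNReal.ofReal (gibbsWeight N q β σ) := by
  unfold gibbs
  rw [Measure.finsetSum_apply]
  simp [Set.indicator_apply, gibbsWeight]

instance (β : ℝ≥0) : IsFiniteMeasure (gibbs N q β) := by
  refine ⟨?_⟩
  unfold gibbs
  rw [Measure.finsetSum_apply]
  simp [ENNReal.sum_lt_top]

lemma gibbs_real_singleton (β : ℝ≥0) (σ : Config N q) :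
    (gibbs N q β).real {σ} = gibbsWeight N q β σ := by
  rw [Measure.real, gibbs_singleton, ENNReal.toReal_ofReal (gibbsWeight_pos β σ).le]

open Classical in
lemma gibbs_real_eq_sum (β : ℝ≥0) (A : Set (Config N q)) :
    (gibbs N q β).real A = ∑ σ ∈ Finset.univ.filter (· ∈ A), gibbsWeight N q β σ := by
  have h := sum_measureReal_singleton (μ := gibbs N q β) (Finset.univ.filter (· ∈ A))
  simp only [gibbs_real_singleton] at h
  rw [h]
  congr 1
  ext; simp

/-- The Metropolis product equals `exp (-β max (H σ) (H η))` up to a constant, which is symmetric.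
-/
lemma glauber_isReversible (β : ℝ≥0) :
    MarkovChain.IsReversible (glauber N q β) (gibbsWeight N q β) := by
  intro σ η
  rcases eq_or_ne σ η with rfl | hne
  · rfl
  change gibbsWeight N q β σ * glauberMatrix N q β σ η =
    gibbsWeight N q β η * glauberMatrix N q β η σ
  unfold glauberMatrix
  rw [if_neg hne, if_neg hne.symm]
  unfold flipProb
  rw [hammingDist_comm η σ]
  split_ifs
  · unfold gibbsWeight
    have key : Real.exp (-β * hamiltonian N q σ) *
        Real.exp (-β * max 0 (hamiltonian N q η - hamiltonian N q σ)) =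
        Real.exp (-β * hamiltonian N q η) *
        Real.exp (-β * max 0 (hamiltonian N q σ - hamiltonian N q η)) := by
      rw [← Real.exp_add, ← Real.exp_add]
      congr 1
      rcases le_total (hamiltonian N q σ) (hamiltonian N q η) with h | h
      · rw [max_eq_right (by linarith), max_eq_left (by linarith)]; ring
      · rw [max_eq_left (by linarith), max_eq_right (by linarith)]; ring
    calc _ = (Real.exp (-β * hamiltonian N q σ) *
        Real.exp (-β * max 0 (hamiltonian N q η - hamiltonian N q σ))) *
        (((N : ℝ) * q)⁻¹ / ∑ η, Real.exp (-β * hamiltonian N q η)) := by ring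
      _ = _ := by rw [key]; ring
  · simp

lemma le_glauber_of_hammingDist (β : ℝ≥0) (hN : 0 < N) {σ η : Config N q}
    (h : hammingDist σ η = 1) :
    ((N : ℝ) * q)⁻¹ * Real.exp (-β * q) ≤ (glauber N q β).1 σ η := by
  have hne : σ ≠ η := by rintro rfl; simp at h
  change _ ≤ glauberMatrix N q β σ η
  unfold glauberMatrix flipProb
  rw [if_neg hne, if_pos h]
  refine mul_le_mul_of_nonneg_left (Real.exp_le_exp.2 ?_) (by positivity)
  have h1 : max 0 (hamiltonian N q η - hamiltonian N q σ) ≤ q :=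
    max_le (Nat.cast_nonneg _) (hamiltonian_sub_le hN h)
  have := mul_le_mul_of_nonneg_left h1 β.2
  simp only [NNReal.val_eq_coe] at this
  linarith

lemma glauber_eq_zero (β : ℝ≥0) {σ η : Config N q} (hne : σ ≠ η) (h : hammingDist σ η ≠ 1) :
    (glauber N q β).1 σ η = 0 := by
  change glauberMatrix N q β σ η = 0
  unfold glauberMatrix flipProb
  rw [if_neg hne, if_neg h]

lemma le_log_factorial (n : ℕ) : n * Real.log n - n ≤ Real.log n.factorial := by
  rcases Nat.eq_zero_or_pos n with rfl | hn
  · simp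
  have hn' : (0 : ℝ) < n := by exact_mod_cast hn
  have h := Real.pow_div_factorial_le_exp (n : ℝ) hn'.le n
  have hf : (0 : ℝ) < n.factorial := by exact_mod_cast n.factorial_pos
  have h2 := Real.log_le_log (by positivity) h
  rw [Real.log_exp, Real.log_div (by positivity) hf.ne', Real.log_pow] at h2
  linarith

lemma log_factorial_le (n : ℕ) :
    Real.log n.factorial ≤ n * Real.log n - n + (1 + Real.log (n + 1)) := by
  rcases Nat.eq_zero_or_pos n with rfl | hn
  · simp
  have h : Real.log n.factorial ≤ n * Real.log n - n + (1 + Real.log n) := by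
    induction n, hn using Nat.le_induction with
    | base => simp
    | succ n hn ih =>
      have hn' : (0 : ℝ) < n := by exact_mod_cast hn
      rw [Nat.factorial_succ, Nat.cast_mul, Real.log_mul (by positivity) (by positivity)]
      push_cast
      have h2 : 1 ≤ (n + 1) * (Real.log (n + 1) - Real.log n) := by
        rw [← Real.log_div (by positivity) hn'.ne']
        have := Real.one_sub_inv_le_log_of_pos (by positivity : (0 : ℝ) < (n + 1) / n)
        have e : 1 - (((n : ℝ) + 1) / n)⁻¹ = 1 / (n + 1) := by field_simp; ring
        rw [e] at this
        calc (1 : ℝ) = (n + 1) * (1 / (n + 1)) := by field_simp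
          _ ≤ _ := mul_le_mul_of_nonneg_left this (by positivity)
      linarith
  have hn' : (0 : ℝ) < n := by exact_mod_cast hn
  have : Real.log n ≤ Real.log (n + 1) := Real.log_le_log hn' (by linarith)
  linarith

/-- The number of permutations of the sites fixing `σ`. -/
def symmetryCount (σ : Config N q) : ℕ := ∏ k, (colourCount σ k).factorial

lemma symmetryCount_pos (σ : Config N q) : 0 < symmetryCount σ :=
  Finset.prod_pos fun _ _ => Nat.factorial_pos _

/-- A colour class has `N! / symmetryCount σ` elements, so this is the logarithm of its unnormalised
mass, without `log N!`. The term `e` is the total Stirling error; everything else except the free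
energy is independent of `σ`. -/
lemma log_gibbs_numerator_div (hN : 0 < N) {β : ℝ≥0} (hβ : 0 < β) (σ : Config N q) :
    ∃ e : ℝ, 0 ≤ e ∧ e ≤ q * (1 + Real.log (N + 1)) ∧
      -β * hamiltonian N q σ - Real.log (symmetryCount σ) =
        -(β * N * freeEnergy q β (empiricalMeasure N q σ)) - β / 2 - N * Real.log N + N - e := by
  have hN' : (0 : ℝ) < N := by exact_mod_cast hN
  have hβ' : (0 : ℝ) < β := hβ
  set n := colourCount σ
  have hlog : Real.log (symmetryCount σ) = ∑ k, Real.log ((n k).factorial) := by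
    unfold symmetryCount
    rw [Nat.cast_prod, Real.log_prod]
    intro k _
    exact_mod_cast (Nat.factorial_pos _).ne'
  have hsum : ∑ k, (n k : ℝ) = N := by exact_mod_cast sum_colourCount σ
  have hent : ∑ k, ((n k : ℝ) * Real.log (n k) - n k) =
      N * ∑ k, empiricalMeasure N q σ k * Real.log (empiricalMeasure N q σ k) +
        N * Real.log N - N := by
    have : ∀ k, (n k : ℝ) * Real.log (n k) - n k =
        N * (empiricalMeasure N q σ k * Real.log (empiricalMeasure N q σ k)) +
          n k * Real.log N - n k := by
      intro k
      rw [empiricalMeasure_apply]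
      change (n k : ℝ) * Real.log (n k) - n k = N * ((n k : ℝ) / N * Real.log ((n k : ℝ) / N)) +
          n k * Real.log N - n k
      rcases Nat.eq_zero_or_pos (n k) with h | h
      · simp [h]
      · have hk : (0 : ℝ) < n k := by exact_mod_cast h
        rw [Real.log_div hk.ne' hN'.ne']
        field_simp
        ring
    rw [Finset.sum_congr rfl fun k _ => this k, Finset.sum_sub_distrib, Finset.sum_add_distrib,
      ← Finset.sum_mul, ← Finset.mul_sum, hsum]
  refine ⟨∑ k, (Real.log ((n k).factorial) - ((n k : ℝ) * Real.log (n k) - n k)),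
    Finset.sum_nonneg fun k _ => sub_nonneg.2 (le_log_factorial _), ?_, ?_⟩
  · calc _ ≤ ∑ _k : Fin q, (1 + Real.log (N + 1)) := by
          refine Finset.sum_le_sum fun k _ => ?_
          have h1 := log_factorial_le (n k)
          have h2 : Real.log ((n k : ℝ) + 1) ≤ Real.log (N + 1) := by
            refine Real.log_le_log (by positivity) ?_
            have : (n k : ℝ) ≤ N := by exact_mod_cast colourCount_le σ k
            linarith
          linarith
      _ = _ := by simp; ring
  · rw [Finset.sum_sub_distrib, hent, ← hlog, hamiltonian_eq hN]
    unfold freeEnergy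
    field_simp
    ring

/-- Comparison of the Gibbs masses of two types of configurations, in terms of the free energy. -/
lemma gibbsWeight_mul_symmetryCount_le (hN : 0 < N) {β : ℝ≥0} (hβ : 0 < β) (σ η : Config N q) :
    gibbsWeight N q β σ * symmetryCount η ≤
      Real.exp (q * (1 + Real.log (N + 1))) *
        Real.exp (β * N * (freeEnergy q β (empiricalMeasure N q η) -
          freeEnergy q β (empiricalMeasure N q σ))) *
        (gibbsWeight N q β η * symmetryCount σ) := by
  obtain ⟨e, he0, he1, he⟩ := log_gibbs_numerator_div hN hβ σ
  obtain ⟨e', he0', he1', he'⟩ := log_gibbs_numerator_div hN hβ η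
  have hc : ∀ τ : Config N q, (symmetryCount τ : ℝ) = Real.exp (Real.log (symmetryCount τ)) :=
    fun τ => (Real.exp_log (by exact_mod_cast symmetryCount_pos τ)).symm
  have hZ : 0 ≤ (∑ η, Real.exp (-β * hamiltonian N q η))⁻¹ :=
    inv_nonneg.2 (Finset.sum_nonneg fun _ _ => (Real.exp_pos _).le)
  unfold gibbsWeight
  rw [hc σ, hc η]
  simp only [div_eq_mul_inv]
  calc _ = (Real.exp (-β * hamiltonian N q σ) * Real.exp (Real.log (symmetryCount η))) *
        (∑ η, Real.exp (-β * hamiltonian N q η))⁻¹ := by ring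
    _ ≤ (Real.exp (q * (1 + Real.log (N + 1))) *
        Real.exp (β * N * (freeEnergy q β (empiricalMeasure N q η) -
          freeEnergy q β (empiricalMeasure N q σ))) *
        (Real.exp (-β * hamiltonian N q η) * Real.exp (Real.log (symmetryCount σ)))) *
        (∑ η, Real.exp (-β * hamiltonian N q η))⁻¹ := by
        refine mul_le_mul_of_nonneg_right ?_ hZ
        simp only [← Real.exp_add]
        refine Real.exp_le_exp.2 ?_
        linarith
    _ = _ := by ring

end CWP

/-! ### Averaging paths over permutations of the sites -/

namespace CWP

open Set Filter Topology

variable {N q : ℕ}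

lemma colourCount_comp_perm (σ : Config N q) (π : Equiv.Perm (Fin N)) :
    colourCount (σ ∘ π) = colourCount σ := by
  funext k
  unfold colourCount
  exact Finset.card_equiv π (by simp)

lemma exists_perm_of_colourCount_eq {σ η : Config N q} (h : colourCount σ = colourCount η) :
    ∃ π : Equiv.Perm (Fin N), σ ∘ π = η := by
  have e : ∀ k, Nonempty ({i // η i = k} ≃ {i // σ i = k}) := fun k => by
    refine Fintype.card_eq.1 ?_
    rw [Fintype.card_subtype, Fintype.card_subtype]
    exact (congrFun h k).symm
  replace e := fun k => (e k).some
  refine ⟨(Equiv.sigmaFiberEquiv η).symm.trans ((Equiv.sigmaCongrRight e).trans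
    (Equiv.sigmaFiberEquiv σ)), ?_⟩
  funext i
  exact (e (η i) ⟨i, rfl⟩).2

lemma hammingDist_comp_perm (σ η : Config N q) (π : Equiv.Perm (Fin N)) :
    hammingDist (σ ∘ π) (η ∘ π) = hammingDist σ η := by
  unfold hammingDist
  exact Finset.card_equiv π (by simp)

lemma card_perm_comp_self (σ : Config N q) :
    (Finset.univ.filter fun π : Equiv.Perm (Fin N) => σ ∘ π = σ).card = symmetryCount σ := by
  have h := DomMulAct.stabilizer_card σ
  rw [Fintype.card_subtype] at h
  rw [h]
  unfold symmetryCount colourCount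
  exact Finset.prod_congr rfl fun k _ => by rw [Fintype.card_subtype]

/-- The permutations carrying `σ` to `η` form a coset of the stabiliser of `σ`. -/
lemma card_perm_comp_eq {σ η : Config N q} (h : colourCount σ = colourCount η) :
    (Finset.univ.filter fun π : Equiv.Perm (Fin N) => σ ∘ π = η).card = symmetryCount σ := by
  obtain ⟨π₀, rfl⟩ := exists_perm_of_colourCount_eq h
  rw [← card_perm_comp_self]
  refine Finset.card_equiv (Equiv.mulRight π₀⁻¹) fun π => ?_
  simp only [Finset.mem_filter, Finset.mem_univ, true_and, Equiv.coe_mulRight, Equiv.Perm.coe_mul]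
  constructor
  · intro hπ
    rw [← Function.comp_assoc, hπ, Function.comp_assoc, ← Equiv.Perm.coe_mul]
    simp
  · intro hπ
    rw [← Function.comp_assoc] at hπ
    nth_rewrite 2 [← hπ]
    rw [Function.comp_assoc, ← Equiv.Perm.coe_mul]
    simp

/-- The configurations with the same colour counts as `σ`. -/
def colourClass (σ : Config N q) : Finset (Config N q) :=
  Finset.univ.filter fun η => colourCount η = colourCount σ

lemma mem_colourClass {σ η : Config N q} :
    η ∈ colourClass σ ↔ colourCount η = colourCount σ := by
  simp [colourClass]

/-- Averaging over permutations of the sites spreads uniformly over the colour class. -/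
lemma sum_perm_comp (σ : Config N q) (f : Config N q → ℝ) :
    ∑ π : Equiv.Perm (Fin N), f (σ ∘ π) = symmetryCount σ * ∑ η ∈ colourClass σ, f η := by
  rw [← Finset.sum_fiberwise_of_maps_to (t := colourClass σ) (g := fun π : Equiv.Perm (Fin N) => σ ∘ π)
    (fun π _ => mem_colourClass.2 (colourCount_comp_perm σ π)), Finset.mul_sum]
  refine Finset.sum_congr rfl fun η hη => ?_
  rw [Finset.sum_congr rfl (g := fun _ => f η) fun π hπ => by
    rw [(Finset.mem_filter.1 hπ).2], Finset.sum_const, nsmul_eq_mul,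
    card_perm_comp_eq (mem_colourClass.1 hη).symm]

lemma symmetryCount_mul_card_colourClass (σ : Config N q) :
    (symmetryCount σ : ℝ) * (colourClass σ).card = N.factorial := by
  have h := sum_perm_comp σ fun _ => 1
  simp only [Finset.sum_const, Finset.card_univ, Fintype.card_perm, Fintype.card_fin,
    nsmul_eq_mul, mul_one] at h
  exact h.symm

lemma gibbsWeight_congr (hN : 0 < N) (β : ℝ≥0) {σ η : Config N q}
    (h : colourCount σ = colourCount η) : gibbsWeight N q β σ = gibbsWeight N q β η := by
  unfold gibbsWeight
  rw [hamiltonian_eq hN σ, hamiltonian_eq hN η, (empiricalMeasure_eq_iff hN σ η).2 h]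

open Classical in
/-- A path of single-site changes, spread over all permutations of the sites, bounds the number
of starting points by the squared gradient of a test function. -/
lemma card_mul_symmetryCount_le {u : Config N q → ℝ} {n : ℕ} {s : ℕ → Config N q}
    (hs : ∀ k < n, hammingDist (s k) (s (k + 1)) = 1) {X : Finset (Config N q)}
    (hX : ∀ σ ∈ X, colourCount σ = colourCount (s 0) ∧ u σ = 0)
    (hend : ∀ σ, colourCount σ = colourCount (s n) → u σ = 1) :
    (symmetryCount (s 0) : ℝ) * X.card ≤ n * ∑ k ∈ Finset.range n, symmetryCount (s k) *
      ∑ σ ∈ colourClass (s k), ∑ η, if hammingDist σ η = 1 then (u σ - u η) ^ 2 else 0 := by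
  have h1 : (symmetryCount (s 0) : ℝ) * X.card =
      ∑ π : Equiv.Perm (Fin N), if s 0 ∘ π ∈ X then (1 : ℝ) else 0 := by
    rw [sum_perm_comp (s 0) fun σ => if σ ∈ X then (1 : ℝ) else 0, ← Finset.sum_filter,
      Finset.sum_const, nsmul_eq_mul, mul_one]
    congr 3
    ext σ
    simp only [Finset.mem_filter, mem_colourClass]
    exact ⟨fun h => ⟨(hX σ h).1, h⟩, fun h => h.2⟩
  -- Along each permuted path starting in `X` the increments of `u` telescope to 1; Cauchy–Schwarz
  -- costs a factor of the length `n`.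
  have h2 : ∀ π : Equiv.Perm (Fin N), (if s 0 ∘ π ∈ X then (1 : ℝ) else 0) ≤
      n * ∑ k ∈ Finset.range n, (u (s (k + 1) ∘ π) - u (s k ∘ π)) ^ 2 := by
    intro π
    split_ifs with h
    · have htel : ∑ k ∈ Finset.range n, (u (s (k + 1) ∘ π) - u (s k ∘ π)) = 1 := by
        rw [Finset.sum_range_sub fun k => u (s k ∘ π), (hX _ h).2,
          hend _ (colourCount_comp_perm (s n) π), sub_zero]
      have := sq_sum_le_card_mul_sum_sq (s := Finset.range n)
        (f := fun k => u (s (k + 1) ∘ π) - u (s k ∘ π))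
      rw [htel, Finset.card_range] at this
      linarith
    · positivity
  have h3 : ∀ k < n, ∑ π : Equiv.Perm (Fin N), (u (s (k + 1) ∘ π) - u (s k ∘ π)) ^ 2 ≤
      symmetryCount (s k) * ∑ σ ∈ colourClass (s k),
        ∑ η, if hammingDist σ η = 1 then (u σ - u η) ^ 2 else 0 := by
    intro k hk
    rw [← sum_perm_comp (s k) fun σ => ∑ η, if hammingDist σ η = 1 then (u σ - u η) ^ 2 else 0]
    refine Finset.sum_le_sum fun π _ => ?_
    have hh : hammingDist (s k ∘ π) (s (k + 1) ∘ π) = 1 := by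
      rw [hammingDist_comp_perm]; exact hs k hk
    refine le_trans (le_of_eq ?_) (Finset.single_le_sum
      (f := fun η => if hammingDist (s k ∘ π) η = 1 then (u (s k ∘ π) - u η) ^ 2 else 0)
      (fun η _ => by positivity) (Finset.mem_univ (s (k + 1) ∘ π)))
    simp only [hh, if_true]
    ring
  calc _ = _ := h1
    _ ≤ ∑ π : Equiv.Perm (Fin N),
        n * ∑ k ∈ Finset.range n, (u (s (k + 1) ∘ π) - u (s k ∘ π)) ^ 2 :=
      Finset.sum_le_sum fun π _ => h2 π
    _ = n * ∑ k ∈ Finset.range n,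
        ∑ π : Equiv.Perm (Fin N), (u (s (k + 1) ∘ π) - u (s k ∘ π)) ^ 2 := by
      rw [← Finset.mul_sum, Finset.sum_comm]
    _ ≤ _ := by
      refine mul_le_mul_of_nonneg_left ?_ (Nat.cast_nonneg _)
      exact Finset.sum_le_sum fun k hk => h3 k (Finset.mem_range.1 hk)

/-- The weight is constant on the colour class, and every single-site change has rate at least `exp
(-β q) / (N q)`. -/
lemma gibbsWeight_mul_gradient_le (hN : 0 < N) (hq : 0 < q) (β : ℝ≥0) (u : Config N q → ℝ)
    (τ : Config N q) :
    gibbsWeight N q β τ * ∑ σ ∈ colourClass τ, ∑ η,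
        (if hammingDist σ η = 1 then (u σ - u η) ^ 2 else 0) ≤
      N * q * Real.exp (β * q) *
        MarkovChain.dirichlet (glauber N q β) (gibbsWeight N q β) u := by
  have hN' : (0 : ℝ) < N := by exact_mod_cast hN
  have hq' : (0 : ℝ) < q := by exact_mod_cast hq
  unfold MarkovChain.dirichlet
  rw [Finset.mul_sum, Finset.mul_sum]
  refine (Finset.sum_le_sum (g := fun σ => N * q * Real.exp (β * q) *
    ∑ η, gibbsWeight N q β σ * (glauber N q β).1 σ η * (u σ - u η) ^ 2)
    fun σ hσ => ?_).trans (Finset.sum_le_sum_of_subset_of_nonneg (Finset.subset_univ _)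
      fun σ _ _ => ?_)
  · rw [Finset.mul_sum, Finset.mul_sum]
    refine Finset.sum_le_sum fun η _ => ?_
    rw [gibbsWeight_congr hN β (mem_colourClass.1 hσ)]
    have hw := (gibbsWeight_pos β τ).le
    split_ifs with h
    · have h1 := le_glauber_of_hammingDist β hN h
      have h2 : 1 ≤ N * q * Real.exp (β * q) * (glauber N q β).1 σ η := by
        have := mul_le_mul_of_nonneg_left h1
          (by positivity : 0 ≤ (N : ℝ) * q * Real.exp (β * q))
        refine le_trans (le_of_eq ?_) this
        rw [neg_mul, Real.exp_neg]
        field_simp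
      calc gibbsWeight N q β τ * (u σ - u η) ^ 2
          = 1 * (gibbsWeight N q β τ * (u σ - u η) ^ 2) := by ring
        _ ≤ (N * q * Real.exp (β * q) * (glauber N q β).1 σ η) *
            (gibbsWeight N q β τ * (u σ - u η) ^ 2) :=
          mul_le_mul_of_nonneg_right h2 (by positivity)
        _ = _ := by ring
    · rw [mul_zero]
      have := (glauber N q β).2.1 σ η
      positivity
  · refine mul_nonneg (by positivity) (Finset.sum_nonneg fun η _ => ?_)
    have := (glauber N q β).2.1 σ η
    have hw := (gibbsWeight_pos β σ).le
    positivity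

/-- Lower bound for the Dirichlet form along a path staying below a free-energy level. -/
lemma card_mul_gibbsWeight_le (hN : 0 < N) (hq : 0 < q) {β : ℝ≥0} (hβ : 0 < β)
    {u : Config N q → ℝ} {n : ℕ} {s : ℕ → Config N q} {ε : ℝ}
    (hs : ∀ k < n, hammingDist (s k) (s (k + 1)) = 1)
    (hlev : ∀ k < n, freeEnergy q β (empiricalMeasure N q (s k)) ≤
      freeEnergy q β (empiricalMeasure N q (s 0)) + ε) {X : Finset (Config N q)}
    (hX : ∀ σ ∈ X, colourCount σ = colourCount (s 0) ∧ u σ = 0)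
    (hend : ∀ σ, colourCount σ = colourCount (s n) → u σ = 1) :
    X.card * gibbsWeight N q β (s 0) ≤ n ^ 2 * (Real.exp (q * (1 + Real.log (N + 1))) *
      Real.exp (β * N * ε)) * (N * q * Real.exp (β * q)) *
        MarkovChain.dirichlet (glauber N q β) (gibbsWeight N q β) u := by
  set K := Real.exp (q * (1 + Real.log (N + 1))) * Real.exp (β * N * ε) with hK
  set D := MarkovChain.dirichlet (glauber N q β) (gibbsWeight N q β) u with hD
  set g : ℕ → ℝ := fun k => ∑ σ ∈ colourClass (s k),
    ∑ η, if hammingDist σ η = 1 then (u σ - u η) ^ 2 else 0 with hg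
  have hg0 : ∀ k, 0 ≤ g k := fun k => Finset.sum_nonneg fun σ _ => Finset.sum_nonneg fun η _ => by
    positivity
  have hc0 : (0 : ℝ) < symmetryCount (s 0) := by exact_mod_cast symmetryCount_pos (s 0)
  have h1 := card_mul_symmetryCount_le hs hX hend
  -- The weight at the start is traded for the weight at step `k`. The level bound along the path
  -- makes the cost `K` independent of `k`.
  have h2 : ∀ k < n, gibbsWeight N q β (s 0) * (symmetryCount (s k) * g k) ≤
      symmetryCount (s 0) * (K * (N * q * Real.exp (β * q)) * D) := by
    intro k hk
    have a1 := gibbsWeight_mul_symmetryCount_le hN hβ (s 0) (s k)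
    have a2 : Real.exp (q * (1 + Real.log (N + 1))) *
        Real.exp (β * N * (freeEnergy q β (empiricalMeasure N q (s k)) -
          freeEnergy q β (empiricalMeasure N q (s 0)))) ≤ K := by
      refine mul_le_mul_of_nonneg_left (Real.exp_le_exp.2 ?_) (Real.exp_pos _).le
      refine mul_le_mul_of_nonneg_left ?_ (by positivity)
      linarith [hlev k hk]
    have a3 := gibbsWeight_mul_gradient_le hN hq β u (s k)
    have hw := gibbsWeight_pos β (s k)
    calc gibbsWeight N q β (s 0) * (symmetryCount (s k) * g k)
        = (gibbsWeight N q β (s 0) * symmetryCount (s k)) * g k := by ring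
      _ ≤ (K * (gibbsWeight N q β (s k) * symmetryCount (s 0))) * g k := by
          refine mul_le_mul_of_nonneg_right (a1.trans ?_) (hg0 k)
          exact mul_le_mul_of_nonneg_right a2 (by positivity)
      _ = (symmetryCount (s 0) * K) * (gibbsWeight N q β (s k) * g k) := by ring
      _ ≤ (symmetryCount (s 0) * K) * (N * q * Real.exp (β * q) * D) :=
          mul_le_mul_of_nonneg_left a3 (by positivity)
      _ = _ := by ring
  refine le_of_mul_le_mul_left ?_ hc0
  calc (symmetryCount (s 0) : ℝ) * (X.card * gibbsWeight N q β (s 0))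
      = gibbsWeight N q β (s 0) * (symmetryCount (s 0) * X.card) := by ring
    _ ≤ gibbsWeight N q β (s 0) * (n * ∑ k ∈ Finset.range n, symmetryCount (s k) * g k) :=
        mul_le_mul_of_nonneg_left h1 (gibbsWeight_pos β (s 0)).le
    _ = n * ∑ k ∈ Finset.range n, gibbsWeight N q β (s 0) * (symmetryCount (s k) * g k) := by
        rw [← Finset.mul_sum]; ring
    _ ≤ n * ∑ _k ∈ Finset.range n, symmetryCount (s 0) * (K * (N * q * Real.exp (β * q)) * D) :=
        mul_le_mul_of_nonneg_left
          (Finset.sum_le_sum fun k hk => h2 k (Finset.mem_range.1 hk)) (Nat.cast_nonneg _)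
    _ = _ := by
        rw [Finset.sum_const, Finset.card_range, nsmul_eq_mul]; ring

end CWP

/-! ### Lattice approximation and paths of low free energy -/

namespace CWP

open Set Filter Topology

section Lattice

lemma exists_latticeSimplex_dist_le {N q : ℕ} (hN : 0 < N) {w : Fin q → ℝ}
    (hw : w ∈ stdSimplex ℝ (Fin q)) : ∃ z ∈ latticeSimplex N q, dist z w ≤ q / N := by
  have hN' : (0 : ℝ) < N := by exact_mod_cast hN
  have hq : 0 < q := by
    rcases Nat.eq_zero_or_pos q with rfl | h
    · simpa using hw.2
    · exact h
  have hq' : (1 : ℝ) ≤ q := by exact_mod_cast hq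
  let i : Fin q := ⟨0, hq⟩
  set f : Fin q → ℕ := fun k => ⌊N * w k⌋₊ with hf
  have hf1 : ∀ k, (f k : ℝ) ≤ N * w k := fun k => Nat.floor_le (mul_nonneg hN'.le (hw.1 k))
  have hf2 : ∀ k, (N : ℝ) * w k < f k + 1 := fun k => Nat.lt_floor_add_one _
  have hsumw : ∑ k, (N : ℝ) * w k = N := by rw [← Finset.mul_sum, hw.2, mul_one]
  have hle : ∑ k, f k ≤ N := by
    have : ((∑ k, f k : ℕ) : ℝ) ≤ N := by
      rw [Nat.cast_sum, ← hsumw]; exact Finset.sum_le_sum fun k _ => hf1 k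
    exact_mod_cast this
  obtain ⟨R, hR⟩ := Nat.exists_eq_add_of_le hle
  have hR' : (R : ℝ) ≤ q := by
    have h1 : (N : ℝ) ≤ ∑ k, ((f k : ℝ) + 1) := by
      rw [← hsumw]; exact Finset.sum_le_sum fun k _ => (hf2 k).le
    rw [Finset.sum_add_distrib] at h1
    have h2 : (N : ℝ) = ∑ k, (f k : ℝ) + R := by exact_mod_cast hR
    simp at h1
    linarith
  -- Rounding down loses less than one unit per coordinate; the remainder `R ≤ q` is put on one
  -- coordinate to restore the total `N`.
  set n : Fin q → ℕ := fun k => f k + if k = i then R else 0 with hn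
  have hnsum : ∑ k, n k = N := by
    simp only [hn, Finset.sum_add_distrib, Finset.sum_ite_eq', Finset.mem_univ, if_true]
    exact hR.symm
  refine ⟨fun k => n k / N, ⟨⟨fun k => by positivity, ?_⟩, n, fun k => rfl⟩, ?_⟩
  · rw [← Finset.sum_div, ← Nat.cast_sum, hnsum, div_self hN'.ne']
  · refine (dist_pi_le_iff (by positivity)).2 fun k => ?_
    have e : (n k : ℝ) / N - w k = (n k - N * w k) / N := by field_simp
    rw [Real.dist_eq, e, abs_div, abs_of_pos hN']
    refine div_le_div_of_nonneg_right ?_ hN'.le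
    have h1 := hf1 k
    have h2 := hf2 k
    have h3 : (n k : ℝ) = f k + if k = i then (R : ℝ) else 0 := by
      simp only [hn]; push_cast; rfl
    rw [h3, abs_le]
    split_ifs
    · have : (0 : ℝ) ≤ R := Nat.cast_nonneg R
      constructor <;> linarith
    · constructor <;> linarith

lemma exists_dist_closestLatticePoint_lt (q : ℕ) {δ : ℝ} (hδ : 0 < δ) :
    ∃ N₀ : ℕ, ∀ N, N₀ < N → ∀ x ∈ stdSimplex ℝ (Fin q), ∀ y,
      IsClosestLatticePoint N q x y → dist y x < δ := by
  obtain ⟨N₀, hN₀⟩ := exists_nat_gt (((q : ℝ) + 1) * q / δ)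
  refine ⟨N₀, fun N hN x hx y hy => ?_⟩
  have hNpos : 0 < N := by omega
  have hN' : (0 : ℝ) < N := by exact_mod_cast hNpos
  have hlt : ((q : ℝ) + 1) * q / N < δ := by
    have : (N₀ : ℝ) < N := by exact_mod_cast hN
    rw [div_lt_iff₀ hN']
    rw [div_lt_iff₀ hδ] at hN₀
    nlinarith
  obtain ⟨z, hz, hzd⟩ := exists_latticeSimplex_dist_le hNpos hx
  have h1 := hy.2 z hz
  have h2 : ∑ k, (z k - x k) ^ 2 ≤ q * ((q : ℝ) / N) ^ 2 := by
    calc _ ≤ ∑ _k : Fin q, ((q : ℝ) / N) ^ 2 := by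
          refine Finset.sum_le_sum fun k _ => ?_
          have := (dist_le_pi_dist z x k).trans hzd
          rw [Real.dist_eq] at this
          exact sq_le_sq' (by linarith [neg_abs_le (z k - x k)])
            ((le_abs_self _).trans this)
      _ = _ := by simp
  have h0 : (0 : ℝ) ≤ (q : ℝ) / N := by positivity
  refine lt_of_le_of_lt ((dist_pi_le_iff (by positivity)).2 fun k => ?_) hlt
  rw [Real.dist_eq]
  have h3 : (y k - x k) ^ 2 ≤ ∑ k, (y k - x k) ^ 2 :=
    Finset.single_le_sum (f := fun k => (y k - x k) ^ 2) (fun _ _ => sq_nonneg _)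
      (Finset.mem_univ k)
  refine abs_le_of_sq_le_sq ?_ (by positivity)
  have e : ((q : ℝ) + 1) * q / N = (q + 1) * ((q : ℝ) / N) := by ring
  rw [e, mul_pow]
  have : (q : ℝ) * (q / N) ^ 2 ≤ (q + 1) ^ 2 * ((q : ℝ) / N) ^ 2 := by
    refine mul_le_mul_of_nonneg_right ?_ (sq_nonneg _)
    have : (0 : ℝ) ≤ q := Nat.cast_nonneg q
    nlinarith
  linarith

/-- Approximate local minima on the lattice are close to local minima on the simplex. -/
lemma exists_near_minimum_of_lattice_min {q : ℕ} (hq : 2 ≤ q) {β : ℝ} (hβ : betaOne q < β)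
    {δ : ℝ} (hδ : 0 < δ) :
    ∃ N₀ : ℕ, ∀ N, N₀ < N → ∀ y ∈ latticeSimplex N q,
      (∀ z ∈ latticeSimplex N q, dist z y < δ → freeEnergy q β y ≤ freeEnergy q β z) →
      ∃ i ∈ indexSet q β, dist y (minimum q β i) < δ / 2 := by
  by_contra! hcon
  choose N hN y hy hmin hfar using hcon
  obtain ⟨x, hx, φ, hφ, hlim⟩ := (isCompact_stdSimplex ℝ (Fin q)).tendsto_subseq
    (x := y) fun n => (hy n).1
  have hcont := continuous_freeEnergy q β
  -- A competitor `w` within `δ` of the limit is approximated by lattice points `z n`, which are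
  -- eventually within `δ` of `y`; the inequality passes to the limit by continuity.
  have hloc : IsLocalMinOn (freeEnergy q β) (stdSimplex ℝ (Fin q)) x := by
    refine isLocalMinOn_of_forall_dist hδ fun w hw hwx => ?_
    have hz : ∀ n, ∃ z ∈ latticeSimplex (N n) q, dist z w ≤ q / (N n) := fun n =>
      exists_latticeSimplex_dist_le (by have := hN n; omega) hw
    choose z hzm hzd using hz
    have hNlim : Tendsto (fun n => (q : ℝ) / (N (φ n) : ℝ)) atTop (𝓝 0) := by
      refine Tendsto.div_atTop tendsto_const_nhds (tendsto_natCast_atTop_atTop.comp ?_)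
      refine tendsto_atTop_mono (fun n => ?_) hφ.tendsto_atTop
      exact (hN (φ n)).le
    have hzlim : Tendsto (fun n => z (φ n)) atTop (𝓝 w) := by
      rw [tendsto_iff_dist_tendsto_zero]
      exact squeeze_zero (fun _ => dist_nonneg) (fun n => hzd (φ n)) hNlim
    have hd : Tendsto (fun n => dist (z (φ n)) (y (φ n))) atTop (𝓝 (dist w x)) :=
      hzlim.dist hlim
    have hev : ∀ᶠ n in atTop, freeEnergy q β (y (φ n)) ≤ freeEnergy q β (z (φ n)) := by
      filter_upwards [hd.eventually_lt_const hwx] with n hn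
      exact hmin (φ n) _ (hzm (φ n)) hn
    exact le_of_tendsto_of_tendsto ((hcont.tendsto x).comp hlim) ((hcont.tendsto w).comp hzlim) hev
  obtain ⟨i, hi, rfl⟩ := (isLocalMinOn_iff hq hβ hx).1 hloc
  have h1 : Tendsto (fun n => dist (y (φ n)) (minimum q β i)) atTop (𝓝 0) :=
    tendsto_iff_dist_tendsto_zero.1 hlim
  obtain ⟨n, hn⟩ := (h1.eventually_lt_const (half_pos hδ)).exists
  exact absurd hn (not_lt.2 (hfar (φ n) i hi))

end Lattice

variable {N q : ℕ}

/-- The number of sites that have to be recoloured to reach the colour counts `n`. -/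
def deficit (n : Fin q → ℕ) (σ : Config N q) : ℕ := ∑ k, (n k - colourCount σ k)

/-- Both count vectors sum to `N`, so the total surplus equals the total deficit, and either one
bounds each coordinate's discrepancy. -/
lemma abs_colourCount_sub_le {n : Fin q → ℕ} (hn : ∑ k, n k = N) (σ : Config N q) (k : Fin q) :
    |(colourCount σ k : ℝ) - n k| ≤ deficit n σ := by
  have h1 : n k - colourCount σ k ≤ deficit n σ :=
    Finset.single_le_sum (f := fun k => n k - colourCount σ k) (fun _ _ => Nat.zero_le _)
      (Finset.mem_univ k)
  have h2 : colourCount σ k ≤ n k + deficit n σ := by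
    have e1 := Finset.add_sum_erase Finset.univ n (Finset.mem_univ k)
    have e2 := Finset.add_sum_erase Finset.univ (colourCount σ) (Finset.mem_univ k)
    rw [hn] at e1
    rw [sum_colourCount] at e2
    have h3 : ∑ l ∈ Finset.univ.erase k, n l ≤ ∑ l ∈ Finset.univ.erase k, colourCount σ l +
        ∑ l ∈ Finset.univ.erase k, (n l - colourCount σ l) := by
      rw [← Finset.sum_add_distrib]
      exact Finset.sum_le_sum fun l _ => by omega
    have h4 : ∑ l ∈ Finset.univ.erase k, (n l - colourCount σ l) ≤ deficit n σ :=
      Finset.sum_le_sum_of_subset (Finset.subset_univ _)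
    omega
  have h1' : (n k : ℝ) ≤ colourCount σ k + deficit n σ := by
    exact_mod_cast (by omega : n k ≤ colourCount σ k + deficit n σ)
  have h2' : (colourCount σ k : ℝ) ≤ n k + deficit n σ := by exact_mod_cast h2
  rw [abs_le]; constructor <;> linarith

lemma hammingDist_update {σ : Config N q} {i : Fin N} {b : Fin q} (h : σ i ≠ b) :
    hammingDist σ (Function.update σ i b) = 1 := by
  unfold hammingDist
  rw [Finset.card_eq_one]
  refine ⟨i, ?_⟩
  ext j
  by_cases hj : j = i
  · subst hj; simp [h]
  · simp [hj]

lemma colourCount_update_self {σ : Config N q} {i : Fin N} {b : Fin q} (h : σ i ≠ b) :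
    colourCount (Function.update σ i b) b = colourCount σ b + 1 := by
  unfold colourCount
  have : (Finset.univ.filter fun j => Function.update σ i b j = b) =
      insert i (Finset.univ.filter fun j => σ j = b) := by
    ext j
    by_cases hj : j = i
    · subst hj; simp
    · simp [hj]
  rw [this, Finset.card_insert_of_notMem (by simpa using h)]

lemma colourCount_update_old {σ : Config N q} {i : Fin N} {b : Fin q} (h : σ i ≠ b) :
    colourCount (Function.update σ i b) (σ i) + 1 = colourCount σ (σ i) := by
  unfold colourCount
  have : (Finset.univ.filter fun j => σ j = σ i) =
      insert i (Finset.univ.filter fun j => Function.update σ i b j = σ i) := by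
    ext j
    by_cases hj : j = i
    · subst hj; simp
    · simp [hj]
  rw [this, Finset.card_insert_of_notMem (by simpa using h.symm)]

lemma colourCount_update_of_ne {σ : Config N q} {i : Fin N} {b k : Fin q} (hk : k ≠ b)
    (hk' : k ≠ σ i) : colourCount (Function.update σ i b) k = colourCount σ k := by
  unfold colourCount
  congr 1
  ext j
  by_cases hj : j = i
  · subst hj; simp [hk.symm, hk'.symm]
  · simp [hj]

/-- The colour counts as an element of a finite type. -/
def colourVector (σ : Config N q) : Fin q → Fin (N + 1) := fun k =>
  ⟨colourCount σ k, Nat.lt_succ_of_le (colourCount_le σ k)⟩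

lemma colourVector_eq_iff {σ η : Config N q} :
    colourVector σ = colourVector η ↔ colourCount σ = colourCount η := by
  simp [colourVector, funext_iff]

/-- The graph on colour counts whose edges are the single-site changes staying below a given
level of the free energy. -/
def levelGraph (N q : ℕ) (β c : ℝ) : SimpleGraph (Fin q → Fin (N + 1)) where
  Adj y z := y ≠ z ∧ ∃ σ η : Config N q, colourVector σ = y ∧ colourVector η = z ∧
    hammingDist σ η = 1 ∧ freeEnergy q β (empiricalMeasure N q σ) ≤ c ∧
    freeEnergy q β (empiricalMeasure N q η) ≤ c
  symm := ⟨by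
    rintro y z ⟨hne, σ, η, hσ, hη, hd, h1, h2⟩
    exact ⟨hne.symm, η, σ, hη, hσ, by rw [hammingDist_comm]; exact hd, h2, h1⟩⟩
  loopless := ⟨fun y h => h.1 rfl⟩

/-- A walk in the level graph lifts to a path of configurations from any starting point. -/
lemma exists_path_of_walk (hN : 0 < N) {β c : ℝ} {y z : Fin q → Fin (N + 1)}
    (p : (levelGraph N q β c).Walk y z) (σ : Config N q) (hσ : colourVector σ = y) :
    ∃ s : ℕ → Config N q, s 0 = σ ∧ colourVector (s p.length) = z ∧
      (∀ k < p.length, hammingDist (s k) (s (k + 1)) = 1) ∧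
      ∀ k < p.length, freeEnergy q β (empiricalMeasure N q (s k)) ≤ c := by
  induction p generalizing σ with
  | nil => exact ⟨fun _ => σ, rfl, hσ, by simp, by simp⟩
  | cons h p ih =>
    have hadj := h
    obtain ⟨-, σ', η', hσ', hη', hd, h1, -⟩ := hadj
    have hcc : colourCount σ' = colourCount σ := by
      rw [← colourVector_eq_iff, hσ', hσ]
    -- The edge is witnessed by configurations with the right counts, not by `σ` itself; a
    -- permutation of the sites moves it to start at `σ`.
    obtain ⟨π, hπ⟩ := exists_perm_of_colourCount_eq hcc
    obtain ⟨s, hs0, hsn, hsd, hsl⟩ := ih (η' ∘ π)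
      ((colourVector_eq_iff.2 (colourCount_comp_perm η' π)).trans hη')
    refine ⟨fun | 0 => σ | k + 1 => s k, rfl, hsn, fun k hk => ?_, fun k hk => ?_⟩
    · cases k with
      | zero =>
        change hammingDist σ (s 0) = 1
        rw [hs0, ← hπ, hammingDist_comp_perm]
        exact hd
      | succ k => exact hsd k (Nat.lt_of_succ_lt_succ hk)
    · cases k with
      | zero =>
        change freeEnergy q β (empiricalMeasure N q σ) ≤ c
        rw [← (empiricalMeasure_eq_iff hN σ' σ).2 hcc]
        exact h1
      | succ k => exact hsl k (Nat.lt_of_succ_lt_succ hk)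

/-- A simple path visits each colour vector at most once, which makes its length polynomial in `N`.
-/
lemma exists_path_of_reachable (hN : 0 < N) {β c : ℝ} {σ η : Config N q}
    (h : (levelGraph N q β c).Reachable (colourVector σ) (colourVector η)) :
    ∃ n ≤ (N + 1) ^ q, ∃ s : ℕ → Config N q, s 0 = σ ∧ colourCount (s n) = colourCount η ∧
      (∀ k < n, hammingDist (s k) (s (k + 1)) = 1) ∧
      ∀ k < n, freeEnergy q β (empiricalMeasure N q (s k)) ≤ c := by
  classical
  obtain ⟨p, hp⟩ := h.exists_isPath
  have hlen := hp.length_lt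
  obtain ⟨s, hs0, hsn, hsd, hsl⟩ := exists_path_of_walk hN p σ rfl
  refine ⟨p.length, ?_, s, hs0, colourVector_eq_iff.1 hsn, hsd, hsl⟩
  simpa using hlen.le

/-- Moving straight towards given colour counts. -/
lemma exists_reachable_of_deficit {β c : ℝ} {n : Fin q → ℕ} (hn : ∑ k, n k = N)
    (σ : Config N q)
    (hc : ∀ τ : Config N q, deficit n τ ≤ deficit n σ →
      freeEnergy q β (empiricalMeasure N q τ) ≤ c) :
    ∃ η : Config N q, colourCount η = n ∧
      (levelGraph N q β c).Reachable (colourVector σ) (colourVector η) := by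
  induction hd : deficit n σ using Nat.strong_induction_on generalizing σ with
  | _ d ih =>
    by_cases hall : ∀ k, n k ≤ colourCount σ k
    · refine ⟨σ, ?_, SimpleGraph.Reachable.refl _⟩
      have hsum : ∑ k, n k = ∑ k, colourCount σ k := by rw [hn, sum_colourCount]
      funext k
      exact ((Finset.sum_eq_sum_iff_of_le fun k _ => hall k).1 hsum k (Finset.mem_univ k)).symm
    · push Not at hall
      obtain ⟨b, hb⟩ := hall
      obtain ⟨a, ha⟩ : ∃ a, n a < colourCount σ a := by
        by_contra! hcon
        have : ∑ k, colourCount σ k < ∑ k, n k :=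
          Finset.sum_lt_sum (fun k _ => hcon k) ⟨b, Finset.mem_univ b, hb⟩
        rw [hn, sum_colourCount] at this
        omega
      obtain ⟨i, hi⟩ : ∃ i, σ i = a := by
        have : 0 < colourCount σ a := by omega
        obtain ⟨i, hi⟩ := Finset.card_pos.1 this
        exact ⟨i, (Finset.mem_filter.1 hi).2⟩
      have hab : σ i ≠ b := by rintro rfl; subst hi; omega
      -- Recolouring a site from an overfull colour to a deficient one fills one missing place and
      -- creates none.
      have hlt : deficit n (Function.update σ i b) < deficit n σ := by
        refine Finset.sum_lt_sum (fun k _ => ?_) ⟨b, Finset.mem_univ b, ?_⟩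
        · by_cases hkb : k = b
          · subst hkb
            have := colourCount_update_self hab
            omega
          · by_cases hka : k = σ i
            · subst hka
              have := colourCount_update_old hab
              rw [← hi] at ha
              omega
            · rw [colourCount_update_of_ne hkb hka]
        · have := colourCount_update_self hab
          omega
      obtain ⟨η, hη, hreach⟩ := ih _ (hd ▸ hlt) (Function.update σ i b)
        (fun τ hτ => hc τ (hτ.trans hlt.le)) rfl
      refine ⟨η, hη, SimpleGraph.Reachable.trans (SimpleGraph.Adj.reachable ?_) hreach⟩
      refine ⟨fun he => ?_, σ, _, rfl, rfl, hammingDist_update hab, hc σ le_rfl, hc _ hlt.le⟩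
      have := congrFun (colourVector_eq_iff.1 he) b
      have := colourCount_update_self hab
      omega

/-- Nearby lattice points are reachable with a small increase of the free energy. -/
lemma exists_reachable_of_dist_lt (hN : 0 < N) {β ε δ : ℝ}
    (hδ : ∀ x ∈ stdSimplex ℝ (Fin q), ∀ y ∈ stdSimplex ℝ (Fin q), dist x y < δ →
      dist (freeEnergy q β x) (freeEnergy q β y) < ε) (σ : Config N q)
    {z : Fin q → ℝ} (hz : z ∈ latticeSimplex N q)
    (hd : 2 * q * dist z (empiricalMeasure N q σ) < δ) {c : ℝ}
    (hc : freeEnergy q β (empiricalMeasure N q σ) + ε ≤ c) :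
    ∃ η : Config N q, empiricalMeasure N q η = z ∧
      (levelGraph N q β c).Reachable (colourVector σ) (colourVector η) := by
  have hN' : (0 : ℝ) < N := by exact_mod_cast hN
  obtain ⟨hzs, n, hzn⟩ := hz
  have hn : ∑ k, n k = N := by
    have h1 := hzs.2
    simp only [hzn, ← Finset.sum_div] at h1
    rw [div_eq_one_iff_eq hN'.ne'] at h1
    exact_mod_cast h1
  have hdist : ∀ τ : Config N q, dist (empiricalMeasure N q τ) z ≤ deficit n τ / N := by
    intro τ
    refine (dist_pi_le_iff (by positivity)).2 fun k => ?_
    rw [Real.dist_eq, empiricalMeasure_apply, hzn, ← sub_div, abs_div, abs_of_pos hN']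
    exact div_le_div_of_nonneg_right (abs_colourCount_sub_le hn τ k) hN'.le
  -- Every configuration of no larger deficit lies within twice this bound of `σ`; this is the
  -- factor `2 * q` in the hypothesis.
  have hdef : (deficit n σ : ℝ) / N ≤ q * dist z (empiricalMeasure N q σ) := by
    rw [div_le_iff₀ hN', deficit, Nat.cast_sum]
    calc ∑ k, ((n k - colourCount σ k : ℕ) : ℝ)
        ≤ ∑ _k : Fin q, dist z (empiricalMeasure N q σ) * N := by
          refine Finset.sum_le_sum fun k _ => ?_
          have h1 := dist_le_pi_dist z (empiricalMeasure N q σ) k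
          rw [Real.dist_eq, empiricalMeasure_apply, hzn, ← sub_div, abs_div, abs_of_pos hN',
            div_le_iff₀ hN'] at h1
          refine le_trans ?_ h1
          rcases le_total (n k) (colourCount σ k) with h | h
          · rw [Nat.sub_eq_zero_of_le h]; simp
          · rw [Nat.cast_sub h]; exact le_abs_self _
      _ = _ := by simp; ring
  obtain ⟨η, hη, hreach⟩ := exists_reachable_of_deficit (β := β) (c := c) hn σ fun τ hτ => by
    have h1 : dist (empiricalMeasure N q τ) (empiricalMeasure N q σ) < δ := by
      have a1 := hdist τ
      have a2 := hdist σ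
      have a3 : (deficit n τ : ℝ) / N ≤ deficit n σ / N :=
        div_le_div_of_nonneg_right (by exact_mod_cast hτ) hN'.le
      have a4 := dist_triangle_right (empiricalMeasure N q τ) (empiricalMeasure N q σ) z
      linarith
    have h2 := hδ _ (empiricalMeasure_mem_latticeSimplex hN τ).1 _
      (empiricalMeasure_mem_latticeSimplex hN σ).1 h1
    rw [Real.dist_eq] at h2
    linarith [le_abs_self (freeEnergy q β (empiricalMeasure N q τ) -
      freeEnergy q β (empiricalMeasure N q σ))]
  refine ⟨η, ?_, hreach⟩
  funext k
  rw [empiricalMeasure_apply, hη, hzn]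

/-- From every configuration one of the metastable points can be reached with an arbitrarily small
increase of the free energy. -/
theorem exists_reachable_minimum {q : ℕ} (hq : 2 ≤ q) {β : ℝ} (hβ : betaOne q < β) {ε : ℝ}
    (hε : 0 < ε) :
    ∃ N₀ : ℕ, ∀ N, N₀ < N → ∀ m : indexSet q β → Fin q → ℝ,
      (∀ i : indexSet q β, IsClosestLatticePoint N q (minimum q β i) (m i)) →
      ∀ σ : Config N q, ∃ i, ∃ η : Config N q, empiricalMeasure N q η = m i ∧
        (levelGraph N q β (freeEnergy q β (empiricalMeasure N q σ) + ε)).Reachable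
          (colourVector σ) (colourVector η) := by
  classical
  have huc := (isCompact_stdSimplex ℝ (Fin q)).uniformContinuousOn_of_continuous
    (continuous_freeEnergy q β).continuousOn
  obtain ⟨δ₁, hδ₁, huc⟩ := Metric.uniformContinuousOn_iff.1 huc ε hε
  have hq0 : (0 : ℝ) < q := by exact_mod_cast (by omega : 0 < q)
  set δ := δ₁ / (2 * q) with hδdef
  have hδ : 0 < δ := by positivity
  have hδlt : ∀ r, r < δ → 2 * q * r < δ₁ := fun r hr => by
    rw [hδdef, lt_div_iff₀ (by positivity)] at hr; linarith
  obtain ⟨N₁, hN₁⟩ := exists_near_minimum_of_lattice_min hq hβ hδ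
  obtain ⟨N₂, hN₂⟩ := exists_dist_closestLatticePoint_lt q (half_pos hδ)
  refine ⟨max N₁ N₂, fun N hN m hm σ => ?_⟩
  have hNpos : 0 < N := by omega
  set c := freeEnergy q β (empiricalMeasure N q σ) + ε with hc
  set R : Finset (Config N q) := Finset.univ.filter fun τ =>
    (levelGraph N q β c).Reachable (colourVector σ) (colourVector τ) with hR
  have hσR : σ ∈ R := by simp [hR]
  -- The lowest reachable configuration lies at or below the start, so `c` still leaves room `ε`
  -- above it. Its lattice neighbours are then reachable too, and it is a local minimum on the
  -- lattice.
  obtain ⟨τ, hτR, hτmin⟩ := R.exists_min_image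
    (fun τ => freeEnergy q β (empiricalMeasure N q τ)) ⟨σ, hσR⟩
  have hτr : (levelGraph N q β c).Reachable (colourVector σ) (colourVector τ) :=
    (Finset.mem_filter.1 hτR).2
  have hτc : freeEnergy q β (empiricalMeasure N q τ) + ε ≤ c := by linarith [hτmin σ hσR]
  have hlmin : ∀ z ∈ latticeSimplex N q, dist z (empiricalMeasure N q τ) < δ →
      freeEnergy q β (empiricalMeasure N q τ) ≤ freeEnergy q β z := by
    intro z hz hd
    obtain ⟨η, rfl, hη⟩ := exists_reachable_of_dist_lt hNpos huc τ hz (hδlt _ hd) hτc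
    exact hτmin η (by simp only [hR, Finset.mem_filter, Finset.mem_univ, true_and]
                      exact hτr.trans hη)
  obtain ⟨i, hi, hdi⟩ := hN₁ N (by omega) _ (empiricalMeasure_mem_latticeSimplex hNpos τ) hlmin
  have hmi := hN₂ N (by omega) _ (minimum_mem_stdSimplex hq hβ i) _ (hm ⟨i, hi⟩)
  obtain ⟨η, hη, hreach⟩ := exists_reachable_of_dist_lt hNpos huc τ (hm ⟨i, hi⟩).1
    (hδlt _ (by
      have := dist_triangle_right (m ⟨i, hi⟩) (empiricalMeasure N q τ) (minimum q β i)
      linarith)) hτc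
  exact ⟨⟨i, hi⟩, η, hη, hτr.trans hreach⟩

end CWP

/-! ### Bounds for the two escape probabilities -/

namespace CWP

open Set Filter Topology

section Bounds

variable {N q : ℕ}

lemma gibbs_ne_zero (β : ℝ≥0) {A : Set (Config N q)} (hA : A.Nonempty) : gibbs N q β A ≠ 0 := by
  obtain ⟨σ, hσ⟩ := hA
  have h1 : gibbs N q β {σ} ≤ gibbs N q β A := measure_mono (by simpa using hσ)
  rw [gibbs_singleton] at h1
  exact (lt_of_lt_of_le (ENNReal.ofReal_pos.2 (gibbsWeight_pos β σ)) h1).ne'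

lemma gibbs_real_pos (β : ℝ≥0) {A : Set (Config N q)} (hA : A.Nonempty) :
    0 < (gibbs N q β).real A :=
  ENNReal.toReal_pos (gibbs_ne_zero β hA) (measure_ne_top _ _)

lemma escapeProb_mul_gibbs_real (β : ℝ≥0) {A B : Set (Config N q)} (hAB : Disjoint A B)
    (hA : A.Nonempty) :
    MarkovChain.escapeProb (glauber N q β) (gibbs N q β) A B * (gibbs N q β).real A =
      MarkovChain.dirichlet (glauber N q β) (gibbsWeight N q β)
        (MarkovChain.potential (glauber N q β) A B) / 2 := by
  have e : (fun σ => (gibbs N q β).real {σ}) = gibbsWeight N q β :=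
    funext fun σ => gibbs_real_singleton β σ
  have h := MarkovChain.escapeProb_mul_real (glauber N q β) (gibbs N q β)
    (by rw [e]; exact glauber_isReversible β) hAB (gibbs_ne_zero β hA)
  rwa [e] at h

open Classical in
/-- Bounding the mass of a set by the masses of its colour classes, of which there are at most
`(N + 1) ^ q`. -/
lemma gibbs_real_le_of_forall_class (β : ℝ≥0) {A : Set (Config N q)} {T : ℝ} (hT : 0 ≤ T)
    (h : ∀ σ ∈ A, ∑ η ∈ Finset.univ.filter (fun η => η ∈ A ∧ colourCount η = colourCount σ),
      gibbsWeight N q β η ≤ T) : (gibbs N q β).real A ≤ (N + 1) ^ q * T := by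
  rw [gibbs_real_eq_sum, ← Finset.sum_fiberwise (Finset.univ.filter (· ∈ A)) colourVector]
  calc _ ≤ ∑ _v : Fin q → Fin (N + 1), T := by
        refine Finset.sum_le_sum fun v _ => ?_
        by_cases hv : ∃ σ ∈ A, colourVector σ = v
        · obtain ⟨σ, hσ, rfl⟩ := hv
          refine le_trans (le_of_eq (Finset.sum_congr ?_ fun _ _ => rfl)) (h σ hσ)
          ext η
          simp [colourVector_eq_iff]
        · push Not at hv
          rw [Finset.sum_eq_zero]
          · exact hT
          · intro η hη
            simp only [Finset.mem_filter, Finset.mem_univ, true_and] at hη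
            exact absurd hη.2 (hv η hη.1)
    _ = _ := by simp

/-- Lower bound for the probability of reaching the union of the metastable sets. -/
lemma one_le_mul_escapeProb (hN : 0 < N) (hq : 0 < q) {β : ℝ≥0} (hβ : 0 < β) {ε : ℝ}
    {M X : Set (Config N q)} (hX : X.Nonempty) (hXM : Disjoint X M)
    (hM : ∀ σ ∈ M, ∀ η, colourCount η = colourCount σ → η ∈ M)
    (hreach : ∀ σ : Config N q, ∃ η ∈ M,
      (levelGraph N q β (freeEnergy q β (empiricalMeasure N q σ) + ε)).Reachable
        (colourVector σ) (colourVector η)) :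
    1 ≤ 2 * ((N + 1) ^ q * (((N + 1) ^ q) ^ 2 * (Real.exp (q * (1 + Real.log (N + 1))) *
      Real.exp (β * N * ε)) * (N * q * Real.exp (β * q)))) *
        MarkovChain.escapeProb (glauber N q β) (gibbs N q β) X M := by
  classical
  set u := MarkovChain.potential (glauber N q β) X M with hu
  set D := MarkovChain.dirichlet (glauber N q β) (gibbsWeight N q β) u with hD
  have hD0 : 0 ≤ D := MarkovChain.dirichlet_nonneg _ (fun σ => (gibbsWeight_pos β σ).le) u
  set C : ℝ := ((N + 1 : ℝ) ^ q) ^ 2 * (Real.exp (q * (1 + Real.log (N + 1))) *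
      Real.exp (β * N * ε)) * (N * q * Real.exp (β * q)) with hC
  have hC0 : 0 ≤ C := by positivity
  have hpos := gibbs_real_pos β hX
  have hesc := escapeProb_mul_gibbs_real β hXM hX
  -- Each colour class of `X` is joined to `M` by its own low path, along which the potential climbs
  -- from 0 to 1. There are at most `(N + 1) ^ q` classes.
  have hle : (gibbs N q β).real X ≤ (N + 1) ^ q * (C * D) := by
    refine gibbs_real_le_of_forall_class β (mul_nonneg hC0 hD0) fun σ hσ => ?_
    obtain ⟨η, hηM, hη⟩ := hreach σ
    obtain ⟨n, hn, s, rfl, hsn, hsd, hsl⟩ := exists_path_of_reachable hN hη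
    have h := card_mul_gibbsWeight_le hN hq hβ (u := u) hsd hsl
      (X := Finset.univ.filter fun η => η ∈ X ∧ colourCount η = colourCount (s 0))
      (fun τ hτ => by
        simp only [Finset.mem_filter, Finset.mem_univ, true_and] at hτ
        exact ⟨hτ.2, MarkovChain.potential_of_mem_left _ _ hτ.1⟩)
      (fun τ hτ => MarkovChain.potential_of_mem_right _ hXM (hM η hηM τ (hτ.trans hsn)))
    rw [Finset.sum_congr rfl (g := fun _ => gibbsWeight N q β (s 0)) fun τ hτ =>
      gibbsWeight_congr hN β (Finset.mem_filter.1 hτ).2.2, Finset.sum_const, nsmul_eq_mul]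
    refine h.trans ?_
    refine mul_le_mul_of_nonneg_right ?_ hD0
    have hn' : (n : ℝ) ≤ (N + 1) ^ q := by exact_mod_cast hn
    rw [hC]
    gcongr
  rw [← hD] at hesc
  have h2 : (gibbs N q β).real X * 1 ≤ (gibbs N q β).real X *
      (2 * ((N + 1) ^ q * C) *
        MarkovChain.escapeProb (glauber N q β) (gibbs N q β) X M) := by
    calc _ ≤ (N + 1) ^ q * (C * D) := by linarith
      _ = 2 * ((N + 1) ^ q * C) * (D / 2) := by ring
      _ = _ := by rw [← hesc]; ring
  exact le_of_mul_le_mul_left h2 hpos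

open Classical in
/-- The mass of a set of configurations with free energy bounded below, relative to the colour
class of a reference configuration. -/
lemma gibbs_real_le_of_freeEnergy_ge (hN : 0 < N) {β : ℝ≥0} (hβ : 0 < β) {A : Set (Config N q)}
    (τ : Config N q) {δ : ℝ}
    (h : ∀ σ ∈ A, freeEnergy q β (empiricalMeasure N q τ) + δ ≤
      freeEnergy q β (empiricalMeasure N q σ)) :
    (gibbs N q β).real A ≤ (N + 1) ^ q * (Real.exp (q * (1 + Real.log (N + 1))) *
      Real.exp (-(β * N * δ)) * (gibbs N q β).real {η | colourCount η = colourCount τ}) := by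
  have hclass : ∀ σ : Config N q, (gibbs N q β).real {η | colourCount η = colourCount σ} =
      (colourClass σ).card * gibbsWeight N q β σ := by
    intro σ
    rw [gibbs_real_eq_sum, Finset.sum_congr (s₂ := colourClass σ) (by ext; simp [colourClass])
      fun η _ => rfl, Finset.sum_congr rfl (g := fun _ => gibbsWeight N q β σ) fun η hη =>
        gibbsWeight_congr hN β (mem_colourClass.1 hη), Finset.sum_const, nsmul_eq_mul]
  refine gibbs_real_le_of_forall_class β (by positivity) fun σ hσ => ?_
  have h1 : ∑ η ∈ Finset.univ.filter (fun η => η ∈ A ∧ colourCount η = colourCount σ),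
      gibbsWeight N q β η ≤ (gibbs N q β).real {η | colourCount η = colourCount σ} := by
    rw [gibbs_real_eq_sum]
    refine Finset.sum_le_sum_of_subset_of_nonneg (fun η hη => ?_)
      fun η _ _ => (gibbsWeight_pos β η).le
    simp only [Finset.mem_filter, Finset.mem_univ, true_and] at hη
    simpa using hη.2
  refine h1.trans ?_
  rw [hclass, hclass]
  have hcσ : (0 : ℝ) < symmetryCount σ := by exact_mod_cast symmetryCount_pos σ
  have hcτ : (0 : ℝ) < symmetryCount τ := by exact_mod_cast symmetryCount_pos τ
  have e1 := symmetryCount_mul_card_colourClass σ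
  have e2 := symmetryCount_mul_card_colourClass τ
  have hw := gibbsWeight_mul_symmetryCount_le hN hβ σ τ
  have hwτ := gibbsWeight_pos β τ
  set K := Real.exp (q * (1 + Real.log (N + 1)))
  have hK : 0 < K := Real.exp_pos _
  have hexp : Real.exp (β * N * (freeEnergy q β (empiricalMeasure N q τ) -
          freeEnergy q β (empiricalMeasure N q σ))) ≤ Real.exp (-(β * N * δ)) := by
    refine Real.exp_le_exp.2 ?_
    have : (β : ℝ) * N * (freeEnergy q β (empiricalMeasure N q τ) -
          freeEnergy q β (empiricalMeasure N q σ)) ≤ β * N * (-δ) :=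
      mul_le_mul_of_nonneg_left (by linarith [h σ hσ]) (by positivity)
    linarith
  -- Cross-multiplication by the symmetry counts turns both class cardinalities into `N!`, which
  -- leaves the comparison of weights `hw`.
  refine le_of_mul_le_mul_left ?_ (mul_pos hcσ hcτ)
  calc (symmetryCount σ : ℝ) * symmetryCount τ * ((colourClass σ).card * gibbsWeight N q β σ)
      = (symmetryCount σ * (colourClass σ).card) * (gibbsWeight N q β σ * symmetryCount τ) := by
        ring
    _ = N.factorial * (gibbsWeight N q β σ * symmetryCount τ) := by rw [e1]
    _ ≤ N.factorial * (K * Real.exp (-(β * N * δ)) *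
          (gibbsWeight N q β τ * symmetryCount σ)) := by
        refine mul_le_mul_of_nonneg_left (hw.trans ?_) (Nat.cast_nonneg _)
        gcongr
    _ = symmetryCount τ * (colourClass τ).card * (K * Real.exp (-(β * N * δ)) *
          (gibbsWeight N q β τ * symmetryCount σ)) := by rw [e2]
    _ = _ := by ring

open Classical in
/-- Upper bound for a capacity by the mass of the boundary of a separating set. -/
lemma dirichlet_indicator_le (β : ℝ≥0) (A B : Set (Config N q))
    (hAB : ∀ σ η, hammingDist σ η = 1 → (σ ∈ A ↔ η ∉ A) → σ ∈ B) :
    MarkovChain.dirichlet (glauber N q β) (gibbsWeight N q β)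
      (fun σ => if σ ∈ A then 0 else 1) ≤ (gibbs N q β).real B := by
  rw [gibbs_real_eq_sum, Finset.sum_filter]
  refine Finset.sum_le_sum fun σ _ => ?_
  have hrow : ∑ η, (glauber N q β).1 σ η = 1 :=
    Matrix.sum_row_of_mem_rowStochastic (glauber N q β).2 σ
  have hw := (gibbsWeight_pos β σ).le
  by_cases hB : σ ∈ B
  · rw [if_pos hB]
    calc _ ≤ ∑ η, gibbsWeight N q β σ * (glauber N q β).1 σ η := by
          refine Finset.sum_le_sum fun η _ => ?_
          have := (glauber N q β).2.1 σ η
          refine mul_le_of_le_one_right (by positivity) ?_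
          simp only
          split_ifs <;> norm_num
      _ = _ := by rw [← Finset.mul_sum, hrow, mul_one]
  · rw [if_neg hB]
    refine le_of_eq (Finset.sum_eq_zero fun η _ => ?_)
    by_cases hiff : σ ∈ A ↔ η ∈ A
    · simp [hiff]
    · have hne : σ ≠ η := by rintro rfl; exact hiff Iff.rfl
      have h1 : hammingDist σ η ≠ 1 := fun h => hB (hAB σ η h (by tauto))
      rw [glauber_eq_zero β hne h1]; simp

end Bounds

/-- A free-energy barrier around each metastable point, at any small enough distance. -/
lemma exists_barrier {q : ℕ} (hq : 2 ≤ q) {β : ℝ} (hβ : betaOne q < β)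
    {i : Option (Fin q)} (hi : i ∈ indexSet q β) {ρ : ℝ} (hρ : 0 < ρ) :
    ∃ r > 0, r ≤ ρ ∧ ∃ δ > 0, ∀ y ∈ stdSimplex ℝ (Fin q),
      r / 2 ≤ dist y (minimum q β i) → dist y (minimum q β i) ≤ 3 * r / 2 →
      freeEnergy q β (minimum q β i) + 2 * δ ≤ freeEnergy q β y := by
  obtain ⟨R, hR, hmin⟩ := exists_strict_min_minimum hq hβ hi
  -- With `r ≤ R / 2` the shell up to `3 * r / 2` stays inside the ball where the minimum is strict,
  -- while its inner radius keeps it away from the centre.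
  set r := min ρ (R / 2) with hr
  have hr0 : 0 < r := by positivity
  have hrR : r ≤ R / 2 := min_le_right _ _
  refine ⟨r, hr0, min_le_left _ _, ?_⟩
  set K := stdSimplex ℝ (Fin q) ∩ {y | r / 2 ≤ dist y (minimum q β i) ∧
    dist y (minimum q β i) ≤ 3 * r / 2} with hK
  have hKc : IsCompact K := by
    refine (isCompact_stdSimplex ℝ (Fin q)).inter_right ?_
    have hc : Continuous fun y => dist y (minimum q β i) := by fun_prop
    exact (isClosed_le continuous_const hc).inter (isClosed_le hc continuous_const)
  rcases K.eq_empty_or_nonempty with he | hne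
  · refine ⟨1, one_pos, fun y hy h1 h2 => ?_⟩
    have : y ∈ K := ⟨hy, h1, h2⟩
    rw [he] at this; exact this.elim
  · obtain ⟨x, hx, hxmin⟩ := hKc.exists_isMinOn hne (continuous_freeEnergy q β).continuousOn
    have hlt := hmin x hx.1 (by
      rintro rfl
      have := hx.2.1
      rw [dist_self] at this
      linarith) (by linarith [hx.2.2])
    refine ⟨(freeEnergy q β x - freeEnergy q β (minimum q β i)) / 2, by linarith,
      fun y hy h1 h2 => ?_⟩
    have : freeEnergy q β x ≤ freeEnergy q β y := hxmin ⟨hy, h1, h2⟩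
    linarith

lemma exists_separation {q : ℕ} (hq : 2 ≤ q) {β : ℝ} (hβ : betaOne q < β) :
    ∃ ρ > 0, ∀ i j, i ≠ j → 2 * ρ ≤ dist (minimum q β i) (minimum q β j) := by
  let T := {p : Option (Fin q) × Option (Fin q) // p.1 ≠ p.2}
  have : Nonempty T := ⟨⟨(none, some ⟨0, by omega⟩), by simp⟩⟩
  obtain ⟨p, hp⟩ := Finite.exists_min fun p : T => dist (minimum q β p.1.1) (minimum q β p.1.2)
  have hpos : 0 < dist (minimum q β p.1.1) (minimum q β p.1.2) :=
    dist_pos.2 fun h => p.2 (minimum_injective hq hβ h)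
  exact ⟨_, half_pos hpos, fun i j hij => by linarith [hp ⟨(i, j), hij⟩]⟩

lemma indexSet_nonempty {q : ℕ} (hq : 2 ≤ q) (β : ℝ) : Nonempty (indexSet q β) :=
  ⟨⟨some ⟨0, by omega⟩, by unfold indexSet; split_ifs <;> simp⟩⟩

/-- Upper bound for the probability of leaving a metastable set for another one. -/
lemma exists_escapeProb_le {q : ℕ} (hq : 2 ≤ q) {β : ℝ≥0} (hβ : betaOne q < β) {ρ : ℝ}
    (hρ : 0 < ρ)
    (hsep : ∀ i j, i ≠ j → 2 * ρ ≤ dist (minimum q β i) (minimum q β j))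
    (j : indexSet q β) :
    ∃ δ > 0, ∃ N₀ : ℕ, ∀ N, N₀ < N → ∀ m : indexSet q β → Fin q → ℝ,
      (∀ i : indexSet q β, IsClosestLatticePoint N q (minimum q β i) (m i)) →
      (empiricalMeasure N q ⁻¹' {m j}).Nonempty →
      MarkovChain.escapeProb (glauber N q β) (gibbs N q β) (empiricalMeasure N q ⁻¹' {m j})
        ((⋃ i, empiricalMeasure N q ⁻¹' {m i}) \ empiricalMeasure N q ⁻¹' {m j}) ≤
      (N + 1) ^ q * (Real.exp (q * (1 + Real.log (N + 1))) * Real.exp (-(β * N * δ))) := by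
  classical
  have hβ0 : (0 : ℝ) < β := (exists_meanField_neg hq hβ).1
  obtain ⟨r, hr0, hrρ, δ, hδ, hbar⟩ := exists_barrier hq hβ j.2 hρ
  -- The barrier is `2 * δ` high; one `δ` is spent on replacing the minimum by its lattice
  -- approximation `m j`.
  obtain ⟨θ, hθ, hcont⟩ := Metric.continuous_iff.1 (continuous_freeEnergy q β)
    (minimum q β j) δ hδ
  obtain ⟨N₁, hN₁⟩ := exists_dist_closestLatticePoint_lt q
    (lt_min hθ (lt_min hr0 hρ) : 0 < min θ (min r ρ))
  -- A single-site change then moves the empirical measure by at most `r / 2`, so every edge across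
  -- the sphere of radius `r` has both ends in the shell.
  obtain ⟨N₂, hN₂⟩ := exists_nat_gt (2 / r)
  refine ⟨δ, hδ, max N₁ N₂, fun N hN m hm hne => ?_⟩
  have hNpos : 0 < N := by omega
  have hN' : (0 : ℝ) < N := by exact_mod_cast hNpos
  have hNr : 1 / (N : ℝ) ≤ r / 2 := by
    have : (N₂ : ℝ) < N := by exact_mod_cast (by omega : N₂ < N)
    rw [div_lt_iff₀ hr0] at hN₂
    rw [div_le_iff₀ hN']
    nlinarith
  have hclose : ∀ i : indexSet q β, dist (m i) (minimum q β i) < min θ (min r ρ) := fun i =>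
    hN₁ N (by omega) _ (minimum_mem_stdSimplex hq hβ i) _ (hm i)
  set Mj : Set (Config N q) := empiricalMeasure N q ⁻¹' {m j} with hMj
  set B : Set (Config N q) := (⋃ i, empiricalMeasure N q ⁻¹' {m i}) \ Mj with hB
  have hdisj : Disjoint Mj B := disjoint_sdiff_self_right
  set A : Set (Config N q) := {σ | dist (empiricalMeasure N q σ) (minimum q β j) < r} with hA
  set S : Set (Config N q) := {σ | r / 2 ≤ dist (empiricalMeasure N q σ) (minimum q β j) ∧
    dist (empiricalMeasure N q σ) (minimum q β j) ≤ 3 * r / 2} with hS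
  obtain ⟨τ, hτ⟩ := hne
  have hτ' : empiricalMeasure N q τ = m j := hτ
  have hclass : {η : Config N q | colourCount η = colourCount τ} = Mj := by
    ext η
    rw [mem_ofPred_eq, ← empiricalMeasure_eq_iff hNpos, hτ']
    rfl
  have hcap := MarkovChain.dirichlet_potential_le (glauber N q β) (glauber_isReversible β)
    (fun σ => (gibbsWeight_pos β σ).le) hdisj (v := fun σ => if σ ∈ A then 0 else 1)
    (fun σ hσ => by
      have h1 : empiricalMeasure N q σ = m j := hσ
      have : σ ∈ A := by
        change dist (empiricalMeasure N q σ) (minimum q β j) < r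
        rw [h1]
        exact (hclose j).trans_le ((min_le_right _ _).trans (min_le_left _ _))
      simp [this])
    (fun σ hσ => by
      obtain ⟨hσ1, hσ2⟩ := hσ
      obtain ⟨i, hi⟩ := mem_iUnion.1 hσ1
      have hi' : empiricalMeasure N q σ = m i := hi
      have hij : i ≠ j := by rintro rfl; exact hσ2 hi
      have : σ ∉ A := by
        change ¬ dist (empiricalMeasure N q σ) (minimum q β j) < r
        rw [hi']
        have h1 := hsep i j fun h => hij (Subtype.ext h)
        have h2 := (hclose i).trans_le ((min_le_right _ _).trans (min_le_right _ _))
        have h3 := dist_triangle_left (minimum q β i) (minimum q β j) (m i)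
        linarith
      simp [this])
  have hshell := dirichlet_indicator_le β A S fun σ η h1 h2 => by
    have hd : |dist (empiricalMeasure N q σ) (minimum q β j) -
        dist (empiricalMeasure N q η) (minimum q β j)| ≤ 1 / N := by
      refine (abs_dist_sub_le _ _ _).trans ((dist_pi_le_iff (by positivity)).2 fun k => ?_)
      have := abs_empiricalMeasure_sub_le σ η k
      rwa [h1, Nat.cast_one] at this
    have hd' := abs_le.1 hd
    have h2' : dist (empiricalMeasure N q σ) (minimum q β j) < r ↔
      ¬ dist (empiricalMeasure N q η) (minimum q β j) < r := h2
    change r / 2 ≤ dist (empiricalMeasure N q σ) (minimum q β j) ∧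
      dist (empiricalMeasure N q σ) (minimum q β j) ≤ 3 * r / 2
    by_cases h : dist (empiricalMeasure N q σ) (minimum q β j) < r
    · have := not_lt.1 (h2'.1 h)
      constructor <;> linarith
    · have : dist (empiricalMeasure N q η) (minimum q β j) < r := by
        by_contra hcon; exact h (h2'.2 hcon)
      constructor <;> linarith
  have hmass := gibbs_real_le_of_freeEnergy_ge hNpos (β := β) (by exact_mod_cast hβ0) (A := S) τ
    (δ := δ) fun σ hσ => by
      have h1 := hbar _ (empiricalMeasure_mem_latticeSimplex hNpos σ).1 hσ.1 hσ.2
      have h2 := hcont (m j) ((hclose j).trans_le (min_le_left _ _))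
      rw [Real.dist_eq] at h2
      have h3 := (abs_lt.1 h2).2
      rw [hτ']
      linarith
  rw [hclass] at hmass
  have hpos := gibbs_real_pos β (A := Mj) ⟨τ, hτ⟩
  have hesc := escapeProb_mul_gibbs_real β hdisj ⟨τ, hτ⟩
  have hD0 := MarkovChain.dirichlet_nonneg (glauber N q β)
    (fun σ => (gibbsWeight_pos β σ).le) (MarkovChain.potential (glauber N q β) Mj B)
  refine le_of_mul_le_mul_right ?_ hpos
  rw [hesc]
  linarith

end CWP

/-! ### Assembling the exponential estimate -/

namespace CWP

open Set Filter Topology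

lemma exists_mul_pow_le_exp (C : ℝ) (p : ℕ) {κ : ℝ} (hκ : 0 < κ) :
    ∃ N₀ : ℕ, ∀ N : ℕ, N₀ < N → C * ((N : ℝ) + 1) ^ p ≤ Real.exp (κ * N) := by
  have h1 : Tendsto (fun x : ℝ => C * Real.exp κ * (x ^ p / Real.exp (κ * x))) atTop (𝓝 0) := by
    have := (tendsto_rpow_mul_exp_neg_mul_atTop_nhds_zero p κ hκ).const_mul (C * Real.exp κ)
    rw [mul_zero] at this
    refine this.congr fun x => ?_
    rw [Real.rpow_natCast, neg_mul, Real.exp_neg]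
    rfl
  have h2 : Tendsto (fun N : ℕ => (N : ℝ) + 1) atTop atTop :=
    tendsto_atTop_add_const_right _ _ tendsto_natCast_atTop_atTop
  obtain ⟨N₀, hN₀⟩ := eventually_atTop.1 ((h1.comp h2).eventually_lt_const one_pos)
  refine ⟨N₀, fun N hN => ?_⟩
  have h := (hN₀ N hN.le).le
  simp only [Function.comp_apply] at h
  have hE := Real.exp_pos (κ * ((N : ℝ) + 1))
  rw [mul_div_assoc', div_le_one hE, mul_add, mul_one, Real.exp_add] at h
  have hk := Real.exp_pos κ
  refine le_of_mul_le_mul_right ?_ hk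
  linarith

lemma exp_mul_one_add_log (q N : ℕ) :
    Real.exp (q * (1 + Real.log (N + 1))) = Real.exp q * ((N : ℝ) + 1) ^ q := by
  have hN : (0 : ℝ) < (N : ℝ) + 1 := by positivity
  rw [mul_add, mul_one, Real.exp_add, mul_comm (q : ℝ) (Real.log _), Real.exp_mul,
    Real.exp_log hN, Real.rpow_natCast]

lemma exists_config_of_mem_latticeSimplex {N q : ℕ} (hN : 0 < N) (hq : 0 < q) {z : Fin q → ℝ}
    (hz : z ∈ latticeSimplex N q) : ∃ σ : Config N q, empiricalMeasure N q σ = z := by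
  have hN' : (0 : ℝ) < N := by exact_mod_cast hN
  obtain ⟨hzs, n, hzn⟩ := hz
  have hn : ∑ k, n k = N := by
    have h1 := hzs.2
    simp only [hzn, ← Finset.sum_div] at h1
    rw [div_eq_one_iff_eq hN'.ne'] at h1
    exact_mod_cast h1
  -- The level is an upper bound for all energies, so it imposes nothing; only the recolouring
  -- procedure matters, and the inverse temperature 1 is arbitrary.
  obtain ⟨c, hc⟩ := (Set.finite_range fun τ : Config N q =>
    freeEnergy q 1 (empiricalMeasure N q τ)).bddAbove
  obtain ⟨η, hη, -⟩ := exists_reachable_of_deficit (β := 1) (c := c) hn (fun _ => ⟨0, hq⟩)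
    fun τ _ => hc ⟨τ, rfl⟩
  refine ⟨η, funext fun k => ?_⟩
  rw [empiricalMeasure_apply, hη, hzn]

/-- A monochromatic configuration is far from all the points `m_i`. -/
lemma exists_monochromatic_far {q : ℕ} (hq : 2 ≤ q) {β : ℝ} (hβ : betaOne q < β) :
    ∃ ρ > 0, ∀ N : ℕ, 0 < N → ∃ σ : Config N q, ∀ i,
      ρ ≤ dist (empiricalMeasure N q σ) (minimum q β i) := by
  let k : Fin q := ⟨0, by omega⟩
  obtain ⟨i₀, hi₀⟩ := Finite.exists_max fun i => minimum q β i k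
  refine ⟨1 - minimum q β i₀ k, sub_pos.2 (minimum_lt_one hq hβ i₀ k), fun N hN =>
    ⟨fun _ => k, fun i => ?_⟩⟩
  have hN' : (N : ℝ) ≠ 0 := by positivity
  have h1 : empiricalMeasure N q (fun _ => k) k = 1 := by
    simp [empiricalMeasure, hN']
  have h2 := dist_le_pi_dist (empiricalMeasure N q fun _ => k) (minimum q β i) k
  rw [h1, Real.dist_eq] at h2
  linarith [hi₀ i, le_abs_self (1 - minimum q β i k)]

end CWP

theorem theorem1 (q : ℕ) (hq : 2 ≤ q) (β : ℝ≥0) (hβ : CWP.betaOne q < (β : ℝ)) :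
    ∃ k₁ : ℝ, 0 < k₁ ∧ ∃ N₀ : ℕ, ∀ N : ℕ, N₀ < N →
      ∀ m : CWP.indexSet q β → Fin q → ℝ,
        (∀ i : CWP.indexSet q β, CWP.IsClosestLatticePoint N q (CWP.minimum q β i) (m i)) →
        MarkovChain.IsMetastable (CWP.glauber N q β) (CWP.gibbs N q β) (Real.exp (-k₁ * N))
          (fun i : CWP.indexSet q β => CWP.empiricalMeasure N q ⁻¹' {m i}) := by
  classical
  have hβ0 : (0 : ℝ) < β := (CWP.exists_meanField_neg hq hβ).1
  have hβ0' : 0 < β := by exact_mod_cast hβ0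
  have hq0 : 0 < q := by omega
  have hI := CWP.indexSet_nonempty hq (β : ℝ)
  obtain ⟨ρ, hρ, hsep⟩ := CWP.exists_separation hq hβ
  obtain ⟨ρ', hρ', hmono⟩ := CWP.exists_monochromatic_far hq hβ
  choose δ hδ N₁ hN₁ using fun j => CWP.exists_escapeProb_le hq hβ hρ hsep j
  obtain ⟨j₀, hj₀⟩ := Finite.exists_min δ
  set d := δ j₀ with hd
  have hd0 : 0 < d := hδ j₀
  -- The paths may climb only half the smallest barrier `d`, so the quotient retains `exp (-β N d /
  -- 2)`.
  obtain ⟨N₂, hN₂⟩ := CWP.exists_reachable_minimum hq hβ (half_pos hd0)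
  obtain ⟨N₃, hN₃⟩ := CWP.exists_dist_closestLatticePoint_lt q (lt_min hρ hρ')
  -- Half of the remaining exponent absorbs the polynomial factors. Their degree is `2 q` from the
  -- numerator and `4 q` from the denominator, plus one for the factor `N` in the rate bound.
  obtain ⟨N₄, hN₄⟩ := CWP.exists_mul_pow_le_exp
    ((q + 1) * 2 * Real.exp q ^ 2 * q * Real.exp (β * q)) (6 * q + 1)
    (by positivity : 0 < β * d / 4)
  refine ⟨β * d / 4, by positivity, (Finset.univ.sup N₁) + N₂ + N₃ + N₄, fun N hN m hm => ?_⟩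
  have hNpos : 0 < N := by omega
  have hN' : (0 : ℝ) < N := by exact_mod_cast hNpos
  have hclose : ∀ i : CWP.indexSet q β, dist (m i) (CWP.minimum q β i) < min ρ ρ' := fun i =>
    hN₃ N (by omega) _ (CWP.minimum_mem_stdSimplex hq hβ i) _ (hm i)
  set M : CWP.indexSet q β → Set (CWP.Config N q) :=
    fun i => CWP.empiricalMeasure N q ⁻¹' {m i} with hM
  have hne : ∀ i, (M i).Nonempty := fun i => by
    obtain ⟨σ, hσ⟩ := CWP.exists_config_of_mem_latticeSimplex hNpos hq0 (hm i).1
    exact ⟨σ, hσ⟩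
  have hdisj : Pairwise fun i j => Disjoint (M i) (M j) := by
    intro i j hij
    refine Set.disjoint_left.2 fun σ h1 h2 => ?_
    have e1 : CWP.empiricalMeasure N q σ = m i := h1
    have e2 : CWP.empiricalMeasure N q σ = m j := h2
    have a1 := (hclose i).trans_le (min_le_left _ _)
    have a2 := (hclose j).trans_le (min_le_left _ _)
    rw [← e1] at a1
    rw [← e2] at a2
    have a3 := hsep i j fun h => hij (Subtype.ext h)
    have a4 := dist_triangle_left (CWP.minimum q β i) (CWP.minimum q β j)
      (CWP.empiricalMeasure N q σ)
    linarith
  set T : ℝ := 2 * ((N + 1) ^ q * (((N + 1) ^ q) ^ 2 *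
    (Real.exp (q * (1 + Real.log (N + 1))) * Real.exp (β * N * (d / 2))) *
      (N * q * Real.exp (β * q)))) with hT
  have hq0' : (0 : ℝ) < q := by exact_mod_cast hq0
  have hT0 : 0 < T := by positivity
  set U : ℝ := (N + 1) ^ q * (Real.exp (q * (1 + Real.log (N + 1))) *
    Real.exp (-(β * N * d))) with hU
  have hU0 : 0 < U := by positivity
  have hden : ∀ X : {X : Set (CWP.Config N q) // X.Nonempty ∧ X ⊆ (⋃ i, M i)ᶜ},
      1 / T ≤ MarkovChain.escapeProb (CWP.glauber N q β) (CWP.gibbs N q β) X (⋃ i, M i) := by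
    rintro ⟨X, hX, hXM⟩
    have h := CWP.one_le_mul_escapeProb hNpos hq0 hβ0' (ε := d / 2) (M := ⋃ i, M i) hX
      (Set.disjoint_left.2 fun σ h1 h2 => hXM h1 h2)
      (fun σ hσ η hη => by
        obtain ⟨i, hi⟩ := Set.mem_iUnion.1 hσ
        refine Set.mem_iUnion.2 ⟨i, ?_⟩
        have hi' : CWP.empiricalMeasure N q σ = m i := hi
        exact ((CWP.empiricalMeasure_eq_iff hNpos η σ).2 hη).trans hi')
      (fun σ => by
        obtain ⟨i, η, hη, hr⟩ := hN₂ N (by omega) m hm σ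
        exact ⟨η, Set.mem_iUnion.2 ⟨i, hη⟩, hr⟩)
    rw [div_le_iff₀ hT0, mul_comm]
    exact h
  -- A monochromatic configuration lies outside every metastable set. Nonemptiness is essential: the
  -- real infimum of an empty family is 0.
  have hXne : Nonempty {X : Set (CWP.Config N q) // X.Nonempty ∧ X ⊆ (⋃ i, M i)ᶜ} := by
    obtain ⟨σ, hσ⟩ := hmono N hNpos
    refine ⟨⟨{σ}, Set.singleton_nonempty σ, ?_⟩⟩
    rw [Set.singleton_subset_iff, Set.mem_compl_iff, Set.mem_iUnion]
    rintro ⟨i, hi⟩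
    have hi' : CWP.empiricalMeasure N q σ = m i := hi
    have h1 := (hclose i).trans_le (min_le_right _ _)
    have h2 := hσ i
    rw [hi'] at h2
    linarith
  have hinf : 1 / T ≤ ⨅ X : {X : Set (CWP.Config N q) // X.Nonempty ∧ X ⊆ (⋃ i, M i)ᶜ},
      MarkovChain.escapeProb (CWP.glauber N q β) (CWP.gibbs N q β) X (⋃ i, M i) :=
    le_ciInf hden
  have hsup : (⨆ j, MarkovChain.escapeProb (CWP.glauber N q β) (CWP.gibbs N q β) (M j)
      ((⋃ i, M i) \ M j)) ≤ U := by
    refine ciSup_le fun j => ?_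
    have hNj : N₁ j < N := by
      have : N₁ j ≤ Finset.univ.sup N₁ := Finset.le_sup (Finset.mem_univ j)
      omega
    refine (hN₁ j N hNj m hm (hne j)).trans ?_
    rw [hU]
    gcongr
    exact hj₀ j
  have hinf0 := lt_of_lt_of_le (one_div_pos.2 hT0) hinf
  refine ⟨hne, hdisj, hinf0, ?_⟩
  have hratio : (⨆ j, MarkovChain.escapeProb (CWP.glauber N q β) (CWP.gibbs N q β) (M j)
      ((⋃ i, M i) \ M j)) / (⨅ X : {X : Set (CWP.Config N q) // X.Nonempty ∧ X ⊆ (⋃ i, M i)ᶜ},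
      MarkovChain.escapeProb (CWP.glauber N q β) (CWP.gibbs N q β) X (⋃ i, M i)) ≤ U * T := by
    rw [div_le_iff₀ hinf0]
    calc _ ≤ U := hsup
      _ = U * T * (1 / T) := by field_simp
      _ ≤ _ := mul_le_mul_of_nonneg_left hinf (by positivity)
  have hcard : (Fintype.card (CWP.indexSet q β) : ℝ) ≤ q + 1 := by
    have h1 : (CWP.indexSet q β).card ≤ q + 1 := by
      simpa using Finset.card_le_univ (CWP.indexSet q β)
    rw [Fintype.card_coe]
    exact_mod_cast h1
  have hfinal := hN₄ N (by omega)
  calc _ ≤ ((q : ℝ) + 1) * (U * T) := by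
        refine mul_le_mul hcard hratio ?_ (by positivity)
        exact div_nonneg (Real.iSup_nonneg fun j => measureReal_nonneg) hinf0.le
    _ = ((q + 1) * 2 * Real.exp q ^ 2 * q * Real.exp (β * q)) * (((N : ℝ) + 1) ^ (6 * q) * N) *
        (Real.exp (-(β * N * d)) * Real.exp (β * N * (d / 2))) := by
        rw [hU, hT, CWP.exp_mul_one_add_log]; ring
    _ ≤ ((q + 1) * 2 * Real.exp q ^ 2 * q * Real.exp (β * q)) * (((N : ℝ) + 1) ^ (6 * q + 1)) *
        (Real.exp (-(β * N * d)) * Real.exp (β * N * (d / 2))) := by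
        rw [pow_succ ((N : ℝ) + 1) (6 * q)]
        gcongr
        linarith
    _ ≤ Real.exp (β * d / 4 * N) * (Real.exp (-(β * N * d)) * Real.exp (β * N * (d / 2))) :=
        mul_le_mul_of_nonneg_right hfinal (by positivity)
    _ = Real.exp (-(β * d / 4) * N) := by
        rw [← Real.exp_add, ← Real.exp_add]
        congr 1
        ring
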